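/- For $x\in\{-1,1\}^n$ let $x\odot e_i$ be $x$ with the $i$-th coordinate negated. A function $g:\{-1,1\}^n\to\{-1,1\}$ is a $k$-junta if at most $k$ of the variables are relevant to it, where $x_i$ is relevant to $g$ if $g(x\odot e_i)\neq g(x)$ for some $x$. For $f:\{-1,1\}^n\to\{-1,1\}$ let $\operatorname{opt}_k(f)=\min_g \Pr_x[g(x)\neq f(x)]$, where $g$ ranges over the $k$-juntas on $\{-1,1\}^n$ and $x$ is uniform on $\{-1,1\}^n$. The oracle $\operatorname{RW}(f)$ returns, on successive requests, $(x^0,f(x^0)),(x^1,f(x^1)),\ldots$, where $x^0$ is uniform on $\{-1,1\}^n$ and $x^{t+1}=x^t\odot e_{i_t}$ with $i_t\in\{1,\ldots,n\}$ uniform, all these choices being independent. Theorem. The class of $k$-juntas is properly agnostically learnable from a labeled random walk: there is a single algorithm (a deterministic program for a random access machine with unit-cost addition and subtraction) and a polynomial $q$ with non-negative integer coefficients such that the following holds for all integers $n\geq 1$, $k\geq 1$, all reals $\epsilon,\delta>0$, and every function $f:\{-1,1\}^n\to\{-1,1\}$. Given $n$, $k$, the binary digits of $\min\{\epsilon,1\}$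 and $\min\{\delta,1\}$, and access to $\operatorname{RW}(f)$, the algorithm always halts after at most \[q\bigl(n,\;2^{k^2},\;(1/\epsilon)^k,\;\log(1/\delta)\bigr)\] steps and always outputs a $k$-junta $h$ (as a list of at most $k$ variables and a truth table over them); and with probability at least $1-\delta$ over the random walk, \[\Pr_x[h(x)\neq f(x)]\leq \operatorname{opt}_k(f)+\epsilon .\] -/

import Mathlib

open MeasureTheory

/-! ## Boolean functions on the cube -/

/-- The cube `{-1,1}^n`. -/
abbrev Cube (n : ℕ) : Type := Fin n → ℤˣ

/-- The vector `e_i`: all entries `+1`, except the `i`-th, which is `-1`. -/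
def flipVec {n : ℕ} (i : Fin n) : Cube n := fun j => if j = i then -1 else 1

/-- The set of (indices of) variables that are relevant to `g`. -/
def relevantVars {n : ℕ} (g : Cube n → ℤˣ) : Set (Fin n) :=
  {i | ∃ x : Cube n, g (x * flipVec i) ≠ g x}

/-- `g` is a `k`-junta: it depends on at most `k` variables. -/
def IsJunta {n : ℕ} (k : ℕ) (g : Cube n → ℤˣ) : Prop := (relevantVars g).ncard ≤ k

/-- `Pr[g(x) ≠ f(x)]` for `x` uniform on the cube. -/
noncomputable def cubeDist {n : ℕ} (g f : Cube n → ℤˣ) : ℝ :=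
  ({x : Cube n | g x ≠ f x}.ncard : ℝ) / 2 ^ n

/-- The distance from `f` to a closest `k`-junta. -/
noncomputable def optJunta {n : ℕ} (k : ℕ) (f : Cube n → ℤˣ) : ℝ :=
  sInf {d : ℝ | ∃ g : Cube n → ℤˣ, IsJunta k g ∧ d = cubeDist g f}

/-! ## The random walk on the cube -/

/-- Every subset of `{-1,1}` is measurable. -/
instance : DiscreteMeasurableSpace ℤˣ :=
  ⟨fun s => ⟨Units.val '' s, .of_discrete, Set.preimage_image_eq s Units.val_injective⟩⟩

/-- Sample space of the random walk: a starting point and the coordinates flipped in turn. -/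
abbrev WalkSpace (n : ℕ) : Type := Cube n × (ℕ → Fin n)

/-- The point visited at time `t`. -/
def walk {n : ℕ} (w : WalkSpace n) : ℕ → Cube n
  | 0 => w.1
  | t + 1 => walk w t * flipVec (w.2 t)

/-- The starting point is uniform, the flipped coordinates are uniform, all independent. -/
noncomputable def walkMeasure (n : ℕ) [NeZero n] : Measure (WalkSpace n) :=
  (PMF.uniformOfFintype (Cube n)).toMeasure.prod
    (Measure.infinitePi fun _ : ℕ => (PMF.uniformOfFintype (Fin n)).toMeasure)

/-! ## Random access machines with an example oracle

Programs work on a memory of natural numbers. Every elementary operation and every test costs one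
step; the only arithmetic is addition and truncated subtraction, so that a number grows by at most
one bit per step and the step count is polynomially related to that of a Turing machine. A program
does not depend on any of the parameters of the learning problem. -/

/-- Programs. Below, `m[a]` is the content of memory cell `a`. -/
inductive Prog : Type
  /-- do nothing -/
  | skip : Prog
  /-- `m[d] := c` -/
  | const (d c : ℕ) : Prog
  /-- `m[d] := m[a] + m[b]` -/
  | add (d a b : ℕ) : Prog
  /-- `m[d] := m[a] - m[b]`, truncated at `0` -/
  | sub (d a b : ℕ) : Prog
  /-- `m[d] := m[m[a]]` -/
  | load (d a : ℕ) : Prog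
  /-- `m[m[a]] := m[b]` -/
  | store (a b : ℕ) : Prog
  /-- request the next labeled example from the oracle -/
  | request : Prog
  /-- write coordinate number `m[a]` of the current example to `m[d]` (as a bit) -/
  | coord (d a : ℕ) : Prog
  /-- write the label of the current example to `m[d]` (as a bit) -/
  | label (d : ℕ) : Prog
  /-- write the next binary digit of the accuracy parameter to `m[d]` -/
  | epsDigit (d : ℕ) : Prog
  /-- write the next binary digit of the confidence parameter to `m[d]` -/
  | deltaDigit (d : ℕ) : Prog
  /-- append `m[a]` to the output -/
  | emit (a : ℕ) : Prog
  /-- sequential composition -/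
  | seq (p q : Prog) : Prog
  /-- if `m[a] ≠ 0` then `p` else `q` -/
  | ite (a : ℕ) (p q : Prog) : Prog
  /-- while `m[a] ≠ 0` do `p` -/
  | loop (a : ℕ) (p : Prog) : Prog

/-- What a program can access but not change: the accuracy and confidence parameters, and the
labeled examples that the oracle returns on successive requests. -/
structure Env (n : ℕ) where
  eps : ℝ
  delta : ℝ
  examples : ℕ → Cube n × ℤˣ

/-- State of a computation: memory, number of examples requested so far, the last example received
(if any), number of digits of the two parameters read so far, and the output written so far. -/
structure State (n : ℕ) where
  mem : ℕ → ℕ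
  asked : ℕ
  current : Option (Cube n × ℤˣ)
  epsRead : ℕ
  deltaRead : ℕ
  out : List ℕ

/-- Signs as bits: `+1` is `0` and `-1` is `1`. -/
def signBit (s : ℤˣ) : ℕ := if s = -1 then 1 else 0

/-- The coordinate with (zero-based) number `i` of the current example as a bit; `0` if there is
none. -/
def coordBit {n : ℕ} (c : Option (Cube n × ℤˣ)) (i : ℕ) : ℕ :=
  match c with
  | none => 0
  | some e => if hi : i < n then signBit (e.1 ⟨i, hi⟩) else 0

/-- The label of the current example as a bit; `0` if there is no example yet. -/
def labelBit {n : ℕ} (c : Option (Cube n × ℤˣ)) : ℕ :=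
  match c with
  | none => 0
  | some e => signBit e.2

/-- The digits of the binary expansion of `min r 1`; digit number `0` is the one before the binary
point, digit number `i` has weight `2^(-i)`. -/
noncomputable def binDigit (r : ℝ) (i : ℕ) : ℕ := ⌊min r 1 * 2 ^ i⌋₊ % 2

/-- Writing `v` to memory cell `d`. -/
def State.write {n : ℕ} (s : State n) (d v : ℕ) : State n :=
  { s with mem := Function.update s.mem d v }

/-- `Runs E p s t s'`: started in state `s`, the program `p` halts in state `s'` after exactly
`t` steps. -/
inductive Runs {n : ℕ} (E : Env n) : Prog → State n → ℕ → State n → Prop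
  | skip (s : State n) : Runs E .skip s 1 s
  | const (s : State n) (d c : ℕ) : Runs E (.const d c) s 1 (s.write d c)
  | add (s : State n) (d a b : ℕ) :
      Runs E (.add d a b) s 1 (s.write d (s.mem a + s.mem b))
  | sub (s : State n) (d a b : ℕ) :
      Runs E (.sub d a b) s 1 (s.write d (s.mem a - s.mem b))
  | load (s : State n) (d a : ℕ) :
      Runs E (.load d a) s 1 (s.write d (s.mem (s.mem a)))
  | store (s : State n) (a b : ℕ) :
      Runs E (.store a b) s 1 (s.write (s.mem a) (s.mem b))
  | request (s : State n) :
      Runs E .request s 1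
        { s with asked := s.asked + 1, current := some (E.examples s.asked) }
  | coord (s : State n) (d a : ℕ) :
      Runs E (.coord d a) s 1 (s.write d (coordBit s.current (s.mem a)))
  | label (s : State n) (d : ℕ) :
      Runs E (.label d) s 1 (s.write d (labelBit s.current))
  | epsDigit (s : State n) (d : ℕ) :
      Runs E (.epsDigit d) s 1
        { s.write d (binDigit E.eps s.epsRead) with epsRead := s.epsRead + 1 }
  | deltaDigit (s : State n) (d : ℕ) :
      Runs E (.deltaDigit d) s 1
        { s.write d (binDigit E.delta s.deltaRead) with deltaRead := s.deltaRead + 1 }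
  | emit (s : State n) (a : ℕ) :
      Runs E (.emit a) s 1 { s with out := s.out ++ [s.mem a] }
  | seq {p q : Prog} {s₁ s₂ s₃ : State n} {t₁ t₂ : ℕ} :
      Runs E p s₁ t₁ s₂ → Runs E q s₂ t₂ s₃ → Runs E (.seq p q) s₁ (t₁ + t₂) s₃
  | ite_true {a : ℕ} {p q : Prog} {s s' : State n} {t : ℕ} :
      s.mem a ≠ 0 → Runs E p s t s' → Runs E (.ite a p q) s (t + 1) s'
  | ite_false {a : ℕ} {p q : Prog} {s s' : State n} {t : ℕ} :
      s.mem a = 0 → Runs E q s t s' → Runs E (.ite a p q) s (t + 1) s'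
  | loop_stop {a : ℕ} {p : Prog} {s : State n} :
      s.mem a = 0 → Runs E (.loop a p) s 1 s
  | loop_step {a : ℕ} {p : Prog} {s₁ s₂ s₃ : State n} {t₁ t₂ : ℕ} :
      s₁.mem a ≠ 0 → Runs E p s₁ t₁ s₂ → Runs E (.loop a p) s₂ t₂ s₃ →
        Runs E (.loop a p) s₁ (t₁ + t₂ + 1) s₃

/-- Computations are deterministic: running time and final state are determined by the program,
the environment and the initial state. -/
theorem Runs.unique {n : ℕ} {E : Env n} {p : Prog} {s s₁ s₂ : State n} {t₁ t₂ : ℕ}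
    (h₁ : Runs E p s t₁ s₁) (h₂ : Runs E p s t₂ s₂) : t₁ = t₂ ∧ s₁ = s₂ := by
  induction h₁ generalizing t₂ s₂ with
  | seq _ _ ih₁ ih₂ =>
    cases h₂ with
    | seq k₁ k₂ =>
      obtain ⟨rfl, rfl⟩ := ih₁ k₁
      obtain ⟨rfl, rfl⟩ := ih₂ k₂
      exact ⟨rfl, rfl⟩
  | ite_true h _ ih =>
    cases h₂ with
    | ite_true _ k =>
      obtain ⟨rfl, rfl⟩ := ih k
      exact ⟨rfl, rfl⟩
    | ite_false h' _ => exact absurd h' h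
  | ite_false h _ ih =>
    cases h₂ with
    | ite_true h' _ => exact absurd h h'
    | ite_false _ k =>
      obtain ⟨rfl, rfl⟩ := ih k
      exact ⟨rfl, rfl⟩
  | loop_stop h =>
    cases h₂ with
    | loop_stop _ => exact ⟨rfl, rfl⟩
    | loop_step h' _ _ => exact absurd h h'
  | loop_step h _ _ ih₁ ih₂ =>
    cases h₂ with
    | loop_stop h' => exact absurd h' h
    | loop_step _ k₁ k₂ =>
      obtain ⟨rfl, rfl⟩ := ih₁ k₁
      obtain ⟨rfl, rfl⟩ := ih₂ k₂
      exact ⟨rfl, rfl⟩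
  | _ => cases h₂; exact ⟨rfl, rfl⟩

/-- The initial state: cells `0` and `1` hold `n` and `k`, everything else is blank. -/
def initState (n k : ℕ) : State n where
  mem := fun a => if a = 0 then n else if a = 1 then k else 0
  asked := 0
  current := none
  epsRead := 0
  deltaRead := 0
  out := []

/-- The environment in which a learner runs: parameters `ε`, `δ`, and the random walk labeled
by `f`. -/
def learnEnv {n : ℕ} (ε δ : ℝ) (f : Cube n → ℤˣ) (w : WalkSpace n) : Env n where
  eps := ε
  delta := δ
  examples := fun t => (walk w t, f (walk w t))

/-- `HaltsWith p k ε δ f w t l`: on input `n`, `k`, `ε`, `δ`, with access to the walk `w` labeled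
by `f`, the program `p` halts after exactly `t` steps with output `l`. -/
def HaltsWith {n : ℕ} (p : Prog) (k : ℕ) (ε δ : ℝ) (f : Cube n → ℤˣ) (w : WalkSpace n)
    (t : ℕ) (l : List ℕ) : Prop :=
  ∃ s : State n, Runs (learnEnv ε δ f w) p (initState n k) t s ∧ s.out = l

/-! ## Hypotheses as output -/

/-- The position in a truth table over the list `J` of variables that belongs to the point `x`:
the number whose binary digits, lowest first, are the bits of `x` at the variables in `J`. -/
def tableIndex {n : ℕ} (x : Cube n) : List (Fin n) → ℕ
  | [] => 0
  | i :: J => signBit (x i) + 2 * tableIndex x J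

/-- `l` describes `h` as a function of at most `k` explicitly listed variables: `l` consists of the
number of these variables, their indices, and the truth table of `h` over them. -/
def IsJuntaCode {n : ℕ} (k : ℕ) (l : List ℕ) (h : Cube n → ℤˣ) : Prop :=
  ∃ (J : List (Fin n)) (T : List ℕ), J.length ≤ k ∧ T.length = 2 ^ J.length ∧
    l = J.length :: (J.map (fun i => (i : ℕ)) ++ T) ∧
    ∀ x : Cube n, T[tableIndex x J]? = some (signBit (h x))

/-!
A labeled random walk gives access to correlations between labels at different times, and these
reveal which variables matter. Let `y` be a stationary point of the walk and suppose that the next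
step flips variable `i`. The change `f (y ⊙ eᵢ) - f y` has Fourier support on the sets `S ∋ i`, and
the labels seen `2n` and `2n + 1` steps later average to `T ^ (2n) ((1 + T) / 2) f` in conditional
expectation, where `T` is the transition operator, with eigenvalue `1 - 2s/n` on characters of
degree `s`. Their correlation is therefore `walkInfluence f i`, the sum of
`weight n |S| * coeff f S ^ 2` over `S ∋ i` (`mean_sub_flip_mul`). The weight is at least a constant
to the power `-k` for degrees up to `k` if `n > 4k` (`le_weight`), so that a variable of small walk
influence carries little Fourier weight of degree up to `k` (`lowWeight_le`); and
`s * weight n s ≤ 1/4` (`mul_weight_le`), so that the walk influences sum up to at most `1/4`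
(`sum_walkInfluence_le`) and only `2 ^ O(k) / ε ^ 2` variables have a large one. The average over an
even and an odd time keeps the weight nonnegative and small near degree `n`.

The program estimates all walk influences, lists the variables whose estimate is large, and outputs
the best function, on a sample taken from the same walk, of `k` variables from the list. Dropping
the other variables from an optimal junta costs at most half the square root of the lost Fourier
weight (`exists_bestOn_close`), which the choice of the threshold makes a small multiple of `ε`. The
list has at most `2 ^ (20k) / ε ^ 2`-many entries, up to a constant factor, and the number of
`k`-tuples from it is polynomial in `2 ^ (k ^ 2)` and `(1 / ε) ^ k`.

The walk is periodic: after many steps it is uniform on a parity class only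
(`abs_trans_iterate_sub_le`). It is cut into an even number of blocks of odd length, each of which
first runs long enough to mix within its class. The parity of the position then alternates from
block to block, and its contribution to sums over all blocks cancels (`abs_sum_condMean_sub_le`).
The deviations from the conditional means of the blocks are controlled by exponential moments
(`pathAvg_exp_le`); a union bound over variables and hypotheses gives `le_walkMeasure_typical`, and
`cubeDist_hypothesis_le` draws the conclusion. Expectations over the walk are handled as finite
averages `pathAvg` and connected to the product measure in `one_sub_le_walkMeasure`.

The program is written in a small language with scalar variables, arrays and counted loops. Its
commands have a functional semantics `Cmd.exec`, are compiled to machine programs that simulate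
them (`Cmd.runs_compile`), and take time polynomial in a bound for their loops
(`Cmd.exists_cost_le`). The digits of the parameters are used only to round `ε` and `δ` down to
powers of two.
-/


namespace JuntaWalk

variable {n : ℕ}

/-! ### Walsh–Fourier analysis on the cube -/

/-- The expectation of `g` at a uniform point of the cube. -/
noncomputable def mean (g : Cube n → ℝ) : ℝ := (∑ x, g x) / 2 ^ n

/-- The Walsh character `χ_S`, the product of the coordinates in `S`. -/
noncomputable def chi (S : Finset (Fin n)) (x : Cube n) : ℝ := ∏ i ∈ S, ((x i : ℤ) : ℝ)

/-- The Fourier coefficient of `g` at `S`. -/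
noncomputable def coeff (g : Cube n → ℝ) (S : Finset (Fin n)) : ℝ :=
  mean fun x => g x * chi S x

theorem card_cube : Fintype.card (Cube n) = 2 ^ n := by
  simp [Cube, Fintype.card_units_int]

theorem mean_add (g h : Cube n → ℝ) : mean (fun x => g x + h x) = mean g + mean h := by
  simp [mean, Finset.sum_add_distrib, add_div]

theorem mean_sub (g h : Cube n → ℝ) : mean (fun x => g x - h x) = mean g - mean h := by
  simp [mean, Finset.sum_sub_distrib, sub_div]

theorem mean_mul_left (c : ℝ) (g : Cube n → ℝ) : mean (fun x => c * g x) = c * mean g := by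
  simp [mean, ← Finset.mul_sum, mul_div_assoc]

theorem mean_sum {ι : Type*} (s : Finset ι) (g : ι → Cube n → ℝ) :
    mean (fun x => ∑ i ∈ s, g i x) = ∑ i ∈ s, mean (g i) := by
  simp only [mean]
  rw [Finset.sum_comm, Finset.sum_div]

theorem mean_const (c : ℝ) : mean (fun _ : Cube n => c) = c := by
  simp only [mean, Finset.sum_const, Finset.card_univ, card_cube, nsmul_eq_mul]
  push_cast
  field_simp

theorem mean_mono {g h : Cube n → ℝ} (H : ∀ x, g x ≤ h x) : mean g ≤ mean h := by
  unfold mean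
  gcongr with x
  exact H x

theorem abs_mean_le {g : Cube n → ℝ} {c : ℝ} (H : ∀ x, |g x| ≤ c) : |mean g| ≤ c := by
  refine abs_le.2 ⟨?_, ?_⟩
  · rw [← mean_const (n := n) (-c)]
    exact mean_mono fun x => (abs_le.1 (H x)).1
  · rw [← mean_const (n := n) c]
    exact mean_mono fun x => (abs_le.1 (H x)).2

theorem mean_flip (g : Cube n → ℝ) (i : Fin n) : mean (fun x => g (x * flipVec i)) = mean g := by
  simp only [mean]
  congr 1
  exact Equiv.sum_comp (Equiv.mulRight (flipVec i)) g

theorem flipVec_mul_self (i : Fin n) : flipVec i * flipVec i = 1 := by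
  ext j
  simp only [flipVec, Pi.mul_apply, Pi.one_apply]
  split <;> simp

theorem mul_flipVec_mul_flipVec (x : Cube n) (i : Fin n) : x * flipVec i * flipVec i = x := by
  rw [mul_assoc, flipVec_mul_self, mul_one]

/-- Flipping a coordinate is an involution, so it can be moved from one factor to the other. -/
theorem mean_flip_mul (g h : Cube n → ℝ) (i : Fin n) :
    mean (fun x => g (x * flipVec i) * h x) = mean fun x => g x * h (x * flipVec i) := by
  rw [← mean_flip (fun x => g x * h (x * flipVec i)) i]
  simp [mul_flipVec_mul_flipVec]

theorem intCast_sq_unit (u : ℤˣ) : ((u : ℤ) : ℝ) * ((u : ℤ) : ℝ) = 1 := by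
  rcases Int.units_eq_one_or u with rfl | rfl <;> simp

theorem chi_flip (S : Finset (Fin n)) (x : Cube n) (i : Fin n) :
    chi S (x * flipVec i) = (if i ∈ S then -1 else 1) * chi S x := by
  have : ∀ j, (((x * flipVec i) j : ℤˣ) : ℤ) = ((if j = i then (-1 : ℤ) else 1)) * (x j : ℤ) := by
    intro j
    simp only [flipVec, Pi.mul_apply]
    split <;> simp
  simp only [chi, this]
  push_cast
  rw [Finset.prod_mul_distrib]
  congr 1
  simp [Finset.prod_ite_eq']

theorem chi_sq (S : Finset (Fin n)) (x : Cube n) : chi S x * chi S x = 1 := by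
  simp only [chi, ← Finset.prod_mul_distrib]
  exact Finset.prod_eq_one fun i _ => intCast_sq_unit _

theorem abs_chi (S : Finset (Fin n)) (x : Cube n) : |chi S x| = 1 := by
  rcases mul_self_eq_one_iff.1 (chi_sq S x) with h | h <;> simp [h]

theorem chi_empty (x : Cube n) : chi ∅ x = 1 := by simp [chi]

theorem chi_congr {S : Finset (Fin n)} {x y : Cube n} (h : ∀ i ∈ S, x i = y i) :
    chi S x = chi S y :=
  Finset.prod_congr rfl fun i hi => by rw [h i hi]

/-- Orthonormality of the characters. -/
theorem mean_chi_mul_chi (S R : Finset (Fin n)) :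
    mean (fun x => chi S x * chi R x) = if S = R then 1 else 0 := by
  split_ifs with h
  · subst h
    simp only [chi_sq]
    exact mean_const 1
  · obtain ⟨i, hi⟩ : ∃ i, ¬ (i ∈ S ↔ i ∈ R) := by
      by_contra! hc
      exact h (Finset.ext hc)
    have h1 := mean_flip (fun x => chi S x * chi R x) i
    have h2 : ∀ x, chi S (x * flipVec i) * chi R (x * flipVec i) = (-1) * (chi S x * chi R x) := by
      intro x
      rw [chi_flip, chi_flip]
      by_cases hS : i ∈ S <;> by_cases hR : i ∈ R <;> simp_all
    simp only [h2, mean_mul_left] at h1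
    linarith

theorem sum_chi_mul_chi (x y : Cube n) :
    ∑ S : Finset (Fin n), chi S x * chi S y = if x = y then 2 ^ n else 0 := by
  simp only [chi, ← Finset.prod_mul_distrib]
  rw [← Finset.powerset_univ, ← Finset.prod_one_add]
  split_ifs with h
  · subst h
    simp only [intCast_sq_unit]
    norm_num
  · obtain ⟨i, hi⟩ := Function.ne_iff.1 h
    refine Finset.prod_eq_zero (Finset.mem_univ i) ?_
    rcases Int.units_eq_one_or (x i) with h1 | h1 <;>
      rcases Int.units_eq_one_or (y i) with h2 | h2 <;> simp_all

/-- Fourier inversion. -/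
theorem sum_coeff_mul_chi (g : Cube n → ℝ) (x : Cube n) : ∑ S, coeff g S * chi S x = g x := by
  have h : ∀ S : Finset (Fin n), coeff g S * chi S x
      = (∑ y, g y * (chi S y * chi S x)) / 2 ^ n := by
    intro S
    simp only [coeff, mean, div_mul_eq_mul_div, Finset.sum_mul, mul_assoc]
  simp only [h]
  rw [← Finset.sum_div, Finset.sum_comm]
  simp only [← Finset.mul_sum, sum_chi_mul_chi]
  simp

/-- Parseval's identity. -/
theorem mean_mul (g h : Cube n → ℝ) : mean (fun x => g x * h x) = ∑ S, coeff g S * coeff h S := by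
  have e : ∀ x, g x * h x = ∑ S, coeff h S * (g x * chi S x) := by
    intro x
    conv_lhs => rw [← sum_coeff_mul_chi h x]
    rw [Finset.mul_sum]
    exact Finset.sum_congr rfl fun S _ => by ring
  simp only [e, mean_sum, mean_mul_left]
  exact Finset.sum_congr rfl fun S _ => by rw [mul_comm]; rfl

theorem abs_coeff_le {g : Cube n → ℝ} (hg : ∀ x, |g x| ≤ 1) (S : Finset (Fin n)) :
    |coeff g S| ≤ 1 :=
  abs_mean_le fun x => by rw [abs_mul, abs_chi, mul_one]; exact hg x

theorem coeff_empty (g : Cube n → ℝ) : coeff g ∅ = mean g := by simp [coeff, chi_empty]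

/-- The transition operator of the random walk. -/
noncomputable def trans (g : Cube n → ℝ) (x : Cube n) : ℝ := (∑ i, g (x * flipVec i)) / n

/-- The eigenvalue of the transition operator on characters of degree `s`. -/
noncomputable def eig (n s : ℕ) : ℝ := 1 - 2 * s / n

theorem coeff_trans [NeZero n] (g : Cube n → ℝ) (S : Finset (Fin n)) :
    coeff (trans g) S = eig n S.card * coeff g S := by
  have hn : (n : ℝ) ≠ 0 := Nat.cast_ne_zero.2 (NeZero.ne n)
  have e : ∀ x, trans g x * chi S x = (n : ℝ)⁻¹ * ∑ i, g (x * flipVec i) * chi S x := by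
    intro x
    rw [trans, ← Finset.sum_mul]
    ring
  have hs : ∑ i : Fin n, (if i ∈ S then (-1 : ℝ) else 1) = n - 2 * S.card := by
    have : ∀ i : Fin n, (if i ∈ S then (-1 : ℝ) else 1) = 1 - 2 * if i ∈ S then 1 else 0 := by
      intro i
      split_ifs <;> norm_num
    simp only [this, Finset.sum_sub_distrib, ← Finset.mul_sum]
    simp
  unfold coeff
  simp only [e, mean_mul_left, mean_sum, mean_flip_mul, chi_flip]
  have e2 : ∀ i x, g x * ((if i ∈ S then (-1 : ℝ) else 1) * chi S x)
      = (if i ∈ S then (-1 : ℝ) else 1) * (g x * chi S x) := fun i x => by ring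
  simp only [e2, mean_mul_left, ← Finset.sum_mul, hs, eig]
  field_simp

theorem coeff_trans_iterate [NeZero n] (g : Cube n → ℝ) (S : Finset (Fin n)) (m : ℕ) :
    coeff (trans^[m] g) S = eig n S.card ^ m * coeff g S := by
  induction m with
  | zero => simp
  | succ m ih => rw [Function.iterate_succ_apply', coeff_trans, ih, pow_succ]; ring

/-- All eigenvalues other than those of the constants and of the full parity are at most
`1 - 2/n` in absolute value. -/
theorem abs_eig_le {s : ℕ} (hs : s ≠ 0) (hsn : s < n) : |eig n s| ≤ 1 - 2 / n := by
  have hn : (0 : ℝ) < n := by exact_mod_cast (Nat.zero_lt_of_lt hsn)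
  have h1 : (1 : ℝ) ≤ s := by exact_mod_cast Nat.one_le_iff_ne_zero.2 hs
  have h2 : (s : ℝ) + 1 ≤ n := by exact_mod_cast hsn
  have h3 : eig n s = (n - 2 * s) / n := by
    unfold eig
    field_simp
  have h4 : (1 : ℝ) - 2 / n = (n - 2) / n := by field_simp
  rw [h3, h4, abs_div, abs_of_pos hn]
  gcongr
  rw [abs_le]
  constructor <;> linarith

/-- Mixing up to parity: after `m` steps the walk is uniform on a parity class, up to an
exponentially small error. -/
theorem abs_trans_iterate_sub_le [NeZero n] {g : Cube n → ℝ} (hg : ∀ x, |g x| ≤ 1) (m : ℕ)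
    (x : Cube n) :
    |trans^[m] g x - mean g - (-1) ^ m * coeff g Finset.univ * chi Finset.univ x|
      ≤ 2 ^ n * Real.exp (-(2 * m / n)) := by
  classical
  have hn : (n : ℝ) ≠ 0 := Nat.cast_ne_zero.2 (NeZero.ne n)
  have hne : (∅ : Finset (Fin n)) ≠ Finset.univ :=
    (Finset.univ_nonempty (α := Fin n)).ne_empty.symm
  have hx := sum_coeff_mul_chi (trans^[m] g) x
  rw [← Finset.add_sum_erase _ _ (Finset.mem_univ (∅ : Finset (Fin n))),
    ← Finset.add_sum_erase _ _
      (Finset.mem_erase.2 ⟨hne.symm, Finset.mem_univ (Finset.univ : Finset (Fin n))⟩)] at hx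
  simp only [coeff_trans_iterate, chi_empty] at hx
  have e0 : eig n (∅ : Finset (Fin n)).card = 1 := by simp [eig]
  have e1 : eig n (Finset.univ : Finset (Fin n)).card = -1 := by
    simp only [eig, Finset.card_univ, Fintype.card_fin]
    field_simp
    norm_num
  rw [e0, e1, coeff_empty] at hx
  rw [← hx]
  have : ∀ a b c : ℝ, 1 ^ m * a * 1 + (b + c) - a - b = c := fun a b c => by ring
  rw [this]
  refine (Finset.abs_sum_le_sum_abs _ _).trans ?_
  have hb : ∀ S ∈ ((Finset.univ : Finset (Finset (Fin n))).erase ∅).erase Finset.univ,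
      |eig n S.card ^ m * coeff g S * chi S x| ≤ Real.exp (-(2 * m / n)) := by
    intro S hS
    simp only [Finset.mem_erase, Finset.mem_univ, and_true] at hS
    rw [abs_mul, abs_mul, abs_chi, mul_one, abs_pow]
    have h1 : S.card ≠ 0 := by simpa using hS.2
    have h2 : S.card < n := by simpa using (Finset.card_lt_iff_ne_univ S).2 hS.1
    have h3 := abs_eig_le h1 h2
    have h4 : |eig n S.card| ≤ Real.exp (-(2 / n)) :=
      h3.trans (Real.one_sub_le_exp_neg _)
    calc |eig n S.card| ^ m * |coeff g S| ≤ Real.exp (-(2 / n)) ^ m * 1 := by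
          gcongr
          exact abs_coeff_le hg S
      _ = Real.exp (-(2 * m / n)) := by
          rw [mul_one, ← Real.exp_nat_mul]
          congr 1
          ring
  refine (Finset.sum_le_card_nsmul _ _ _ hb).trans ?_
  rw [nsmul_eq_mul]
  gcongr
  have : (((Finset.univ : Finset (Finset (Fin n))).erase ∅).erase Finset.univ).card ≤ 2 ^ n := by
    refine (Finset.card_le_univ _).trans ?_
    simp
  exact_mod_cast this

/-! ### Approximation by juntas on few candidate variables -/

/-- A sign-valued function as a real-valued function. -/
def toReal (f : Cube n → ℤˣ) (x : Cube n) : ℝ := ((f x : ℤ) : ℝ)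

theorem abs_toReal (f : Cube n → ℤˣ) (x : Cube n) : |toReal f x| = 1 := by
  rcases Int.units_eq_one_or (f x) with h | h <;> simp [toReal, h]

theorem cubeDist_eq_mean (g f : Cube n → ℤˣ) :
    cubeDist g f = mean fun x => if g x ≠ f x then 1 else 0 := by
  classical
  rw [cubeDist, mean, Set.ncard_eq_toFinset_card', Finset.sum_boole]
  congr 3
  ext x
  simp

theorem cubeDist_eq (g f : Cube n → ℤˣ) :
    cubeDist g f = (1 - mean fun x => toReal f x * toReal g x) / 2 := by
  have h : ∀ x, (if g x ≠ f x then (1 : ℝ) else 0) = 2⁻¹ * (1 - toReal f x * toReal g x) := by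
    intro x
    rcases Int.units_eq_one_or (f x) with hf | hf <;>
      rcases Int.units_eq_one_or (g x) with hg | hg <;> simp [toReal, hf, hg] <;> norm_num
  rw [cubeDist_eq_mean]
  simp only [h, mean_mul_left, mean_sub, mean_const]
  ring

theorem coeff_eq_zero_of_flip {g : Cube n → ℝ} {i : Fin n} (hg : ∀ x, g (x * flipVec i) = g x)
    {S : Finset (Fin n)} (hi : i ∈ S) : coeff g S = 0 := by
  have h := mean_flip (fun x => g x * chi S x) i
  have e : ∀ x, g (x * flipVec i) * chi S (x * flipVec i) = (-1) * (g x * chi S x) := by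
    intro x
    rw [hg, chi_flip, if_pos hi]
    ring
  simp only [e, mean_mul_left] at h
  unfold coeff
  linarith

/-- The part of the Fourier expansion of `f` over subsets of `J`; this is the conditional
expectation of `f` given the coordinates in `J`. -/
noncomputable def project (f : Cube n → ℝ) (J : Finset (Fin n)) (x : Cube n) : ℝ :=
  ∑ S ∈ J.powerset, coeff f S * chi S x

theorem mean_mul_eq_project (f g : Cube n → ℝ) (J : Finset (Fin n))
    (hg : ∀ i ∉ J, ∀ x, g (x * flipVec i) = g x) :
    mean (fun x => f x * g x) = mean fun x => project f J x * g x := by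
  have e : ∀ x, project f J x * g x = ∑ S ∈ J.powerset, coeff f S * (g x * chi S x) := by
    intro x
    rw [project, Finset.sum_mul]
    exact Finset.sum_congr rfl fun S _ => by ring
  rw [mean_mul]
  simp only [e, mean_sum, mean_mul_left]
  symm
  refine Finset.sum_subset (Finset.subset_univ _) fun S _ hS => ?_
  obtain ⟨i, hi, hiJ⟩ := Finset.not_subset.1 (fun h => hS (Finset.mem_powerset.2 h))
  rw [show mean (fun x => g x * chi S x) = 0 from coeff_eq_zero_of_flip (hg i hiJ) hi, mul_zero]

theorem project_congr (f : Cube n → ℝ) {J : Finset (Fin n)} {x y : Cube n}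
    (h : ∀ i ∈ J, x i = y i) : project f J x = project f J y :=
  Finset.sum_congr rfl fun S hS => by
    rw [chi_congr fun i hi => h i (Finset.mem_powerset.1 hS hi)]

theorem sq_mean_abs_le (g : Cube n → ℝ) : mean (fun x => |g x|) ^ 2 ≤ mean fun x => g x * g x := by
  have h := mean_mono (n := n) (g := fun _ => 0)
    (h := fun x => (|g x| - mean fun x => |g x|) * (|g x| - mean fun x => |g x|))
    fun x => mul_self_nonneg _
  set m := mean fun x => |g x| with hm
  have e : ∀ x, (|g x| - m) * (|g x| - m) = g x * g x - ((2 * m) * |g x| - m ^ 2) := by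
    intro x
    have := abs_mul_abs_self (g x)
    linear_combination this
  simp only [e, mean_sub, mean_mul_left, mean_const] at h
  nlinarith [h, hm]

theorem mean_sum_coeff_sq (c : Finset (Fin n) → ℝ) (D : Finset (Finset (Fin n))) :
    mean (fun x => (∑ S ∈ D, c S * chi S x) * (∑ S ∈ D, c S * chi S x)) = ∑ S ∈ D, c S ^ 2 := by
  have e : ∀ x, (∑ S ∈ D, c S * chi S x) * (∑ S ∈ D, c S * chi S x)
      = ∑ S ∈ D, ∑ R ∈ D, (c S * c R) * (chi S x * chi R x) := by
    intro x
    rw [Finset.sum_mul_sum]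
    exact Finset.sum_congr rfl fun S _ => Finset.sum_congr rfl fun R _ => by ring
  simp only [e, mean_sum, mean_mul_left, mean_chi_mul_chi]
  refine Finset.sum_congr rfl fun S hS => ?_
  rw [Finset.sum_eq_single S]
  · simp [pow_two]
  · intro R _ hR
    simp [hR.symm]
  · exact fun h => absurd hS h

/-- The best approximation of `f` by a function of the variables in `J`: the sign of the
conditional expectation. -/
noncomputable def bestOn (f : Cube n → ℤˣ) (J : Finset (Fin n)) (x : Cube n) : ℤˣ :=
  if 0 ≤ project (toReal f) J x then 1 else -1

theorem bestOn_congr (f : Cube n → ℤˣ) {J : Finset (Fin n)} {x y : Cube n}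
    (h : ∀ i ∈ J, x i = y i) : bestOn f J x = bestOn f J y := by
  rw [bestOn, bestOn, project_congr _ h]

theorem cubeDist_bestOn (f : Cube n → ℤˣ) (J : Finset (Fin n)) :
    cubeDist (bestOn f J) f = (1 - mean fun x => |project (toReal f) J x|) / 2 := by
  rw [cubeDist_eq, mean_mul_eq_project _ _ J]
  · congr 3
    ext x
    rw [toReal, bestOn]
    split_ifs with h
    · simp [abs_of_nonneg h]
    · simp [abs_of_neg (not_le.1 h)]
  · intro i hi x
    rw [toReal, toReal, bestOn_congr]
    intro j hj
    have : j ≠ i := fun h => hi (h ▸ hj)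
    simp [flipVec, this]

/-- No function of the variables in `J` is closer to `f` than `bestOn f J`; see
`cubeDist_bestOn`. -/
theorem le_cubeDist_of_flip (f g : Cube n → ℤˣ) (J : Finset (Fin n))
    (hg : ∀ i ∉ J, ∀ x, g (x * flipVec i) = g x) :
    (1 - mean fun x => |project (toReal f) J x|) / 2 ≤ cubeDist g f := by
  rw [cubeDist_eq, mean_mul_eq_project _ _ J]
  · gcongr
    refine mean_mono fun x => (le_abs_self _).trans ?_
    rw [abs_mul, abs_toReal, mul_one]
  · intro i hi x
    rw [toReal, toReal, hg i hi]

/-- Dropping variables costs at most the square root of the Fourier weight that is lost, in terms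
of the mean absolute value of the conditional expectation. By `cubeDist_bestOn`, the loss in
distance is half of this. -/
theorem mean_abs_project_sub_le (f : Cube n → ℝ) {J J' : Finset (Fin n)} (h : J' ⊆ J) :
    (mean fun x => |project f J x|) - (mean fun x => |project f J' x|)
      ≤ √(∑ S ∈ J.powerset \ J'.powerset, coeff f S ^ 2) := by
  have e : ∀ x, project f J x - project f J' x
      = ∑ S ∈ J.powerset \ J'.powerset, coeff f S * chi S x := by
    intro x
    rw [project, project, ← Finset.sum_sdiff (Finset.powerset_mono.2 h)]
    ring
  rw [← mean_sub]
  refine (mean_mono (h := fun x => |project f J x - project f J' x|)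
    fun x => abs_sub_abs_le_abs_sub _ _).trans ?_
  refine Real.le_sqrt_of_sq_le ?_
  refine (sq_mean_abs_le _).trans ?_
  simp only [e]
  rw [mean_sum_coeff_sq]

/-- The Fourier weight of `f` on the sets of size at most `k` that contain `i`. -/
noncomputable def lowWeight (f : Cube n → ℝ) (k : ℕ) (i : Fin n) : ℝ :=
  ∑ S with i ∈ S ∧ S.card ≤ k, coeff f S ^ 2

/-- If all variables outside `R` have small low-degree Fourier weight, then some function of at
most `k` variables from `R` is nearly as close to `f` as any `k`-junta. -/
theorem exists_bestOn_close (f g : Cube n → ℤˣ) {k : ℕ} (hg : IsJunta k g)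
    (R : Finset (Fin n)) {b : ℝ} (hb : ∀ i ∉ R, lowWeight (toReal f) k i ≤ b) (hb0 : 0 ≤ b) :
    ∃ J ⊆ R, J.card ≤ k ∧ cubeDist (bestOn f J) f ≤ cubeDist g f + √(k * b) / 2 := by
  classical
  set J : Finset (Fin n) := (relevantVars g).toFinset with hJ
  have hcard : J.card ≤ k := by
    rw [IsJunta, Set.ncard_eq_toFinset_card'] at hg
    exact hg
  have hflip : ∀ i ∉ J, ∀ x, g (x * flipVec i) = g x := by
    intro i hi x
    by_contra hne
    exact hi (Set.mem_toFinset.2 ⟨x, hne⟩)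
  refine ⟨J ∩ R, Finset.inter_subset_right,
    (Finset.card_le_card Finset.inter_subset_left).trans hcard, ?_⟩
  have h1 := le_cubeDist_of_flip f g J hflip
  have h2 := mean_abs_project_sub_le (toReal f) (Finset.inter_subset_left : J ∩ R ⊆ J)
  have h3 : ∑ S ∈ J.powerset \ (J ∩ R).powerset, coeff (toReal f) S ^ 2 ≤ k * b := by
    calc ∑ S ∈ J.powerset \ (J ∩ R).powerset, coeff (toReal f) S ^ 2
        ≤ ∑ S, ∑ i ∈ J \ R, if i ∈ S ∧ S.card ≤ k then coeff (toReal f) S ^ 2 else 0 := by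
          have h0 : ∀ (S : Finset (Fin n)) (i : Fin n),
              0 ≤ if i ∈ S ∧ S.card ≤ k then coeff (toReal f) S ^ 2 else 0 := fun S i => by
            split_ifs <;> positivity
          refine (Finset.sum_le_sum fun S hS => ?_).trans
            (Finset.sum_le_sum_of_subset_of_nonneg (Finset.subset_univ _)
              fun S _ _ => Finset.sum_nonneg fun i _ => h0 S i)
          simp only [Finset.mem_sdiff, Finset.mem_powerset] at hS
          obtain ⟨hSJ, hSR⟩ := hS
          obtain ⟨i, hi, hiR⟩ := Finset.not_subset.1 hSR
          refine le_trans ?_ (Finset.single_le_sum (f := fun i =>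
            if i ∈ S ∧ S.card ≤ k then coeff (toReal f) S ^ 2 else 0) (fun i _ => h0 S i)
            (Finset.mem_sdiff.2 ⟨hSJ hi, fun h => hiR (Finset.mem_inter.2 ⟨hSJ hi, h⟩)⟩))
          rw [if_pos ⟨hi, (Finset.card_le_card hSJ).trans hcard⟩]
      _ = ∑ i ∈ J \ R, lowWeight (toReal f) k i := by
          rw [Finset.sum_comm]
          simp only [lowWeight, Finset.sum_filter]
      _ ≤ ∑ _i ∈ J \ R, b := Finset.sum_le_sum fun i hi => hb i (Finset.mem_sdiff.1 hi).2
      _ = (J \ R).card * b := by rw [Finset.sum_const, nsmul_eq_mul]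
      _ ≤ k * b := by
          gcongr
          exact (Finset.card_le_card Finset.sdiff_subset).trans hcard
  rw [cubeDist_bestOn]
  have h4 := Real.sqrt_le_sqrt h3
  linarith

theorem isJunta_of_congr {g : Cube n → ℤˣ} {k : ℕ} (J : Finset (Fin n)) (hJ : J.card ≤ k)
    (hg : ∀ x y : Cube n, (∀ i ∈ J, x i = y i) → g x = g y) : IsJunta k g := by
  refine le_trans ?_ hJ
  rw [← Set.ncard_coe_finset]
  refine Set.ncard_le_ncard ?_ J.finite_toSet
  rintro i ⟨x, hx⟩
  by_contra hi
  refine hx (hg _ _ fun j hj => ?_)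
  have : j ≠ i := fun h => hi (h ▸ hj)
  simp [flipVec, this]

theorem le_optJunta {f : Cube n → ℤˣ} {k : ℕ} {a : ℝ}
    (h : ∀ g, IsJunta k g → a ≤ cubeDist g f) : a ≤ optJunta k f := by
  refine le_csInf ⟨_, fun _ => 1, isJunta_of_congr ∅ (by simp) fun _ _ _ => rfl, rfl⟩ ?_
  rintro d ⟨g, hg, rfl⟩
  exact h g hg

/-! ### Influences seen through the random walk -/

/-- The factor with which a Fourier coefficient of degree `s` enters `walkInfluence`. It is an
average of an even and of the following odd power of the eigenvalue, so that it is nonnegative and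
small for degrees close to `n`, where the eigenvalue is close to `-1`. -/
noncomputable def weight (n s : ℕ) : ℝ := eig n s ^ (2 * n) * ((1 + eig n s) / 2)

/-- A noisy variant of the influence of the `i`-th variable on `f`. -/
noncomputable def walkInfluence (f : Cube n → ℝ) (i : Fin n) : ℝ :=
  ∑ S with i ∈ S, weight n S.card * coeff f S ^ 2

theorem one_add_eig_div_two [NeZero n] (s : ℕ) : (1 + eig n s) / 2 = 1 - s / n := by
  unfold eig
  ring

theorem weight_nonneg [NeZero n] {s : ℕ} (hs : s ≤ n) : 0 ≤ weight n s := by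
  have hn : (0 : ℝ) < n := Nat.cast_pos.2 (NeZero.pos n)
  rw [weight, one_add_eig_div_two]
  refine mul_nonneg (Even.pow_nonneg ⟨n, by ring⟩ _) (sub_nonneg.2 ?_)
  rw [div_le_one hn]
  exact_mod_cast hs

/-- With `u = eig n s ^ 2`, the left-hand side is `n * (1 - u) * u ^ n / 4`, and `u ^ n` is at most
`exp (-(n * (1 - u)))`. -/
theorem mul_weight_le [NeZero n] {s : ℕ} (hs : s ≤ n) : s * weight n s ≤ 1 / 4 := by
  have hn : (0 : ℝ) < n := Nat.cast_pos.2 (NeZero.pos n)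
  have hs' : (s : ℝ) ≤ n := by exact_mod_cast hs
  set u : ℝ := eig n s ^ 2 with hu
  have e1 : s * weight n s = n / 4 * ((1 - u) * u ^ n) := by
    rw [weight, pow_mul, ← hu]
    have : (s : ℝ) = n / 2 * (1 - eig n s) := by
      unfold eig
      field_simp
      ring
    conv_lhs => rw [this]
    rw [hu]
    ring
  have hu0 : 0 ≤ u := sq_nonneg _
  have h1 : u ≤ Real.exp (-(1 - u)) := by
    have := Real.add_one_le_exp (-(1 - u))
    linarith
  have h2 : u ^ n ≤ Real.exp (-(n * (1 - u))) := by
    calc u ^ n ≤ Real.exp (-(1 - u)) ^ n := by gcongr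
      _ = _ := by rw [← Real.exp_nat_mul]; congr 1; ring
  have h3 : n * (1 - u) * u ^ n ≤ 1 := by
    rcases le_or_gt (n * (1 - u)) 0 with h | h
    · exact (mul_nonpos_of_nonpos_of_nonneg h (pow_nonneg hu0 _)).trans zero_le_one
    · calc n * (1 - u) * u ^ n ≤ n * (1 - u) * Real.exp (-(n * (1 - u))) := by gcongr
        _ ≤ Real.exp (n * (1 - u)) * Real.exp (-(n * (1 - u))) := by
            gcongr
            linarith [Real.add_one_le_exp (n * (1 - u))]
        _ = 1 := by rw [← Real.exp_add, add_neg_cancel, Real.exp_zero]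
  rw [e1]
  linarith

/-- The weights of the degrees up to `k` are bounded below independently of `n`. -/
theorem le_weight [NeZero n] {k s : ℕ} (hs : s ≤ k) (hk : 4 * k < n) :
    3 / 4 * (4 : ℝ)⁻¹ ^ (8 * k) ≤ weight n s := by
  have hn : (0 : ℝ) < n := Nat.cast_pos.2 (NeZero.pos n)
  have hk' : 4 * (k : ℝ) ≤ n := by exact_mod_cast hk.le
  have hs' : (s : ℝ) ≤ k := by exact_mod_cast hs
  have hs0 : (0 : ℝ) ≤ s := Nat.cast_nonneg s
  set y : ℝ := 2 * s / n with hy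
  have hy0 : 0 ≤ y := by positivity
  have hy1 : y ≤ 1 / 2 := by
    rw [hy, div_le_iff₀ hn]
    linarith
  have h1 : Real.exp (-(2 * y)) ≤ 1 - y := by
    rw [Real.exp_neg, inv_le_comm₀ (Real.exp_pos _) (by linarith)]
    refine le_trans ?_ (Real.add_one_le_exp _)
    rw [inv_le_iff_one_le_mul₀ (by linarith)]
    nlinarith
  have h2 : (4 : ℝ)⁻¹ ^ (8 * k) ≤ eig n s ^ (2 * n) := by
    have h4 : (4 : ℝ)⁻¹ ≤ Real.exp (-1) := by
      rw [Real.exp_neg]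
      gcongr
      linarith [Real.exp_one_lt_d9]
    calc (4 : ℝ)⁻¹ ^ (8 * k) ≤ Real.exp (-1) ^ (8 * k) := by gcongr
      _ = Real.exp (-(8 * k)) := by
          rw [← Real.exp_nat_mul]
          congr 1
          push_cast
          ring
      _ ≤ Real.exp (-(8 * s)) := by gcongr
      _ = Real.exp (-(2 * y)) ^ (2 * n) := by
          rw [← Real.exp_nat_mul]
          congr 1
          rw [hy]
          push_cast
          field_simp
          ring
      _ ≤ (1 - y) ^ (2 * n) := by gcongr
      _ = eig n s ^ (2 * n) := rfl
  have h3 : (3 : ℝ) / 4 ≤ (1 + eig n s) / 2 := by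
    rw [show eig n s = 1 - y from rfl]
    linarith
  rw [weight, mul_comm]
  exact mul_le_mul h2 h3 (by norm_num) (Even.pow_nonneg ⟨n, by ring⟩ _)

theorem walkInfluence_nonneg [NeZero n] (f : Cube n → ℝ) (i : Fin n) : 0 ≤ walkInfluence f i :=
  Finset.sum_nonneg fun S _ =>
    mul_nonneg (weight_nonneg ((Finset.card_le_univ S).trans_eq (by simp))) (sq_nonneg _)

/-- The total walk influence is bounded independently of `n`; this is what bounds the number of
candidate variables. -/
theorem sum_walkInfluence_le [NeZero n] (f : Cube n → ℤˣ) :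
    ∑ i, walkInfluence (toReal f) i ≤ 1 / 4 := by
  have e : ∑ i, walkInfluence (toReal f) i
      = ∑ S : Finset (Fin n), S.card * weight n S.card * coeff (toReal f) S ^ 2 := by
    simp only [walkInfluence, Finset.sum_filter]
    rw [Finset.sum_comm]
    refine Finset.sum_congr rfl fun S _ => ?_
    rw [← Finset.sum_filter, Finset.sum_const, nsmul_eq_mul, mul_assoc]
    simp
  have hp : ∑ S, coeff (toReal f) S ^ 2 = 1 := by
    have h := mean_mul (toReal f) (toReal f)
    have h1 : ∀ x, toReal f x * toReal f x = 1 := fun x => intCast_sq_unit _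
    simp only [h1, mean_const, ← pow_two] at h
    exact h.symm
  rw [e]
  calc _ ≤ ∑ S, 1 / 4 * coeff (toReal f) S ^ 2 := by
        gcongr with S
        exact mul_weight_le ((Finset.card_le_univ S).trans_eq (by simp))
    _ = 1 / 4 := by rw [← Finset.mul_sum, hp, mul_one]

/-- Variables of small walk influence have small low-degree Fourier weight. -/
theorem lowWeight_le [NeZero n] (f : Cube n → ℝ) {k : ℕ} (hk : 4 * k < n) (i : Fin n) :
    lowWeight f k i ≤ 4 / 3 * 4 ^ (8 * k) * walkInfluence f i := by
  have h : 3 / 4 * (4 : ℝ)⁻¹ ^ (8 * k) * lowWeight f k i ≤ walkInfluence f i := by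
    rw [lowWeight, walkInfluence, Finset.mul_sum]
    calc _ ≤ ∑ S with i ∈ S ∧ S.card ≤ k, weight n S.card * coeff f S ^ 2 := by
          gcongr with S hS
          exact le_weight (Finset.mem_filter.1 hS).2.2 hk
      _ ≤ _ := by
          refine Finset.sum_le_sum_of_subset_of_nonneg ?_ fun S _ _ => ?_
          · intro S hS
            simp only [Finset.mem_filter] at hS ⊢
            exact ⟨hS.1, hS.2.1⟩
          · exact mul_nonneg (weight_nonneg ((Finset.card_le_univ S).trans_eq (by simp)))
              (sq_nonneg _)
  calc lowWeight f k i
      = 4 / 3 * 4 ^ (8 * k) * (3 / 4 * (4 : ℝ)⁻¹ ^ (8 * k) * lowWeight f k i) := by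
        rw [inv_pow]
        field_simp
    _ ≤ _ := by gcongr

theorem coeff_sub_flip (f : Cube n → ℝ) (i : Fin n) (S : Finset (Fin n)) :
    coeff (fun x => (f x - f (x * flipVec i)) / 2) S = if i ∈ S then coeff f S else 0 := by
  have e : ∀ x, (f x - f (x * flipVec i)) / 2 * chi S x
      = 2⁻¹ * (f x * chi S x - f (x * flipVec i) * chi S x) := fun x => by ring
  have e2 : ∀ x, f x * ((if i ∈ S then (-1 : ℝ) else 1) * chi S x)
      = (if i ∈ S then (-1 : ℝ) else 1) * (f x * chi S x) := fun x => by ring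
  unfold coeff
  simp only [e, mean_mul_left, mean_sub, mean_flip_mul, chi_flip, e2]
  split_ifs <;> ring

/-- The walk influence as a correlation between the change of `f` under a flip of `x_i` and the
values of `f` at the two points visited `2n` and `2n+1` steps later. -/
theorem mean_sub_flip_mul [NeZero n] (f : Cube n → ℝ) (i : Fin n) :
    mean (fun x => (f x - f (x * flipVec i)) / 2 *
      ((trans^[2 * n] f x + trans^[2 * n + 1] f x) / 2)) = walkInfluence f i := by
  rw [mean_mul]
  simp only [coeff_sub_flip, walkInfluence, Finset.sum_filter]
  refine Finset.sum_congr rfl fun S _ => ?_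
  split_ifs
  · have : coeff (fun x => (trans^[2 * n] f x + trans^[2 * n + 1] f x) / 2) S
        = weight n S.card * coeff f S := by
      have e : ∀ x, (trans^[2 * n] f x + trans^[2 * n + 1] f x) / 2 * chi S x
          = 2⁻¹ * (trans^[2 * n] f x * chi S x + trans^[2 * n + 1] f x * chi S x) :=
        fun x => by ring
      have h1 := coeff_trans_iterate f S (2 * n)
      have h2 := coeff_trans_iterate f S (2 * n + 1)
      unfold coeff at h1 h2 ⊢
      simp only [e, mean_mul_left, mean_add]
      rw [h1, h2, weight]
      ring
    rw [this]
    ring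
  · simp

/-! ### Averages over the steps of the walk -/

/-- Put the step `i` in front of the sequence `ω` of steps. -/
def consStep (i : Fin n) (ω : ℕ → Fin n) : ℕ → Fin n
  | 0 => i
  | t + 1 => ω t

/-- The first `m` steps of `ω`, followed by `ω'`. -/
def glue (m : ℕ) (ω ω' : ℕ → Fin n) (t : ℕ) : Fin n := if t < m then ω t else ω' (t - m)

/-- The quantity `F` depends on the first `m` steps only. -/
def DependsOn {α : Type*} (m : ℕ) (F : (ℕ → Fin n) → α) : Prop :=
  ∀ ω ω', (∀ t < m, ω t = ω' t) → F ω = F ω'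

/-- The average of `F` over the first `m` steps; the later ones are given a fixed value, so that
this is the expectation of `F` if `F` depends on the first `m` steps only. -/
noncomputable def pathAvg [NeZero n] : ℕ → ((ℕ → Fin n) → ℝ) → ℝ
  | 0, F => F fun _ => 0
  | m + 1, F => (∑ i, pathAvg m fun ω => F (consStep i ω)) / n

theorem glue_zero (ω ω' : ℕ → Fin n) : glue 0 ω ω' = ω' := by
  ext t
  simp [glue]

theorem glue_of_lt {m t : ℕ} (h : t < m) (ω ω' : ℕ → Fin n) : glue m ω ω' t = ω t := if_pos h

theorem glue_add (m t : ℕ) (ω ω' : ℕ → Fin n) : glue m ω ω' (m + t) = ω' t := by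
  simp [glue]

theorem glue_consStep (m : ℕ) (i : Fin n) (ω ω' : ℕ → Fin n) :
    glue (m + 1) (consStep i ω) ω' = consStep i (glue m ω ω') := by
  funext t
  cases t with
  | zero => simp [glue, consStep]
  | succ t => simp [glue, consStep]

theorem DependsOn.consStep {α : Type*} {m : ℕ} {F : (ℕ → Fin n) → α} (h : DependsOn (m + 1) F)
    (i : Fin n) : DependsOn m fun ω => F (consStep i ω) := by
  intro ω ω' hω
  refine h _ _ fun t ht => ?_
  cases t with
  | zero => rfl
  | succ t => exact hω t (Nat.lt_of_succ_lt_succ ht)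

theorem DependsOn.glue {α : Type*} {m : ℕ} {F : (ℕ → Fin n) → α} (h : DependsOn m F)
    (ω ω' : ℕ → Fin n) : F (glue m ω ω') = F ω :=
  h _ _ fun _ ht => glue_of_lt ht _ _

section pathAvg

variable [NeZero n]

theorem natCast_ne_zero' : (n : ℝ) ≠ 0 := Nat.cast_ne_zero.2 (NeZero.ne n)

theorem pathAvg_const (m : ℕ) (c : ℝ) : pathAvg (n := n) m (fun _ => c) = c := by
  induction m with
  | zero => rfl
  | succ m ih =>
    have := natCast_ne_zero' (n := n)
    simp only [pathAvg, ih, Finset.sum_const, Finset.card_univ, Fintype.card_fin, nsmul_eq_mul]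
    field_simp

theorem pathAvg_add (m : ℕ) (F G : (ℕ → Fin n) → ℝ) :
    pathAvg m (fun ω => F ω + G ω) = pathAvg m F + pathAvg m G := by
  induction m generalizing F G with
  | zero => rfl
  | succ m ih => simp only [pathAvg, ih, Finset.sum_add_distrib, add_div]

theorem pathAvg_mul_left (m : ℕ) (c : ℝ) (F : (ℕ → Fin n) → ℝ) :
    pathAvg m (fun ω => c * F ω) = c * pathAvg m F := by
  induction m generalizing F with
  | zero => rfl
  | succ m ih => simp only [pathAvg, ih, ← Finset.mul_sum, mul_div_assoc]

theorem pathAvg_sub (m : ℕ) (F G : (ℕ → Fin n) → ℝ) :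
    pathAvg m (fun ω => F ω - G ω) = pathAvg m F - pathAvg m G := by
  have h := pathAvg_add m F fun ω => (-1) * G ω
  rw [pathAvg_mul_left] at h
  have e : (fun ω => F ω - G ω) = fun ω => F ω + (-1) * G ω := by
    funext ω
    ring
  rw [e, h]
  ring

theorem pathAvg_mono (m : ℕ) {F G : (ℕ → Fin n) → ℝ} (h : ∀ ω, F ω ≤ G ω) :
    pathAvg m F ≤ pathAvg m G := by
  induction m generalizing F G with
  | zero => exact h _
  | succ m ih =>
    simp only [pathAvg]
    gcongr with i
    exact ih fun ω => h _

theorem pathAvg_sum {ι : Type*} (m : ℕ) (s : Finset ι) (F : ι → (ℕ → Fin n) → ℝ) :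
    pathAvg m (fun ω => ∑ i ∈ s, F i ω) = ∑ i ∈ s, pathAvg m (F i) := by
  classical
  induction s using Finset.induction_on with
  | empty => simpa using pathAvg_const m 0
  | insert a s ha ih => simp only [Finset.sum_insert ha, pathAvg_add, ih]

theorem abs_pathAvg_le {m : ℕ} {F : (ℕ → Fin n) → ℝ} {c : ℝ} (h : ∀ ω, |F ω| ≤ c) :
    |pathAvg m F| ≤ c := by
  refine abs_le.2 ⟨?_, ?_⟩
  · rw [← pathAvg_const (n := n) m (-c)]
    exact pathAvg_mono m fun ω => (abs_le.1 (h ω)).1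
  · rw [← pathAvg_const (n := n) m c]
    exact pathAvg_mono m fun ω => (abs_le.1 (h ω)).2

/-- The Markov property: average over the first `m` steps and then over the following `l`. -/
theorem pathAvg_glue (m l : ℕ) (F : (ℕ → Fin n) → ℝ) :
    pathAvg (m + l) F = pathAvg m fun ω => pathAvg l fun ω' => F (glue m ω ω') := by
  induction m generalizing F with
  | zero => simp only [Nat.zero_add, pathAvg, glue_zero]
  | succ m ih =>
    rw [Nat.succ_add]
    simp only [pathAvg, ih, glue_consStep]

theorem DependsOn.pathAvg_eq {m m' : ℕ} {F : (ℕ → Fin n) → ℝ} (h : DependsOn m F)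
    (hm : m ≤ m') : pathAvg m' F = pathAvg m F := by
  obtain ⟨l, rfl⟩ := Nat.exists_eq_add_of_le hm
  rw [pathAvg_glue]
  simp only [h.glue, pathAvg_const]

end pathAvg

theorem walk_consStep (x : Cube n) (i : Fin n) (ω : ℕ → Fin n) (t : ℕ) :
    walk (x, consStep i ω) (t + 1) = walk (x * flipVec i, ω) t := by
  induction t with
  | zero => simp [walk, consStep]
  | succ t ih => rw [walk, ih, walk]; rfl

theorem walk_add (x : Cube n) (ω : ℕ → Fin n) (s t : ℕ) :
    walk (x, ω) (s + t) = walk (walk (x, ω) s, fun r => ω (s + r)) t := by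
  induction t with
  | zero => rfl
  | succ t ih => rw [← Nat.add_assoc, walk, ih, walk]

theorem dependsOn_walk (x : Cube n) (t : ℕ) : DependsOn t fun ω => walk (x, ω) t := by
  intro ω ω' h
  induction t with
  | zero => rfl
  | succ t ih =>
    change walk (x, ω) t * flipVec (ω t) = walk (x, ω') t * flipVec (ω' t)
    rw [h t (Nat.lt_succ_self t)]
    congr 1
    exact ih fun r hr => h r (hr.trans (Nat.lt_succ_self t))

theorem chi_univ_walk (x : Cube n) (ω : ℕ → Fin n) (t : ℕ) :
    chi Finset.univ (walk (x, ω) t) = (-1) ^ t * chi Finset.univ x := by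
  induction t with
  | zero => simp [walk]
  | succ t ih =>
    rw [walk, chi_flip, ih, pow_succ]
    simp

/-- The powers of the transition operator are conditional expectations along the walk. -/
theorem pathAvg_walk [NeZero n] (g : Cube n → ℝ) (x : Cube n) (t : ℕ) :
    pathAvg t (fun ω => g (walk (x, ω) t)) = trans^[t] g x := by
  induction t generalizing x with
  | zero => rfl
  | succ t ih => simp only [pathAvg, walk_consStep, ih, Function.iterate_succ_apply', trans]

/-! ### Concentration of block averages -/

/-- The steps from time `t` on. -/
def shift (t : ℕ) (ω : ℕ → Fin n) (r : ℕ) : Fin n := ω (t + r)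

/-- The value of the block statistic `Z` on the `l`-th block of length `L`. -/
def blockValue (L : ℕ) (Z : Cube n → (ℕ → Fin n) → ℝ) (x : Cube n) (ω : ℕ → Fin n) (l : ℕ) : ℝ :=
  Z (walk (x, ω) (l * L)) (shift (l * L) ω)

theorem blockValue_zero (L : ℕ) {Z : Cube n → (ℕ → Fin n) → ℝ} (hZ : ∀ x, DependsOn L (Z x))
    (x : Cube n) (ω ω' : ℕ → Fin n) : blockValue L Z x (glue L ω ω') 0 = Z x ω := by
  have : shift (0 * L) (glue L ω ω') = glue L ω ω' := by
    funext t
    simp [shift]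
  rw [blockValue, this, (hZ _).glue]
  simp [walk]

theorem blockValue_succ (L : ℕ) (Z : Cube n → (ℕ → Fin n) → ℝ) (x : Cube n)
    (ω ω' : ℕ → Fin n) (l : ℕ) :
    blockValue L Z x (glue L ω ω') (l + 1) = blockValue L Z (walk (x, ω) L) ω' l := by
  have e : (l + 1) * L = L + l * L := by ring
  have e2 : (fun r => glue L ω ω' (L + r)) = ω' := by
    funext r
    exact glue_add _ _ _ _
  rw [blockValue, blockValue, e, walk_add, e2, (dependsOn_walk x L).glue]
  congr 1
  funext r
  rw [shift, Nat.add_assoc, glue_add, shift]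

section concentration

variable [NeZero n]

/-- Exponential moments of the sum of the deviations of a block statistic from its conditional
mean, by peeling off the first block. -/
theorem pathAvg_exp_le (L : ℕ) {Z : Cube n → (ℕ → Fin n) → ℝ} (hZ : ∀ x, DependsOn L (Z x))
    (hb : ∀ x ω, |Z x ω| ≤ 1) {s : ℝ} (hs : |s| ≤ 1 / 2) (j : ℕ) (x : Cube n) :
    pathAvg (j * L) (fun ω => Real.exp (s * ∑ l ∈ Finset.range j,
      (blockValue L Z x ω l - blockValue L (fun y _ => pathAvg L (Z y)) x ω l)))
      ≤ Real.exp (4 * s ^ 2 * j) := by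
  induction j generalizing x with
  | zero => simp [pathAvg_const]
  | succ j ih =>
    have hM : ∀ y : Cube n, DependsOn L fun _ : ℕ → Fin n => pathAvg L (Z y) :=
      fun y _ _ _ => rfl
    rw [show (j + 1) * L = L + j * L by ring, pathAvg_glue]
    simp only [Finset.sum_range_succ', blockValue_succ, blockValue_zero L hZ,
      blockValue_zero L hM, mul_add, Real.exp_add]
    have h1 : ∀ ω : ℕ → Fin n, ∀ ω' : ℕ → Fin n,
        Real.exp (s * ∑ l ∈ Finset.range j, (blockValue L Z (walk (x, ω) L) ω' l -
          blockValue L (fun y _ => pathAvg L (Z y)) (walk (x, ω) L) ω' l)) *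
          Real.exp (s * (Z x ω - pathAvg L (Z x)))
        = Real.exp (s * (Z x ω - pathAvg L (Z x))) *
          Real.exp (s * ∑ l ∈ Finset.range j, (blockValue L Z (walk (x, ω) L) ω' l -
          blockValue L (fun y _ => pathAvg L (Z y)) (walk (x, ω) L) ω' l)) :=
      fun _ _ => mul_comm _ _
    simp only [h1, pathAvg_mul_left]
    have hMb : |pathAvg L (Z x)| ≤ 1 := abs_pathAvg_le (hb x)
    have h2 : ∀ ω, Real.exp (s * (Z x ω - pathAvg L (Z x)))
        ≤ 1 + 4 * s ^ 2 + s * (Z x ω - pathAvg L (Z x)) := by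
      intro ω
      set d := Z x ω - pathAvg L (Z x)
      have hd : |d| ≤ 2 := (abs_sub _ _).trans (by linarith [hb x ω])
      have hsd : |s * d| ≤ 1 := by
        rw [abs_mul]
        calc |s| * |d| ≤ 1 / 2 * 2 := by gcongr
          _ = 1 := by norm_num
      have h3 := (abs_le.1 (Real.abs_exp_sub_one_sub_id_le hsd)).2
      have h4 : d ^ 2 ≤ 4 := by
        rw [← sq_abs]
        nlinarith [abs_nonneg d]
      nlinarith [sq_nonneg s, mul_le_mul_of_nonneg_left h4 (sq_nonneg s)]
    calc _ ≤ pathAvg L (fun ω => Real.exp (4 * s ^ 2 * j) *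
            Real.exp (s * (Z x ω - pathAvg L (Z x)))) := by
          refine pathAvg_mono L fun ω => ?_
          rw [mul_comm]
          gcongr
          exact ih _
      _ ≤ Real.exp (4 * s ^ 2 * j) * (1 + 4 * s ^ 2) := by
          rw [pathAvg_mul_left]
          gcongr
          refine (pathAvg_mono L h2).trans_eq ?_
          rw [pathAvg_add, pathAvg_const, pathAvg_mul_left, pathAvg_sub, pathAvg_const]
          ring
      _ ≤ Real.exp (4 * s ^ 2 * j) * Real.exp (4 * s ^ 2) := by
          gcongr
          linarith [Real.add_one_le_exp (4 * s ^ 2)]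
      _ = _ := by
          rw [← Real.exp_add]
          congr 1
          push_cast
          ring

/-- A Hoeffding-type bound for either tail, `σ` being the sign. -/
theorem pathAvg_ind_le_exp (L : ℕ) {Z : Cube n → (ℕ → Fin n) → ℝ} (hZ : ∀ x, DependsOn L (Z x))
    (hb : ∀ x ω, |Z x ω| ≤ 1) {a : ℝ} (ha : 0 ≤ a) (ha4 : a ≤ 4) (σ : ℝ) (hσ : |σ| = 1) (j : ℕ)
    (x : Cube n) :
    pathAvg (j * L) (fun ω => if j * a ≤ σ * ∑ l ∈ Finset.range j,
      (blockValue L Z x ω l - blockValue L (fun y _ => pathAvg L (Z y)) x ω l) then 1 else 0)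
      ≤ Real.exp (-(j * a ^ 2 / 16)) := by
  have hs : |a / 8 * σ| ≤ 1 / 2 := by
    rw [abs_mul, hσ, mul_one, abs_of_nonneg (by positivity)]
    linarith
  have hσ2 : σ ^ 2 = 1 := by rw [← sq_abs, hσ, one_pow]
  -- Markov's inequality for the exponential moment with parameter `a / 8`
  have h := pathAvg_exp_le L hZ hb hs j x
  calc _ ≤ pathAvg (j * L) (fun ω => Real.exp (-(j * a ^ 2 / 8)) *
        Real.exp (a / 8 * σ * ∑ l ∈ Finset.range j,
      (blockValue L Z x ω l - blockValue L (fun y _ => pathAvg L (Z y)) x ω l))) := by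
        refine pathAvg_mono _ fun ω => ?_
        split_ifs with hc
        · rw [← Real.exp_add]
          refine Real.one_le_exp ?_
          have := mul_le_mul_of_nonneg_left hc (show 0 ≤ a / 8 by positivity)
          linarith
        · positivity
    _ ≤ Real.exp (-(j * a ^ 2 / 8)) * Real.exp (4 * (a / 8 * σ) ^ 2 * j) := by
        rw [pathAvg_mul_left]
        gcongr
    _ = _ := by
        rw [← Real.exp_add]
        congr 1
        rw [mul_pow, hσ2]
        ring

omit [NeZero n] in
/-- The parity of the walk alternates from block to block, so its contribution to the sum of the
conditional means cancels. -/
theorem abs_sum_condMean_sub_le {L N : ℕ} (hL : Odd L) (hN : Even N) {M : Cube n → ℝ}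
    {μ c η : ℝ} (hM : ∀ x, |M x - μ - c * chi Finset.univ x| ≤ η) (x : Cube n)
    (ω : ℕ → Fin n) :
    |∑ l ∈ Finset.range N, blockValue L (fun y _ => M y) x ω l - N * μ| ≤ N * η := by
  have hsum : ∑ l ∈ Finset.range N, chi Finset.univ (walk (x, ω) (l * L)) = 0 := by
    have : ∀ l : ℕ, chi Finset.univ (walk (x, ω) (l * L)) = (-1) ^ l * chi Finset.univ x := by
      intro l
      rw [chi_univ_walk, mul_comm l, pow_mul, hL.neg_one_pow]
    simp only [this, ← Finset.sum_mul, neg_one_geom_sum, if_pos hN, zero_mul]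
  have e : ∑ l ∈ Finset.range N, blockValue L (fun y _ => M y) x ω l - N * μ
      = ∑ l ∈ Finset.range N, (M (walk (x, ω) (l * L)) - μ
        - c * chi Finset.univ (walk (x, ω) (l * L))) := by
    rw [Finset.sum_sub_distrib, Finset.sum_sub_distrib, ← Finset.mul_sum, hsum]
    simp [blockValue]
  rw [e]
  refine (Finset.abs_sum_le_sum_abs _ _).trans ?_
  refine (Finset.sum_le_card_nsmul _ _ η fun l _ => hM _).trans_eq ?_
  simp

/-- A statistic of a window of the walk that opens at time `T`. -/
def delayed (T : ℕ) (G : Cube n → (ℕ → Fin n) → ℝ) (x : Cube n) (ω : ℕ → Fin n) : ℝ :=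
  G (walk (x, ω) T) (shift T ω)

omit [NeZero n] in
theorem dependsOn_delayed {T ℓ L : ℕ} {G : Cube n → (ℕ → Fin n) → ℝ}
    (hG : ∀ y, DependsOn ℓ (G y)) (hL : T + ℓ ≤ L) (x : Cube n) :
    DependsOn L (delayed T G x) := by
  intro ω ω' h
  have hw : walk (x, ω) T = walk (x, ω') T := dependsOn_walk x T ω ω' fun t ht => h t (by omega)
  rw [delayed, delayed, hw]
  exact hG _ _ _ fun t ht => h _ (by omega)

/-- The conditional mean of a delayed statistic, given the starting point of the block. -/
theorem pathAvg_delayed {T ℓ L : ℕ} {G : Cube n → (ℕ → Fin n) → ℝ}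
    (hG : ∀ y, DependsOn ℓ (G y)) (hL : T + ℓ ≤ L) (x : Cube n) :
    pathAvg L (delayed T G x) = trans^[T] (fun y => pathAvg ℓ (G y)) x := by
  rw [(dependsOn_delayed hG le_rfl x).pathAvg_eq hL, pathAvg_glue, ← pathAvg_walk]
  congr 1
  funext ω
  congr 1
  funext ω'
  rw [delayed, (dependsOn_walk x T).glue]
  congr 1
  funext r
  exact glue_add _ _ _ _

/-- Concentration of the block averages of a window statistic around its stationary mean. -/
theorem pathAvg_deviation_le {T ℓ L N : ℕ} {G : Cube n → (ℕ → Fin n) → ℝ}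
    (hG : ∀ y, DependsOn ℓ (G y)) (hL : T + ℓ ≤ L) (hodd : Odd L) (hN : Even N)
    (hb : ∀ y ω, |G y ω| ≤ 1) {a : ℝ} (ha : 0 ≤ a) (ha4 : a ≤ 4)
    (hT : 2 ^ n * Real.exp (-(2 * T / n)) ≤ a / 2) (x : Cube n) :
    pathAvg (N * L) (fun ω => if N * a < |∑ l ∈ Finset.range N, blockValue L (delayed T G) x ω l
      - N * mean fun y => pathAvg ℓ (G y)| then 1 else 0)
      ≤ 2 * Real.exp (-(N * a ^ 2 / 64)) := by
  set Z := delayed T G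
  set μ := mean fun y => pathAvg ℓ (G y)
  have hZ : ∀ y, DependsOn L (Z y) := dependsOn_delayed hG hL
  have hZb : ∀ y ω, |Z y ω| ≤ 1 := fun y ω => hb _ _
  have hM : ∀ y, |pathAvg L (Z y) - μ
      - (-1) ^ T * coeff (fun y => pathAvg ℓ (G y)) Finset.univ * chi Finset.univ y| ≤ a / 2 := by
    intro y
    rw [pathAvg_delayed hG hL]
    exact (abs_trans_iterate_sub_le (fun y => abs_pathAvg_le (hb y)) T y).trans hT
  have h1 := pathAvg_ind_le_exp L hZ hZb (a := a / 2) (by linarith) (by linarith) 1 (by simp) N x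
  have h2 := pathAvg_ind_le_exp L hZ hZb (a := a / 2) (by linarith) (by linarith) (-1) (by simp) N x
  have e : (N : ℝ) * (a / 2) ^ 2 / 16 = N * a ^ 2 / 64 := by ring
  rw [e] at h1 h2
  rw [two_mul]
  refine le_trans ?_ (add_le_add h1 h2)
  rw [← pathAvg_add]
  refine pathAvg_mono _ fun ω => ?_
  have h3 := abs_le.1 (abs_sum_condMean_sub_le hodd hN hM x ω)
  rw [Finset.sum_sub_distrib]
  set A := ∑ l ∈ Finset.range N, blockValue L Z x ω l
  set B := ∑ l ∈ Finset.range N, blockValue L (fun y _ => pathAvg L (Z y)) x ω l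
  by_cases hc : N * a < |A - N * μ|
  · rw [if_pos hc]
    rcases lt_abs.1 hc with h | h
    · rw [if_pos (c := _ ≤ 1 * (A - B)) (by linarith)]
      split_ifs <;> norm_num
    · rw [if_pos (c := _ ≤ -1 * (A - B)) (by linarith)]
      split_ifs <;> norm_num
  · rw [if_neg hc]
    split_ifs <;> norm_num

end concentration

/-! ### Averages as probabilities -/

section measure

variable [NeZero n]

/-- The law of the steps of the walk. -/
noncomputable def stepMeasure (n : ℕ) [NeZero n] : Measure (ℕ → Fin n) :=
  Measure.infinitePi fun _ : ℕ => (PMF.uniformOfFintype (Fin n)).toMeasure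

instance : IsProbabilityMeasure (stepMeasure n) := by
  unfold stepMeasure
  infer_instance

omit [NeZero n] in
theorem measurable_consStep : Measurable fun p : Fin n × (ℕ → Fin n) => consStep p.1 p.2 := by
  refine measurable_pi_lambda _ fun t => ?_
  cases t with
  | zero => exact measurable_fst
  | succ t => exact (measurable_pi_apply t).comp measurable_snd

/-- A first step followed by an independent sequence of steps is a sequence of steps. -/
theorem map_consStep :
    ((PMF.uniformOfFintype (Fin n)).toMeasure.prod (stepMeasure n)).map
      (fun p => consStep p.1 p.2) = stepMeasure n := by
  refine Measure.eq_infinitePi _ fun s t ht => ?_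
  rw [Measure.map_apply measurable_consStep
    (MeasurableSet.pi s.countable_toSet fun i _ => ht i)]
  set s' : Finset ℕ := (s.erase 0).image Nat.pred with hs'
  have hmem : ∀ j, j ∈ s' ↔ j + 1 ∈ s := by
    intro j
    simp only [hs', Finset.mem_image, Finset.mem_erase]
    constructor
    · rintro ⟨a, ⟨h0, ha⟩, rfl⟩
      rwa [Nat.pred_eq_sub_one, Nat.sub_add_cancel (Nat.one_le_iff_ne_zero.2 h0)]
    · exact fun h => ⟨j + 1, ⟨Nat.succ_ne_zero j, h⟩, rfl⟩
  have hpre : (fun p : Fin n × (ℕ → Fin n) => consStep p.1 p.2) ⁻¹' (Set.pi s t)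
      = (if 0 ∈ s then t 0 else Set.univ) ×ˢ Set.pi s' fun j => t (j + 1) := by
    ext ⟨i, ω⟩
    simp only [Set.mem_preimage, Set.mem_pi, Set.mem_prod, Finset.mem_coe]
    constructor
    · intro h
      refine ⟨?_, fun j hj => h (j + 1) ((hmem j).1 hj)⟩
      split_ifs with h0
      · exact h 0 h0
      · exact Set.mem_univ _
    · rintro ⟨h1, h2⟩ j hj
      cases j with
      | zero => rwa [if_pos hj] at h1
      | succ j => exact h2 j ((hmem j).2 hj)
  rw [hpre, Measure.prod_prod, stepMeasure, Measure.infinitePi_pi _ fun i _ => ht (i + 1)]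
  have herase : s.erase 0 = s'.map ⟨Nat.succ, Nat.succ_injective⟩ := by
    ext j
    simp only [Finset.mem_erase, Finset.mem_map, Function.Embedding.coeFn_mk, hmem]
    constructor
    · rintro ⟨h0, hj⟩
      exact ⟨j - 1, by rwa [Nat.sub_add_cancel (Nat.one_le_iff_ne_zero.2 h0)], by omega⟩
    · rintro ⟨a, ha, rfl⟩
      exact ⟨Nat.succ_ne_zero a, ha⟩
  have hprod : ∏ i ∈ s.erase 0, (PMF.uniformOfFintype (Fin n)).toMeasure (t i)
      = ∏ j ∈ s', (PMF.uniformOfFintype (Fin n)).toMeasure (t (j + 1)) := by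
    rw [herase, Finset.prod_map]
    rfl
  rw [← hprod]
  split_ifs with h0
  · exact Finset.mul_prod_erase s (fun i => (PMF.uniformOfFintype (Fin n)).toMeasure (t i)) h0
  · rw [measure_univ, one_mul, Finset.erase_eq_of_notMem h0]

theorem DependsOn.measurableSet {m : ℕ} {P : (ℕ → Fin n) → Prop} (h : DependsOn m P) :
    MeasurableSet {ω | P ω} := by
  have e : {ω | P ω} = (fun (ω : ℕ → Fin n) (t : Fin m) => ω t) ⁻¹'
      {u | P fun t => if ht : t < m then u ⟨t, ht⟩ else 0} := by
    ext ω
    simp only [Set.mem_ofPred_eq, Set.mem_preimage]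
    rw [h ω (fun t => if ht : t < m then ω t else 0) fun t ht => by simp [ht]]
  rw [e]
  refine measurableSet_preimage ?_ (Set.toFinite _).measurableSet
  exact measurable_pi_lambda _ fun t => measurable_pi_apply _

open scoped Classical in
theorem stepMeasure_eq_pathAvg {m : ℕ} {P : (ℕ → Fin n) → Prop} (h : DependsOn m P) :
    stepMeasure n {ω | P ω} = ENNReal.ofReal (pathAvg m fun ω => if P ω then 1 else 0) := by
  induction m generalizing P with
  | zero =>
    by_cases hP : P fun _ => 0
    · have : {ω | P ω} = Set.univ := by
        ext ω
        simp [h ω (fun _ => 0) (by simp), hP]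
      simp [this, pathAvg, hP]
    · have : {ω | P ω} = ∅ := by
        ext ω
        simp [h ω (fun _ => 0) (by simp), hP]
      simp [this, pathAvg, hP]
  | succ m ih =>
    have hn : (0 : ℝ) < n := Nat.cast_pos.2 (NeZero.pos n)
    have h0 : ∀ i, 0 ≤ pathAvg m fun ω => if P (consStep i ω) then (1 : ℝ) else 0 := by
      intro i
      exact (pathAvg_const m 0).symm.le.trans
        (pathAvg_mono m fun ω => by split_ifs <;> norm_num)
    rw [← map_consStep, Measure.map_apply measurable_consStep h.measurableSet,
      Measure.prod_apply (measurable_consStep h.measurableSet), lintegral_fintype]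
    have e : ∀ i : Fin n, stepMeasure n (Prod.mk i ⁻¹'
        ((fun p : Fin n × (ℕ → Fin n) => consStep p.1 p.2) ⁻¹' {ω | P ω}))
        * (PMF.uniformOfFintype (Fin n)).toMeasure {i}
        = ENNReal.ofReal ((pathAvg m fun ω => if P (consStep i ω) then 1 else 0) / n) := by
      intro i
      rw [PMF.toMeasure_apply_singleton _ _ (measurableSet_singleton i),
        PMF.uniformOfFintype_apply, Fintype.card_fin, div_eq_mul_inv,
        ENNReal.ofReal_mul (h0 i), ENNReal.ofReal_inv_of_pos hn, ENNReal.ofReal_natCast,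
        ← ih (h.consStep i)]
      rfl
    simp only [e]
    rw [← ENNReal.ofReal_sum_of_nonneg fun i _ => div_nonneg (h0 i) hn.le, ← Finset.sum_div]
    rfl

open scoped Classical in
/-- An event of small probability from each starting point has a complement of large
probability. -/
theorem one_sub_le_walkMeasure {m : ℕ} {P : Cube n → (ℕ → Fin n) → Prop}
    (h : ∀ x, DependsOn m (P x)) {δ : ℝ} (hδ : 0 ≤ δ)
    (hP : ∀ x, pathAvg m (fun ω => if P x ω then 1 else 0) ≤ δ) :
    1 - δ ≤ (walkMeasure n).real {w | ¬ P w.1 w.2} := by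
  have hw : walkMeasure n = (PMF.uniformOfFintype (Cube n)).toMeasure.prod (stepMeasure n) := rfl
  have : IsProbabilityMeasure (walkMeasure n) := by
    rw [hw]
    infer_instance
  have hmeas : MeasurableSet {w : WalkSpace n | P w.1 w.2} := by
    have e : {w : WalkSpace n | P w.1 w.2} = ⋃ x, ({x} : Set (Cube n)) ×ˢ {ω | P x ω} := by
      ext ⟨x, ω⟩
      simp
    rw [e]
    exact MeasurableSet.iUnion fun x => (measurableSet_singleton x).prod (h x).measurableSet
  have hle : walkMeasure n {w | P w.1 w.2} ≤ ENNReal.ofReal δ := by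
    rw [hw, Measure.prod_apply hmeas]
    calc _ ≤ ∫⁻ _x, ENNReal.ofReal δ ∂(PMF.uniformOfFintype (Cube n)).toMeasure := by
          refine lintegral_mono fun x => ?_
          refine le_trans (le_of_eq ?_) (ENNReal.ofReal_le_ofReal (hP x))
          exact stepMeasure_eq_pathAvg (h x)
      _ = ENNReal.ofReal δ := by simp
  have hr : (walkMeasure n).real {w | P w.1 w.2} ≤ δ := ENNReal.toReal_le_of_le_ofReal hδ hle
  have hc : {w : WalkSpace n | ¬ P w.1 w.2} = {w | P w.1 w.2}ᶜ := rfl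
  rw [hc, probReal_compl_eq_one_sub hmeas]
  linarith

end measure

/-! ### A structured language for random access machines -/

/-- The scalar variables of the learning program. The first four hold its parameters: the dimension,
the number of variables of a junta, and the numbers of leading zeros of the two digit sequences. -/
inductive Var : Type
  | dim | arity | epsLen | deltaLen | arity4 | reps | cap | prec | precSq | deltaLen1 | thr
  | blocks | wait | dim2 | tableSize | i | j | z | l | c | p | y0 | y1 | y2 | y3 | bit | flip
  | r | total | acc | tmp | quo | pw | idx | cc | score | best | bestc
  deriving DecidableEq

/-- The arrays of the learning program: sample points (row by row) and their labels, positive and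
negative contributions to the influence estimates, the candidate variables, and the numbers of
labels `+1` and `-1` for each position in a truth table. -/
inductive Arr : Type
  | points | labels | pos | neg | cand | zeros | ones
  deriving DecidableEq

/-- Arithmetic expressions. -/
inductive Expr : Type
  | lit (c : ℕ)
  | var (x : Var)
  | entry (A : Arr) (e : Expr)
  | add (e₁ e₂ : Expr)
  | sub (e₁ e₂ : Expr)

instance : Coe Var Expr := ⟨.var⟩
instance (c : ℕ) : OfNat Expr c := ⟨.lit c⟩
instance : Add Expr := ⟨.add⟩
instance : Sub Expr := ⟨.sub⟩

/-- Structured commands. The only loops are `loop x v c`, in which the counter `x` runs from `0`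
to the value of `v` (exclusive), so that every command terminates. -/
inductive Cmd : Type
  | skip
  | assign (x : Var) (e : Expr)
  | put (A : Arr) (e₁ e₂ : Expr)
  | request
  | coord (x : Var) (e : Expr)
  | label (x : Var)
  | emit (e : Expr)
  | seq (c₁ c₂ : Cmd)
  | branch (e : Expr) (c₁ c₂ : Cmd)
  | loop (x v : Var) (c : Cmd)

infixr:60 " ;; " => Cmd.seq
infix:62 " ≔ " => Cmd.assign

/-- The state on which structured commands operate. -/
structure Store (n : ℕ) where
  v : Var → ℕ
  a : Arr → ℕ → ℕ
  asked : ℕ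
  current : Option (Cube n × ℤˣ)
  out : List ℕ

namespace Store

/-- Assign `u` to the variable `x`. -/
def set (σ : Store n) (x : Var) (u : ℕ) : Store n := { σ with v := Function.update σ.v x u }

/-- Assign `u` to the `i`-th entry of the array `A`. -/
def put (σ : Store n) (A : Arr) (i u : ℕ) : Store n :=
  { σ with a := Function.update σ.a A (Function.update (σ.a A) i u) }

@[simp] theorem set_v (σ : Store n) (x y : Var) (u : ℕ) :
    (σ.set x u).v y = if y = x then u else σ.v y := by
  simp [set, Function.update_apply]

@[simp] theorem set_a (σ : Store n) (x : Var) (u : ℕ) : (σ.set x u).a = σ.a := rfl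
@[simp] theorem set_asked (σ : Store n) (x : Var) (u : ℕ) : (σ.set x u).asked = σ.asked := rfl
@[simp] theorem set_current (σ : Store n) (x : Var) (u : ℕ) :
    (σ.set x u).current = σ.current := rfl
@[simp] theorem set_out (σ : Store n) (x : Var) (u : ℕ) : (σ.set x u).out = σ.out := rfl

@[simp] theorem put_a (σ : Store n) (A B : Arr) (i j u : ℕ) :
    (σ.put A i u).a B j = if B = A ∧ j = i then u else σ.a B j := by
  by_cases h : B = A
  · subst h
    simp [put, Function.update_apply]
  · simp [put, h]

@[simp] theorem put_v (σ : Store n) (A : Arr) (i u : ℕ) : (σ.put A i u).v = σ.v := rfl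
@[simp] theorem put_asked (σ : Store n) (A : Arr) (i u : ℕ) :
    (σ.put A i u).asked = σ.asked := rfl
@[simp] theorem put_current (σ : Store n) (A : Arr) (i u : ℕ) :
    (σ.put A i u).current = σ.current := rfl

end Store

namespace Expr

/-- The value of an expression. -/
def eval (σ : Store n) : Expr → ℕ
  | lit c => c
  | var x => σ.v x
  | entry A e => σ.a A (e.eval σ)
  | add e₁ e₂ => e₁.eval σ + e₂.eval σ
  | sub e₁ e₂ => e₁.eval σ - e₂.eval σ

@[simp] theorem eval_lit (σ : Store n) (c : ℕ) : eval σ (lit c) = c := rfl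
@[simp] theorem eval_zero (σ : Store n) : eval σ 0 = 0 := rfl
@[simp] theorem eval_one (σ : Store n) : eval σ 1 = 1 := rfl
@[simp] theorem eval_var (σ : Store n) (x : Var) : eval σ (var x) = σ.v x := rfl
@[simp] theorem eval_entry (σ : Store n) (A : Arr) (e : Expr) :
    eval σ (entry A e) = σ.a A (e.eval σ) := rfl
@[simp] theorem eval_add (σ : Store n) (e₁ e₂ : Expr) :
    eval σ (e₁ + e₂) = e₁.eval σ + e₂.eval σ := rfl
@[simp] theorem eval_sub (σ : Store n) (e₁ e₂ : Expr) :
    eval σ (e₁ - e₂) = e₁.eval σ - e₂.eval σ := rfl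

end Expr

namespace Cmd

/-- The effect of a command. -/
def exec (E : Env n) : Cmd → Store n → Store n
  | skip, σ => σ
  | assign x e, σ => σ.set x (e.eval σ)
  | put A e₁ e₂, σ => σ.put A (e₁.eval σ) (e₂.eval σ)
  | request, σ => { σ with asked := σ.asked + 1, current := some (E.examples σ.asked) }
  | coord x e, σ => σ.set x (coordBit σ.current (e.eval σ))
  | label x, σ => σ.set x (labelBit σ.current)
  | emit e, σ => { σ with out := σ.out ++ [e.eval σ] }
  | seq c₁ c₂, σ => exec E c₂ (exec E c₁ σ)
  | branch e c₁ c₂, σ => if e.eval σ ≠ 0 then exec E c₁ σ else exec E c₂ σ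
  | loop x v c, σ =>
      (fun τ => (exec E c τ).set x ((exec E c τ).v x + 1))^[σ.v v] (σ.set x 0)

/-- The variables that a command may modify. -/
def mods : Cmd → List Var
  | assign x _ | coord x _ | label x => [x]
  | seq c₁ c₂ | branch _ c₁ c₂ => c₁.mods ++ c₂.mods
  | loop x _ c => x :: c.mods
  | _ => []

/-- The arrays that a command may modify. -/
def amods : Cmd → List Arr
  | put A _ _ => [A]
  | seq c₁ c₂ | branch _ c₁ c₂ => c₁.amods ++ c₂.amods
  | loop _ _ c => c.amods
  | _ => []

/-- Whether a command requests examples. -/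
def asks : Cmd → Bool
  | request => true
  | seq c₁ c₂ | branch _ c₁ c₂ => c₁.asks || c₂.asks
  | loop _ _ c => c.asks
  | _ => false

/-- Whether a command produces output. -/
def emits : Cmd → Bool
  | emit _ => true
  | seq c₁ c₂ | branch _ c₁ c₂ => c₁.emits || c₂.emits
  | loop _ _ c => c.emits
  | _ => false

/-- The variables that bound the loops of a command. -/
def bounds : Cmd → List Var
  | seq c₁ c₂ | branch _ c₁ c₂ => c₁.bounds ++ c₂.bounds
  | loop _ v c => v :: c.bounds
  | _ => []

/-- No loop body modifies the counter of its loop. -/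
def countersSafe : Cmd → Bool
  | seq c₁ c₂ | branch _ c₁ c₂ => c₁.countersSafe && c₂.countersSafe
  | loop x _ c => decide (x ∉ c.mods) && c.countersSafe
  | _ => true

/-- Loop bodies modify neither the counter nor any of the loop bounds of the command. -/
def Safe (c : Cmd) : Prop := c.countersSafe = true ∧ ∀ v ∈ c.bounds, v ∉ c.mods

instance (c : Cmd) : Decidable c.Safe := inferInstanceAs (Decidable (_ ∧ _))

@[simp] theorem exec_skip (E : Env n) (σ : Store n) : exec E skip σ = σ := rfl
@[simp] theorem exec_assign (E : Env n) (σ : Store n) (x : Var) (e : Expr) :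
    exec E (x ≔ e) σ = σ.set x (e.eval σ) := rfl
@[simp] theorem exec_put (E : Env n) (σ : Store n) (A : Arr) (e₁ e₂ : Expr) :
    exec E (put A e₁ e₂) σ = σ.put A (e₁.eval σ) (e₂.eval σ) := rfl
@[simp] theorem exec_request (E : Env n) (σ : Store n) : exec E request σ =
    { σ with asked := σ.asked + 1, current := some (E.examples σ.asked) } := rfl
@[simp] theorem exec_coord (E : Env n) (σ : Store n) (x : Var) (e : Expr) :
    exec E (coord x e) σ = σ.set x (coordBit σ.current (e.eval σ)) := rfl
@[simp] theorem exec_label (E : Env n) (σ : Store n) (x : Var) :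
    exec E (label x) σ = σ.set x (labelBit σ.current) := rfl
@[simp] theorem exec_emit (E : Env n) (σ : Store n) (e : Expr) :
    exec E (emit e) σ = { σ with out := σ.out ++ [e.eval σ] } := rfl
@[simp] theorem exec_seq (E : Env n) (σ : Store n) (c₁ c₂ : Cmd) :
    exec E (c₁ ;; c₂) σ = exec E c₂ (exec E c₁ σ) := rfl
@[simp] theorem exec_branch (E : Env n) (σ : Store n) (e : Expr) (c₁ c₂ : Cmd) :
    exec E (branch e c₁ c₂) σ = if e.eval σ ≠ 0 then exec E c₁ σ else exec E c₂ σ := rfl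

/-- `τ` differs from `σ` at most in what the command `c` may modify. -/
structure Frame (c : Cmd) (σ τ : Store n) : Prop where
  v : ∀ x, x ∉ c.mods → τ.v x = σ.v x
  a : ∀ A, A ∉ c.amods → τ.a A = σ.a A
  asked : c.asks = false → τ.asked = σ.asked
  current : c.asks = false → τ.current = σ.current
  out : c.emits = false → τ.out = σ.out

theorem Frame.refl (c : Cmd) (σ : Store n) : Frame c σ σ :=
  ⟨fun _ _ => rfl, fun _ _ => rfl, fun _ => rfl, fun _ => rfl, fun _ => rfl⟩

theorem Frame.trans {c : Cmd} {σ τ υ : Store n} (h : Frame c σ τ) (h' : Frame c τ υ) :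
    Frame c σ υ :=
  ⟨fun x hx => (h'.v x hx).trans (h.v x hx), fun A hA => (h'.a A hA).trans (h.a A hA),
    fun h0 => (h'.asked h0).trans (h.asked h0), fun h0 => (h'.current h0).trans (h.current h0),
    fun h0 => (h'.out h0).trans (h.out h0)⟩

theorem Frame.weaken {c c' : Cmd} {σ τ : Store n} (h : Frame c σ τ)
    (hv : ∀ x ∈ c.mods, x ∈ c'.mods) (ha : ∀ A ∈ c.amods, A ∈ c'.amods)
    (hq : c'.asks = false → c.asks = false) (he : c'.emits = false → c.emits = false) :
    Frame c' σ τ :=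
  ⟨fun x hx => h.v x fun h' => hx (hv x h'), fun A hA => h.a A fun h' => hA (ha A h'),
    fun h0 => h.asked (hq h0), fun h0 => h.current (hq h0), fun h0 => h.out (he h0)⟩

/-- A command changes only what it may modify. -/
theorem exec_frame (E : Env n) (c : Cmd) (σ : Store n) : Frame c σ (c.exec E σ) := by
  induction c generalizing σ with
  | skip => exact Frame.refl _ _
  | assign x e | coord x e | label x =>
    refine ⟨fun y hy => ?_, fun _ _ => rfl, fun _ => rfl, fun _ => rfl, fun _ => rfl⟩
    have : y ≠ x := fun h => hy (by simp [mods, h])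
    simp [exec, this]
  | put A e₁ e₂ =>
    refine ⟨fun _ _ => rfl, fun B hB => ?_, fun _ => rfl, fun _ => rfl, fun _ => rfl⟩
    have : B ≠ A := fun h => hB (by simp [amods, h])
    funext i
    simp [exec, this]
  | request =>
    exact ⟨fun _ _ => rfl, fun _ _ => rfl, fun h => by simp [asks] at h,
      fun h => by simp [asks] at h, fun _ => rfl⟩
  | emit e =>
    exact ⟨fun _ _ => rfl, fun _ _ => rfl, fun _ => rfl, fun _ => rfl,
      fun h => by simp [emits] at h⟩
  | seq c₁ c₂ ih₁ ih₂ =>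
    refine ((ih₁ σ).weaken ?_ ?_ ?_ ?_).trans ((ih₂ _).weaken ?_ ?_ ?_ ?_) <;>
      simp +contextual [mods, amods, asks, emits]
  | branch e c₁ c₂ ih₁ ih₂ =>
    rw [exec]
    split_ifs
    · refine (ih₁ σ).weaken ?_ ?_ ?_ ?_ <;> simp +contextual [mods, amods, asks, emits]
    · refine (ih₂ σ).weaken ?_ ?_ ?_ ?_ <;> simp +contextual [mods, amods, asks, emits]
  | loop x v c ih =>
    have hset : ∀ (τ : Store n) (u : ℕ), Frame (loop x v c) τ (τ.set x u) := by
      intro τ u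
      refine ⟨fun y hy => ?_, fun _ _ => rfl, fun _ => rfl, fun _ => rfl, fun _ => rfl⟩
      have : y ≠ x := fun h => hy (by simp [mods, h])
      simp [this]
    have hb : ∀ τ : Store n, Frame (loop x v c) τ (c.exec E τ) := fun τ => by
      refine (ih τ).weaken ?_ ?_ ?_ ?_ <;> simp +contextual [mods, amods, asks, emits]
    rw [exec]
    generalize σ.v v = N
    induction N with
    | zero => exact hset _ _
    | succ N ihN =>
      rw [Function.iterate_succ_apply']
      exact ihN.trans ((hb _).trans (hset _ _))

/-- The invariant rule for loops. -/
theorem exec_loop (E : Env n) {x v : Var} {c : Cmd} (hx : x ∉ c.mods) {σ : Store n}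
    (I : ℕ → Store n → Prop) (h0 : I 0 (σ.set x 0))
    (hs : ∀ i < σ.v v, ∀ τ, τ.v x = i → Frame (loop x v c) σ τ → I i τ →
      I (i + 1) ((c.exec E τ).set x (i + 1))) :
    I (σ.v v) ((loop x v c).exec E σ) := by
  have key : ∀ i ≤ σ.v v, I i ((fun τ => (exec E c τ).set x ((exec E c τ).v x + 1))^[i] (σ.set x 0))
      ∧ ((fun τ => (exec E c τ).set x ((exec E c τ).v x + 1))^[i] (σ.set x 0)).v x = i
      ∧ Frame (loop x v c) σ
        ((fun τ => (exec E c τ).set x ((exec E c τ).v x + 1))^[i] (σ.set x 0)) := by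
    have hset : ∀ (τ : Store n) (u : ℕ), Frame (loop x v c) τ (τ.set x u) := by
      intro τ u
      refine ⟨fun y hy => ?_, fun _ _ => rfl, fun _ => rfl, fun _ => rfl, fun _ => rfl⟩
      have : y ≠ x := fun h => hy (by simp [mods, h])
      simp [this]
    have hb : ∀ τ : Store n, Frame (loop x v c) τ (c.exec E τ) := fun τ => by
      refine (exec_frame E c τ).weaken ?_ ?_ ?_ ?_ <;>
        simp +contextual [mods, amods, asks, emits]
    intro i
    induction i with
    | zero => exact fun _ => ⟨h0, by simp, hset _ _⟩
    | succ i ih =>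
      intro hi
      obtain ⟨h1, h2, h3⟩ := ih (by omega)
      rw [Function.iterate_succ_apply']
      have h4 := (exec_frame E c
        ((fun τ => (exec E c τ).set x ((exec E c τ).v x + 1))^[i] (σ.set x 0))).v x hx
      rw [h2] at h4
      refine ⟨?_, by simp [h4], h3.trans ((hb _).trans (hset _ _))⟩
      have := hs i (by omega) _ h2 h3 h1
      simpa only [h4] using this
  exact (key _ le_rfl).1

end Cmd

/-! ### Compilation -/

/-- The number of a variable. The dimension has number `0`, so that its cell is the one that holds
it initially. -/
def Var.code (x : Var) : ℕ := x.ctorIdx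

/-- The number of an array. -/
def Arr.code (A : Arr) : ℕ := A.ctorIdx

theorem Var.code_inj {x y : Var} : x.code = y.code ↔ x = y :=
  ⟨fun h => by rw [← Var.ofNat_ctorIdx x, ← Var.ofNat_ctorIdx y]; exact congrArg _ h,
    fun h => h ▸ rfl⟩

theorem Arr.code_inj {A B : Arr} : A.code = B.code ↔ A = B :=
  ⟨fun h => by rw [← Arr.ofNat_ctorIdx A, ← Arr.ofNat_ctorIdx B]; exact congrArg _ h,
    fun h => h ▸ rfl⟩

theorem Arr.code_lt (A : Arr) : A.code < 8 := by
  cases A <;> decide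

/-- The memory cell of a variable. Multiples of `4` are for variables, odd numbers from `3` on for
array entries, and the remaining even numbers for intermediate results. Cell `1`, which holds the
arity initially, is not used. -/
def Var.cell (x : Var) : ℕ := 4 * x.code

/-- The memory cell of an array entry. -/
def Arr.cell (A : Arr) (i : ℕ) : ℕ := 16 * i + (2 * A.code + 3)

/-- Memory cells for intermediate results. -/
def scratch (d : ℕ) : ℕ := 4 * d + 2

theorem Arr.cell_inj {A B : Arr} {i j : ℕ} : A.cell i = B.cell j ↔ A = B ∧ i = j := by
  constructor
  · intro h
    have hA := A.code_lt
    have hB := B.code_lt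
    unfold Arr.cell at h
    exact ⟨Arr.code_inj.1 (by omega), by omega⟩
  · rintro ⟨rfl, rfl⟩
    rfl

/-- The machine state `s` represents the store `σ`. -/
structure Rep (σ : Store n) (s : State n) : Prop where
  v : ∀ x : Var, s.mem x.cell = σ.v x
  a : ∀ (A : Arr) (i : ℕ), s.mem (A.cell i) = σ.a A i
  asked : s.asked = σ.asked
  current : s.current = σ.current
  out : s.out = σ.out

theorem State.write_mem (s : State n) (d u c : ℕ) :
    (s.write d u).mem c = if c = d then u else s.mem c := by
  simp [State.write, Function.update_apply]

theorem Rep.write_scratch {σ : Store n} {s : State n} (h : Rep σ s) (d u : ℕ) :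
    Rep σ (s.write (scratch d) u) := by
  refine ⟨fun x => ?_, fun A i => ?_, h.asked, h.current, h.out⟩
  · rw [State.write_mem, if_neg (by unfold Var.cell scratch; omega), h.v]
  · rw [State.write_mem, if_neg (by unfold Arr.cell scratch; omega), h.a]

theorem Rep.write_var {σ : Store n} {s : State n} (h : Rep σ s) (x : Var) (u : ℕ) :
    Rep (σ.set x u) (s.write x.cell u) := by
  refine ⟨fun y => ?_, fun A i => ?_, h.asked, h.current, h.out⟩
  · rw [State.write_mem, Store.set_v, h.v]
    have : y.cell = x.cell ↔ y = x := by
      rw [← Var.code_inj]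
      unfold Var.cell
      omega
    simp only [this]
  · rw [State.write_mem, if_neg (by unfold Var.cell Arr.cell; omega), h.a]
    rfl

theorem Rep.write_arr {σ : Store n} {s : State n} (h : Rep σ s) (A : Arr) (i u : ℕ) :
    Rep (σ.put A i u) (s.write (A.cell i) u) := by
  refine ⟨fun y => ?_, fun B j => ?_, h.asked, h.current, h.out⟩
  · rw [State.write_mem, if_neg (by unfold Var.cell Arr.cell; omega), h.v]
    rfl
  · rw [State.write_mem, Store.put_a, h.a]
    simp only [Arr.cell_inj]

/-- Replace the index in scratch cell `d` by the address of the array entry. -/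
def addrProg (A : Arr) (d : ℕ) : Prog :=
  .seq (.add (scratch d) (scratch d) (scratch d)) <|
  .seq (.add (scratch d) (scratch d) (scratch d)) <|
  .seq (.add (scratch d) (scratch d) (scratch d)) <|
  .seq (.add (scratch d) (scratch d) (scratch d)) <|
  .seq (.const (scratch (d + 1)) (2 * A.code + 3))
    (.add (scratch d) (scratch d) (scratch (d + 1)))

theorem runs_addrProg (E : Env n) (A : Arr) (d : ℕ) {σ : Store n} {s : State n} (h : Rep σ s) :
    ∃ s', Runs E (addrProg A d) s 6 s' ∧ Rep σ s' ∧
      s'.mem (scratch d) = A.cell (s.mem (scratch d)) ∧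
      ∀ d' < d, s'.mem (scratch d') = s.mem (scratch d') := by
  refine ⟨_, .seq (.add _ _ _ _) (.seq (.add _ _ _ _) (.seq (.add _ _ _ _)
    (.seq (.add _ _ _ _) (.seq (.const _ _ _) (.add _ _ _ _))))), ?_, ?_, ?_⟩
  · exact (((((h.write_scratch _ _).write_scratch _ _).write_scratch _ _).write_scratch
      _ _).write_scratch _ _).write_scratch _ _
  · have : scratch d ≠ scratch (d + 1) := by unfold scratch; omega
    simp only [State.write_mem, if_true, this, if_false]
    unfold Arr.cell
    ring
  · intro d' hd'
    have h1 : scratch d' ≠ scratch d := by unfold scratch; omega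
    have h2 : scratch d' ≠ scratch (d + 1) := by unfold scratch; omega
    simp only [State.write_mem, h1, h2, if_false]

namespace Expr

/-- Compile an expression; the value ends up in scratch cell `d`, and scratch cells below `d` are
left alone. -/
def compile : Expr → ℕ → Prog
  | lit c, d => .const (scratch d) c
  | var x, d => .seq (.const (scratch d) 0) (.add (scratch d) x.cell (scratch d))
  | entry A e, d => .seq (e.compile d) (.seq (addrProg A d) (.load (scratch d) (scratch d)))
  | add e₁ e₂, d => .seq (e₁.compile d)
      (.seq (e₂.compile (d + 1)) (.add (scratch d) (scratch d) (scratch (d + 1))))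
  | sub e₁ e₂, d => .seq (e₁.compile d)
      (.seq (e₂.compile (d + 1)) (.sub (scratch d) (scratch d) (scratch (d + 1))))

/-- The number of steps of the compiled expression. -/
def cost : Expr → ℕ
  | lit _ => 1
  | var _ => 2
  | entry _ e => e.cost + 7
  | add e₁ e₂ | sub e₁ e₂ => e₁.cost + (e₂.cost + 1)

theorem runs_compile (E : Env n) (e : Expr) (d : ℕ) {σ : Store n} {s : State n} (h : Rep σ s) :
    ∃ s', Runs E (e.compile d) s e.cost s' ∧ Rep σ s' ∧ s'.mem (scratch d) = e.eval σ ∧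
      ∀ d' < d, s'.mem (scratch d') = s.mem (scratch d') := by
  have hne : ∀ {d d' : ℕ}, d' < d → scratch d' ≠ scratch d := by
    intro d d' hd
    unfold scratch
    omega
  induction e generalizing d s with
  | lit c =>
    exact ⟨_, .const _ _ _, h.write_scratch _ _, by simp [State.write_mem],
      fun d' hd' => by simp [State.write_mem, hne hd']⟩
  | var x =>
    refine ⟨_, .seq (.const _ _ _) (.add _ _ _ _), (h.write_scratch _ _).write_scratch _ _, ?_,
      fun d' hd' => by simp [State.write_mem, hne hd']⟩
    have : x.cell ≠ scratch d := by unfold Var.cell scratch; omega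
    simp [State.write_mem, this, h.v]
  | entry A e ih =>
    obtain ⟨s₁, r₁, h₁, v₁, f₁⟩ := ih d h
    obtain ⟨s₂, r₂, h₂, v₂, f₂⟩ := runs_addrProg E A d h₁
    refine ⟨_, .seq r₁ (.seq r₂ (.load _ _ _)), h₂.write_scratch _ _, ?_, fun d' hd' => ?_⟩
    · simp [State.write_mem, v₂, v₁, h₂.a]
    · simp [State.write_mem, hne hd', f₂ d' hd', f₁ d' hd']
  | add e₁ e₂ ih₁ ih₂ =>
    obtain ⟨s₁, r₁, h₁, v₁, f₁⟩ := ih₁ d h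
    obtain ⟨s₂, r₂, h₂, v₂, f₂⟩ := ih₂ (d + 1) h₁
    refine ⟨_, .seq r₁ (.seq r₂ (.add _ _ _ _)), h₂.write_scratch _ _, ?_, fun d' hd' => ?_⟩
    · rw [State.write_mem, if_pos rfl, v₂, f₂ d d.lt_succ_self, v₁, eval]
    · rw [State.write_mem, if_neg (hne hd'), f₂ d' (by omega), f₁ d' hd']
  | sub e₁ e₂ ih₁ ih₂ =>
    obtain ⟨s₁, r₁, h₁, v₁, f₁⟩ := ih₁ d h
    obtain ⟨s₂, r₂, h₂, v₂, f₂⟩ := ih₂ (d + 1) h₁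
    refine ⟨_, .seq r₁ (.seq r₂ (.sub _ _ _ _)), h₂.write_scratch _ _, ?_, fun d' hd' => ?_⟩
    · rw [State.write_mem, if_pos rfl, v₂, f₂ d d.lt_succ_self, v₁, eval]
    · rw [State.write_mem, if_neg (hne hd'), f₂ d' (by omega), f₁ d' hd']

end Expr

namespace Cmd

/-- Compile a command. -/
def compile : Cmd → Prog
  | skip => .skip
  | assign x e => .seq (e.compile 0)
      (.seq (.const (scratch 1) 0) (.add x.cell (scratch 0) (scratch 1)))
  | put A e₁ e₂ => .seq (e₁.compile 0)
      (.seq (addrProg A 0) (.seq (e₂.compile 1) (.store (scratch 0) (scratch 1))))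
  | request => .request
  | coord x e => .seq (e.compile 0) (.coord x.cell (scratch 0))
  | label x => .label x.cell
  | emit e => .seq (e.compile 0) (.emit (scratch 0))
  | seq c₁ c₂ => .seq c₁.compile c₂.compile
  | branch e c₁ c₂ => .seq (e.compile 0) (.ite (scratch 0) c₁.compile c₂.compile)
  | loop x v c => .seq (.const x.cell 0) <| .seq (.sub (scratch 0) v.cell x.cell) <|
      .loop (scratch 0) <| .seq c.compile <| .seq (.const (scratch 1) 1) <|
        .seq (.add x.cell x.cell (scratch 1)) (.sub (scratch 0) v.cell x.cell)

/-- A bound for the number of steps of a compiled command if all loop bounds are at most `H`. -/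
def cost (H : ℕ) : Cmd → ℕ
  | skip => 1
  | assign _ e => e.cost + 2
  | put _ e₁ e₂ => e₁.cost + e₂.cost + 7
  | request => 1
  | coord _ e => e.cost + 1
  | label _ => 1
  | emit e => e.cost + 1
  | seq c₁ c₂ => c₁.cost H + c₂.cost H
  | branch e c₁ c₂ => e.cost + c₁.cost H + c₂.cost H + 1
  | loop _ _ c => H * (c.cost H + 4) + 3

/-- The compiled command does what the command does, in the time given by `Cmd.cost`. -/
theorem runs_compile (E : Env n) (H : ℕ) (c : Cmd) (hc : c.Safe) {σ : Store n} {s : State n}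
    (h : Rep σ s) (hH : ∀ v ∈ c.bounds, σ.v v ≤ H) :
    ∃ t s', Runs E c.compile s t s' ∧ t ≤ c.cost H ∧ Rep (c.exec E σ) s' := by
  induction c generalizing σ s with
  | skip => exact ⟨_, _, .skip _, le_rfl, h⟩
  | assign x e =>
    obtain ⟨s₁, r₁, h₁, v₁, -⟩ := e.runs_compile E 0 h
    refine ⟨_, _, .seq r₁ (.seq (.const _ _ _) (.add _ _ _ _)), by simp [cost], ?_⟩
    have e1 : scratch 0 ≠ scratch 1 := by decide
    rw [State.write_mem, if_neg e1, State.write_mem, if_pos rfl, v₁]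
    exact (h₁.write_scratch _ _).write_var x _
  | put A e₁ e₂ =>
    obtain ⟨s₁, r₁, h₁, v₁, -⟩ := e₁.runs_compile E 0 h
    obtain ⟨s₂, r₂, h₂, v₂, -⟩ := runs_addrProg E A 0 h₁
    obtain ⟨s₃, r₃, h₃, v₃, f₃⟩ := e₂.runs_compile E 1 h₂
    refine ⟨_, _, .seq r₁ (.seq r₂ (.seq r₃ (.store _ _ _))), by simp only [cost]; omega, ?_⟩
    rw [f₃ 0 Nat.zero_lt_one, v₂, v₁, v₃]
    exact h₃.write_arr A _ _
  | request =>
    refine ⟨_, _, .request _, le_rfl, ⟨h.v, h.a, ?_, ?_, h.out⟩⟩ <;> simp [h.asked]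
  | coord x e =>
    obtain ⟨s₁, r₁, h₁, v₁, -⟩ := e.runs_compile E 0 h
    refine ⟨_, _, .seq r₁ (.coord _ _ _), le_rfl, ?_⟩
    rw [v₁, h₁.current]
    exact h₁.write_var x _
  | label x =>
    refine ⟨_, _, .label _ _, le_rfl, ?_⟩
    rw [h.current]
    exact h.write_var x _
  | emit e =>
    obtain ⟨s₁, r₁, h₁, v₁, -⟩ := e.runs_compile E 0 h
    refine ⟨_, _, .seq r₁ (.emit _ _), le_rfl, ⟨h₁.v, h₁.a, h₁.asked, h₁.current, ?_⟩⟩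
    simp [h₁.out, v₁]
  | seq c₁ c₂ ih₁ ih₂ =>
    obtain ⟨hs, hb⟩ := hc
    simp only [countersSafe, Bool.and_eq_true] at hs
    simp only [bounds, mods, List.mem_append] at hb hH
    obtain ⟨t₁, s₁, r₁, l₁, h₁⟩ := ih₁ ⟨hs.1, fun v hv h' => hb v (.inl hv) (.inl h')⟩ h
      fun v hv => hH v (.inl hv)
    obtain ⟨t₂, s₂, r₂, l₂, h₂⟩ := ih₂ ⟨hs.2, fun v hv h' => hb v (.inr hv) (.inr h')⟩ h₁
      fun v hv => by
        rw [(exec_frame E c₁ σ).v v fun h' => hb v (.inr hv) (.inl h')]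
        exact hH v (.inr hv)
    exact ⟨_, _, .seq r₁ r₂, add_le_add l₁ l₂, h₂⟩
  | branch e c₁ c₂ ih₁ ih₂ =>
    obtain ⟨hs, hb⟩ := hc
    simp only [countersSafe, Bool.and_eq_true] at hs
    simp only [bounds, mods, List.mem_append] at hb hH
    obtain ⟨s₀, r₀, h₀, v₀, -⟩ := e.runs_compile E 0 h
    by_cases h0 : e.eval σ ≠ 0
    · obtain ⟨t₁, s₁, r₁, l₁, h₁⟩ := ih₁ ⟨hs.1, fun v hv h' => hb v (.inl hv) (.inl h')⟩ h₀
        fun v hv => hH v (.inl hv)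
      refine ⟨_, _, .seq r₀ (.ite_true (v₀ ▸ h0) r₁), by simp only [cost]; omega, ?_⟩
      rwa [exec, if_pos h0]
    · obtain ⟨t₁, s₁, r₁, l₁, h₁⟩ := ih₂ ⟨hs.2, fun v hv h' => hb v (.inr hv) (.inr h')⟩ h₀
        fun v hv => hH v (.inr hv)
      refine ⟨_, _, .seq r₀ (.ite_false (by rw [v₀]; exact not_not.1 h0) r₁),
        by simp only [cost]; omega, ?_⟩
      rwa [exec, if_neg h0]
  | loop x v c ih =>
    obtain ⟨hs, hb⟩ := hc
    simp only [countersSafe, Bool.and_eq_true, decide_eq_true_eq] at hs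
    simp only [bounds, mods, List.mem_cons] at hb hH
    obtain ⟨hx, hs⟩ := hs
    have hvx : v ≠ x := fun h' => hb v (.inl rfl) (.inl h')
    have hvc : v ∉ c.mods := fun h' => hb v (.inl rfl) (.inr h')
    set body : Store n → Store n := fun τ => (exec E c τ).set x ((exec E c τ).v x + 1) with hbody
    set N := σ.v v with hN
    have hfr : ∀ (τ : Store n) y, y ≠ x → y ∉ c.mods → (body τ).v y = τ.v y := by
      intro τ y hy hyc
      simp only [hbody, Store.set_v, if_neg hy]
      exact (exec_frame E c τ).v y hyc
    have key : ∀ r i τ s, r + i = N → Rep τ s → τ.v x = i →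
        (∀ y, y = v ∨ y ∈ c.bounds → τ.v y = σ.v y) → s.mem (scratch 0) = r →
        ∃ t s', Runs E (.loop (scratch 0) <| .seq c.compile <| .seq (.const (scratch 1) 1) <|
          .seq (.add x.cell x.cell (scratch 1)) (.sub (scratch 0) v.cell x.cell)) s t s' ∧
          t ≤ r * (c.cost H + 4) + 1 ∧ Rep (body^[r] τ) s' := by
      intro r
      induction r with
      | zero =>
        intro i τ s _ hR _ _ h0
        exact ⟨_, _, Runs.loop_stop h0, by simp, hR⟩
      | succ r ihr =>
        intro i τ s hri hR hxi hτ h0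
        obtain ⟨t₁, s₁, r₁, l₁, h₁⟩ := ih ⟨hs, fun y hy h' => hb y (.inr hy) (.inr h')⟩ hR
          fun y hy => (hτ y (.inr hy)).trans_le (hH y (.inr hy))
        have hx1 : (exec E c τ).v x = i := ((exec_frame E c τ).v x hx).trans hxi
        have hv1 : (exec E c τ).v v = N := ((exec_frame E c τ).v v hvc).trans (hτ v (.inl rfl))
        have hxs : x.cell ≠ scratch 1 := by unfold Var.cell scratch; omega
        have hvs : v.cell ≠ scratch 1 := by unfold Var.cell scratch; omega
        have hvxc : v.cell ≠ x.cell := by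
          intro h'
          unfold Var.cell at h'
          exact hvx (Var.code_inj.1 (by omega))
        have hR2 := ((h₁.write_scratch 1 1).write_var x (i + 1)).write_scratch 0 (N - (i + 1))
        obtain ⟨t₂, s₂, r₂, l₂, h₂⟩ := ihr (i + 1) (body τ) _ (by omega)
          (by simp only [hbody, hx1]; exact hR2) (by simp [hbody, hx1])
          (fun y hy => by
            rw [hfr τ y, hτ y hy]
            · rintro rfl
              exact hb y hy (.inl rfl)
            · exact fun h' => hb y hy (.inr h'))
          (by rw [State.write_mem, if_pos rfl]; omega)
        refine ⟨_, s₂, .loop_step (t₂ := t₂) (by omega) (.seq r₁ (.seq (.const _ _ _)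
          (.seq (.add _ _ _ _) (.sub _ _ _ _)))) ?_, ?_, ?_⟩
        · simp only [State.write_mem, if_pos, hxs, hvs, hvxc, if_false, h₁.v, hx1, hv1]
          exact r₂
        · rw [Nat.succ_mul]
          omega
        · rw [Function.iterate_succ_apply]
          exact h₂
    have hvxc : v.cell ≠ x.cell := by
      intro h'
      unfold Var.cell at h'
      exact hvx (Var.code_inj.1 (by omega))
    obtain ⟨t, s', r', l', h'⟩ := key N 0 (σ.set x 0) _ rfl
      ((h.write_var x 0).write_scratch 0 N) (by simp)
      (fun y hy => by
        rw [Store.set_v, if_neg]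
        rintro rfl
        exact hb y hy (.inl rfl))
      (by rw [State.write_mem, if_pos rfl])
    refine ⟨_, s', .seq (.const _ _ _) (.seq (.sub _ _ _ _) (t₂ := t) ?_), ?_, ?_⟩
    · simp only [State.write_mem, if_pos, hvxc, if_false, h.v, Nat.sub_zero]
      exact r'
    · have : N * (c.cost H + 4) ≤ H * (c.cost H + 4) :=
        Nat.mul_le_mul_right _ (hH v (.inl rfl))
      simp only [cost]
      omega
    · exact h'

/-- The running time of a command is polynomial in its loop bounds. -/
theorem exists_cost_le (c : Cmd) : ∃ C D : ℕ, ∀ H, c.cost H ≤ C * (H + 1) ^ D := by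
  have hpow : ∀ H D : ℕ, 1 ≤ (H + 1) ^ D := fun H D => Nat.one_le_pow _ _ (Nat.succ_pos H)
  induction c with
  | skip => exact ⟨1, 0, fun H => by simp [cost]⟩
  | assign x e => exact ⟨e.cost + 2, 0, fun H => by simp [cost]⟩
  | put A e₁ e₂ => exact ⟨e₁.cost + e₂.cost + 7, 0, fun H => by simp [cost]⟩
  | request => exact ⟨1, 0, fun H => by simp [cost]⟩
  | coord x e => exact ⟨e.cost + 1, 0, fun H => by simp [cost]⟩
  | label x => exact ⟨1, 0, fun H => by simp [cost]⟩
  | emit e => exact ⟨e.cost + 1, 0, fun H => by simp [cost]⟩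
  | seq c₁ c₂ ih₁ ih₂ =>
    obtain ⟨C₁, D₁, h₁⟩ := ih₁
    obtain ⟨C₂, D₂, h₂⟩ := ih₂
    refine ⟨C₁ + C₂, D₁ + D₂, fun H => (add_le_add (h₁ H) (h₂ H)).trans ?_⟩
    rw [add_mul]
    gcongr <;> omega
  | branch e c₁ c₂ ih₁ ih₂ =>
    obtain ⟨C₁, D₁, h₁⟩ := ih₁
    obtain ⟨C₂, D₂, h₂⟩ := ih₂
    refine ⟨e.cost + C₁ + C₂ + 1, D₁ + D₂, fun H => ?_⟩
    have e₁ : c₁.cost H ≤ C₁ * (H + 1) ^ (D₁ + D₂) :=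
      (h₁ H).trans (Nat.mul_le_mul_left _ (Nat.pow_le_pow_right (Nat.succ_pos H) (by omega)))
    have e₂ : c₂.cost H ≤ C₂ * (H + 1) ^ (D₁ + D₂) :=
      (h₂ H).trans (Nat.mul_le_mul_left _ (Nat.pow_le_pow_right (Nat.succ_pos H) (by omega)))
    have e₃ := Nat.mul_le_mul_left (e.cost + 1) (hpow H (D₁ + D₂))
    simp only [cost]
    nlinarith
  | loop x v c ih =>
    obtain ⟨C, D, h⟩ := ih
    refine ⟨C + 7, D + 1, fun H => ?_⟩
    have e₁ := h H
    have e₂ := hpow H D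
    simp only [cost]
    calc H * (c.cost H + 4) + 3 ≤ (H + 1) * (C * (H + 1) ^ D + 7 * (H + 1) ^ D) := by
          nlinarith [Nat.mul_le_mul_left H e₁, Nat.mul_le_mul_left H e₂]
      _ = _ := by ring

end Cmd

/-! ### The learning program -/

section program

open Var Cmd
open JuntaWalk.Expr (entry)

/-- Simple parameters. -/
def setSimple : Cmd :=
  arity4 ≔ arity + arity + arity + arity ;;
  reps ≔ arity4 + arity4 + arity4 + arity4 + arity4 + (epsLen + epsLen) ;;
  deltaLen1 ≔ deltaLen + 1 ;; dim2 ≔ dim + dim ;; cap ≔ 1 ;; tableSize ≔ 1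

/-- The maximal number of candidate variables and the size of a truth table. -/
def setPowers : Cmd :=
  loop i reps (cap ≔ cap + cap) ;; loop i arity (tableSize ≔ tableSize + tableSize)

/-- The reciprocal of the accuracy of the estimates. -/
def setPrec : Cmd := prec ≔ 0 ;; loop i cap (prec ≔ prec + dim)

/-- The number of requests before the window of each block opens, and an auxiliary square. -/
def setWait : Cmd :=
  wait ≔ 1 ;; loop i prec (wait ≔ wait + dim) ;;
  precSq ≔ 0 ;; loop i prec (precSq ≔ precSq + prec)

/-- Half of the threshold for candidate variables, by repeated addition of `deltaLen + 1`. -/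
def setThr : Cmd := thr ≔ 0 ;; loop i precSq (thr ≔ thr + deltaLen1)

/-- The number of blocks. -/
def setBlocks : Cmd := blocks ≔ 0 ;; loop i prec (blocks ≔ blocks + thr)

/-- Store the coordinates of the current example. -/
def storePoint : Cmd :=
  loop i dim (coord bit i ;; put .points (p + i) bit)

/-- Find the coordinate in which the current example differs from the stored one. The sum of the two
truncated differences is a test for inequality. -/
def findFlip : Cmd :=
  loop i dim (coord bit i ;;
    branch ((entry .points (p + i) - bit) + (bit - entry .points (p + i))) (flip ≔ i) skip)

/-- Update the counters for the flipped coordinate. The product `(y1 - y0) * (y2 + y3) / 4` of signs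
is nonzero only if `y0 ≠ y1` and `y2 = y3`, and then it is `1` or `-1` according to whether
`y1 = y2`. -/
def countFlip : Cmd :=
  branch ((y0 - y1) + (y1 - y0))
    (branch ((y2 - y3) + (y3 - y2)) skip
      (branch ((y1 - y2) + (y2 - y1))
        (put .neg flip (entry .neg flip + 1))
        (put .pos flip (entry .pos flip + 1))))
    skip

/-- Process one block of the walk. -/
def sampleBlock : Cmd :=
  loop z wait request ;; label y0 ;; storePoint ;; put .labels j y0 ;;
  request ;; label y1 ;; findFlip ;;
  loop z dim2 request ;; label y2 ;; request ;; label y3 ;; countFlip ;; p ≔ p + dim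

/-- Process all blocks of the walk. -/
def sample : Cmd := p ≔ 0 ;; loop j blocks sampleBlock

/-- List the candidate variables, but not more than `cap` of them: variable `0`, those whose
counters exceed the threshold, and all variables if there are few of them. -/
def select : Cmd :=
  r ≔ 0 ;; loop i dim
    (branch ((1 - i) + (arity4 + 1 - dim) + (entry .pos i + 1 - (entry .neg i + thr + thr)))
      (branch (cap - r) (put .cand r i ;; r ≔ r + 1) skip) skip)

/-- The number of tuples of candidate variables. -/
def countTuples : Cmd :=
  total ≔ 1 ;; loop i arity (acc ≔ 0 ;; loop j r (acc ≔ acc + total) ;; total ≔ acc)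

/-- Divide `tmp` by `r` with remainder, by repeated subtraction; `total` bounds the quotient. -/
def divide : Cmd :=
  quo ≔ 0 ;; loop z total (branch (tmp + 1 - r) (tmp ≔ tmp - r ;; quo ≔ quo + 1) skip)

/-- The position of the current sample in the truth table over the tuple number `cc`. -/
def locate : Cmd :=
  tmp ≔ cc ;; pw ≔ 1 ;; idx ≔ 0 ;; loop l arity
    (divide ;; branch (entry .points (p + entry .cand tmp)) (idx ≔ idx + pw) skip ;;
      tmp ≔ quo ;; pw ≔ pw + pw)

/-- Count the labels of the samples for each position in the truth table. -/
def tally : Cmd :=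
  loop i tableSize (put .zeros i 0 ;; put .ones i 0) ;; p ≔ 0 ;;
  loop j blocks (locate ;;
    branch (entry .labels j) (put .ones idx (entry .ones idx + 1))
      (put .zeros idx (entry .zeros idx + 1)) ;;
    p ≔ p + dim)

/-- The number of samples on which the best truth table errs. -/
def addUp : Cmd :=
  score ≔ 0 ;; loop i tableSize
    (score ≔ score + (entry .zeros i - (entry .zeros i - entry .ones i)))

/-- Find the best tuple of candidate variables. -/
def search : Cmd :=
  best ≔ blocks + 1 ;; bestc ≔ 0 ;; loop c total
    (cc ≔ c ;; tally ;; addUp ;; branch (best - score) (best ≔ score ;; bestc ≔ cc) skip)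

/-- Output the best tuple and its truth table. -/
def answer : Cmd :=
  cc ≔ bestc ;; tally ;; emit arity ;; tmp ≔ cc ;;
  loop l arity (divide ;; emit (entry .cand tmp) ;; tmp ≔ quo) ;;
  loop i tableSize (emit (1 - (1 - (entry .ones i - entry .zeros i))))

/-- The phases of the program after the digits of the parameters have been read. -/
def phases : List Cmd :=
  [setSimple, setPowers, setPrec, setWait, setThr, setBlocks, sample, select, countTuples,
    search, answer]

end program

theorem phases_safe : ∀ c ∈ phases, c.Safe := by decide

/-! ### Parameters -/

open Cmd

theorem exec_accumulate (E : Env n) (σ : Store n) {u v x y : Var} (hux : u ≠ x) (huy : u ≠ y)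
    (hxy : x ≠ y) : ((loop u v (x ≔ .var x + .var y)).exec E σ).v x
      = σ.v x + σ.v v * σ.v y := by
  refine exec_loop E (by simpa [mods] using hux)
    (fun m τ => τ.v x = σ.v x + m * σ.v y) (by simp [hux.symm]) fun m _ τ _ hf h => ?_
  have hy : τ.v y = σ.v y := hf.v y (by simp [mods, huy.symm, hxy.symm])
  simp [hux.symm, h, hy]
  ring

theorem exec_double (E : Env n) (σ : Store n) {u v x : Var} (hux : u ≠ x) :
    ((loop u v (x ≔ .var x + .var x)).exec E σ).v x = σ.v x * 2 ^ σ.v v := by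
  refine exec_loop E (by simpa [mods] using hux)
    (fun m τ => τ.v x = σ.v x * 2 ^ m) (by simp [hux.symm]) fun m _ τ _ _ h => ?_
  simp [hux.symm, h, pow_succ]
  ring

/-- The maximal number of candidate variables, for an accuracy of at least `2 ^ (-e)`. Walk
influences above its reciprocal count as large. -/
def capOf (k e : ℕ) : ℕ := 2 ^ (20 * k + 2 * e)

/-- The reciprocal of the accuracy of the estimates. -/
def precOf (n k e : ℕ) : ℕ := n * capOf k e

/-- Half of the threshold for candidate variables: the number of blocks times the accuracy of the
estimates. -/
def thrOf (n k e d : ℕ) : ℕ := precOf n k e ^ 2 * (d + 1)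

/-- The number of blocks, `precOf ^ 3 * (d + 1)`. Deviations by `1 / precOf` then have probability
about `exp (-precOf * (d + 1))`. -/
def blocksOf (n k e d : ℕ) : ℕ := precOf n k e * thrOf n k e d

/-- The time at which the window of a block opens. -/
def delayOf (n k e : ℕ) : ℕ := n * precOf n k e

/-- The store after the parameters have been computed. -/
structure Prepared (k e d : ℕ) (σ : Store n) : Prop where
  dim : σ.v .dim = n
  arity : σ.v .arity = k
  arity4 : σ.v .arity4 = 4 * k
  cap : σ.v .cap = capOf k e
  thr : σ.v .thr = thrOf n k e d
  blocks : σ.v .blocks = blocksOf n k e d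
  wait : σ.v .wait = delayOf n k e + 1
  dim2 : σ.v .dim2 = 2 * n
  tableSize : σ.v .tableSize = 2 ^ k

/-- The store before the parameters are computed. -/
structure Initial (k e d : ℕ) (σ : Store n) : Prop where
  dim : σ.v .dim = n
  arity : σ.v .arity = k
  epsLen : σ.v .epsLen = e
  deltaLen : σ.v .deltaLen = d
  a : ∀ A i, σ.a A i = 0
  asked : σ.asked = 0
  out : σ.out = []

/-- Bounds for the loops of the computation of the parameters, and its result. -/
theorem exec_prepare (E : Env n) {k e d : ℕ} {σ : Store n} (h : Initial k e d σ) :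
    let σ₁ := setSimple.exec E σ
    let σ₂ := setPowers.exec E σ₁
    let σ₃ := setPrec.exec E σ₂
    let σ₄ := setWait.exec E σ₃
    let σ₅ := setThr.exec E σ₄
    let σ₆ := setBlocks.exec E σ₅
    σ₁.v .reps = 20 * k + 2 * e ∧ σ₁.v .arity = k ∧ σ₂.v .cap = capOf k e ∧
      σ₃.v .prec = precOf n k e ∧ σ₄.v .precSq = precOf n k e ^ 2 ∧ σ₅.v .prec = precOf n k e ∧
      Prepared k e d σ₆ ∧ (∀ A i, σ₆.a A i = 0) ∧ σ₆.asked = 0 ∧ σ₆.out = [] := by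
  intro σ₁ σ₂ σ₃ σ₄ σ₅ σ₆
  have f₁ : Frame setSimple σ σ₁ := exec_frame E _ _
  have f₂ : Frame setPowers σ₁ σ₂ := exec_frame E _ _
  have f₃ : Frame setPrec σ₂ σ₃ := exec_frame E _ _
  have f₄ : Frame setWait σ₃ σ₄ := exec_frame E _ _
  have f₅ : Frame setThr σ₄ σ₅ := exec_frame E _ _
  have f₆ : Frame setBlocks σ₅ σ₆ := exec_frame E _ _
  have reps₁ : σ₁.v .reps = 20 * k + 2 * e := by
    simp [σ₁, setSimple, h.arity, h.epsLen]
    ring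
  have arity₁ : σ₁.v .arity = k := by simp [σ₁, setSimple, h.arity]
  have arity4₁ : σ₁.v .arity4 = 4 * k := by
    simp [σ₁, setSimple, h.arity]
    ring
  have dl₁ : σ₁.v .deltaLen1 = d + 1 := by simp [σ₁, setSimple, h.deltaLen]
  have dim2₁ : σ₁.v .dim2 = 2 * n := by
    simp [σ₁, setSimple, h.dim]
    ring
  have cap₁ : σ₁.v .cap = 1 := by simp [σ₁, setSimple]
  have ts₁ : σ₁.v .tableSize = 1 := by simp [σ₁, setSimple]
  have dim₁ : σ₁.v .dim = n := by simp [σ₁, setSimple, h.dim]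
  have cap₂ : σ₂.v .cap = capOf k e := by
    simp only [σ₂, setPowers, exec_seq]
    rw [(exec_frame E _ _).v .cap (by decide), exec_double E _ (by decide), cap₁, reps₁, one_mul,
      capOf]
  have ts₂ : σ₂.v .tableSize = 2 ^ k := by
    simp only [σ₂, setPowers, exec_seq]
    rw [exec_double E _ (by decide), (exec_frame E _ σ₁).v .tableSize (by decide),
      (exec_frame E _ σ₁).v .arity (by decide), ts₁, arity₁, one_mul]
  have dim₂ : σ₂.v .dim = n := (f₂.v _ (by decide)).trans dim₁
  have prec₃ : σ₃.v .prec = precOf n k e := by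
    simp only [σ₃, setPrec, exec_seq]
    rw [exec_accumulate E _ (by decide) (by decide) (by decide)]
    simp [cap₂, dim₂, precOf]
    ring
  have dim₃ : σ₃.v .dim = n := (f₃.v _ (by decide)).trans dim₂
  have wait₄ : σ₄.v .wait = delayOf n k e + 1 := by
    simp only [σ₄, setWait, exec_seq]
    rw [(exec_frame E _ _).v .wait (by decide), (exec_frame E _ _).v .wait (by decide),
      exec_accumulate E _ (by decide) (by decide) (by decide)]
    simp [prec₃, dim₃, delayOf]
    ring
  have sq₄ : σ₄.v .precSq = precOf n k e ^ 2 := by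
    have : ∀ τ : Store n, τ.v .prec = precOf n k e →
        ((loop .i .prec (.precSq ≔ .var .precSq + .var .prec)).exec E
          ((Var.precSq ≔ 0).exec E τ)).v .precSq = precOf n k e ^ 2 := by
      intro τ hτ
      rw [exec_accumulate E _ (by decide) (by decide) (by decide)]
      simp [hτ]
      ring
    simp only [σ₄, setWait, exec_seq]
    refine this _ ?_
    rw [(exec_frame E _ _).v .prec (by decide), (exec_frame E _ _).v .prec (by decide), prec₃]
  have prec₅ : σ₅.v .prec = precOf n k e :=
    ((f₅.v _ (by decide)).trans (f₄.v _ (by decide))).trans prec₃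
  have dl₄ : σ₄.v .deltaLen1 = d + 1 :=
    (f₄.v _ (by decide)).trans ((f₃.v _ (by decide)).trans ((f₂.v _ (by decide)).trans dl₁))
  have thr₅ : σ₅.v .thr = thrOf n k e d := by
    simp only [σ₅, setThr, exec_seq]
    rw [exec_accumulate E _ (by decide) (by decide) (by decide)]
    simp [sq₄, dl₄, thrOf]
  have blocks₆ : σ₆.v .blocks = blocksOf n k e d := by
    simp only [σ₆, setBlocks, exec_seq]
    rw [exec_accumulate E _ (by decide) (by decide) (by decide)]
    simp [prec₅, thr₅, blocksOf]
  refine ⟨reps₁, arity₁, cap₂, prec₃, sq₄, prec₅, ⟨?_, ?_, ?_, ?_, ?_, blocks₆, ?_, ?_, ?_⟩,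
    ?_, ?_, ?_⟩
  · rw [f₆.v _ (by decide), f₅.v _ (by decide), f₄.v _ (by decide), dim₃]
  · rw [f₆.v _ (by decide), f₅.v _ (by decide), f₄.v _ (by decide), f₃.v _ (by decide),
      f₂.v _ (by decide), arity₁]
  · rw [f₆.v _ (by decide), f₅.v _ (by decide), f₄.v _ (by decide), f₃.v _ (by decide),
      f₂.v _ (by decide), arity4₁]
  · rw [f₆.v _ (by decide), f₅.v _ (by decide), f₄.v _ (by decide), f₃.v _ (by decide), cap₂]
  · rw [f₆.v _ (by decide), thr₅]
  · rw [f₆.v _ (by decide), f₅.v _ (by decide), wait₄]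
  · rw [f₆.v _ (by decide), f₅.v _ (by decide), f₄.v _ (by decide), f₃.v _ (by decide),
      f₂.v _ (by decide), dim2₁]
  · rw [f₆.v _ (by decide), f₅.v _ (by decide), f₄.v _ (by decide), f₃.v _ (by decide), ts₂]
  · intro A i
    rw [f₆.a A (by simp [setBlocks, amods]), f₅.a A (by simp [setThr, amods]),
      f₄.a A (by simp [setWait, amods]), f₃.a A (by simp [setPrec, amods]),
      f₂.a A (by simp [setPowers, amods]), f₁.a A (by simp [setSimple, amods]), h.a]
  · rw [f₆.asked rfl, f₅.asked rfl, f₄.asked rfl, f₃.asked rfl, f₂.asked rfl, f₁.asked rfl,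
      h.asked]
  · rw [f₆.out rfl, f₅.out rfl, f₄.out rfl, f₃.out rfl, f₂.out rfl, f₁.out rfl, h.out]

/-! ### Sampling -/

theorem signBit_inj {a b : ℤˣ} : signBit a = signBit b ↔ a = b := by
  rcases Int.units_eq_one_or a with rfl | rfl <;>
    rcases Int.units_eq_one_or b with rfl | rfl <;> decide

theorem signBit_le_one (a : ℤˣ) : signBit a ≤ 1 := by
  unfold signBit
  split_ifs <;> omega

theorem coordBit_some (e : Cube n × ℤˣ) (i : Fin n) : coordBit (some e) i = signBit (e.1 i) := by
  simp [coordBit]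

theorem exec_requests (E : Env n) (σ : Store n) {v : Var} (hv : 0 < σ.v v) :
    ((loop .z v request).exec E σ).asked = σ.asked + σ.v v ∧
      ((loop .z v request).exec E σ).current = some (E.examples (σ.asked + σ.v v - 1)) := by
  have := exec_loop E (x := .z) (v := v) (c := request) (by simp [mods]) (σ := σ)
    (fun m τ => τ.asked = σ.asked + m ∧
      (0 < m → τ.current = some (E.examples (σ.asked + m - 1)))) (by simp) (by
      rintro m - τ - - ⟨h, -⟩
      simp [h, Nat.add_assoc])
  exact ⟨this.1, this.2 hv⟩

theorem exec_storePoint (E : Env n) (σ : Store n) (hdim : σ.v .dim = n) :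
    (∀ i < n, (storePoint.exec E σ).a .points (σ.v .p + i) = coordBit σ.current i) ∧
      ∀ m < σ.v .p, (storePoint.exec E σ).a .points m = σ.a .points m := by
  have := exec_loop E (x := .i) (v := .dim)
    (c := coord .bit (.var .i) ;; put .points (.var .p + .var .i) (.var .bit)) (by decide) (σ := σ)
    (fun m τ => (∀ i < m, τ.a .points (σ.v .p + i) = coordBit σ.current i) ∧
      ∀ m < σ.v .p, τ.a .points m = σ.a .points m) (by simp) (by
      rintro m - τ hm hf ⟨h₁, h₂⟩
      have hp : τ.v .p = σ.v .p := hf.v _ (by decide)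
      have hc : τ.current = σ.current := hf.current rfl
      simp only [exec_seq, exec_coord, exec_put, Store.set_a, Store.put_a, Expr.eval_add,
        Expr.eval_var, Store.set_v, hp, hm, hc, true_and, reduceCtorEq, if_false,
        if_true]
      refine ⟨fun i hi => ?_, fun i hi => ?_⟩
      · rcases Nat.lt_succ_iff_lt_or_eq.1 hi with h | rfl
        · rw [if_neg (by omega), h₁ i h]
        · simp
      · rw [if_neg (by omega), h₂ i hi])
  rwa [hdim] at this

theorem signBit_sub_ne_zero {a b : ℤˣ} :
    (signBit a - signBit b) + (signBit b - signBit a) ≠ 0 ↔ a ≠ b := by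
  rw [← signBit_inj.ne]
  omega

theorem exec_findFlip (E : Env n) (σ : Store n) (hdim : σ.v .dim = n) {y : Cube n} {u : Fin n}
    {s : ℤˣ} (hy : ∀ i : Fin n, σ.a .points (σ.v .p + i) = signBit (y i))
    (hc : σ.current = some (y * flipVec u, s)) : (findFlip.exec E σ).v .flip = u := by
  have := exec_loop E (x := .i) (v := .dim)
    (c := coord .bit (.var .i) ;; branch ((.entry .points (.var .p + .var .i) - .var .bit)
      + (.var .bit - .entry .points (.var .p + .var .i))) (.flip ≔ .var .i) skip) (by decide)
    (σ := σ) (fun m τ => u < m → τ.v .flip = u) (by simp) (by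
      intro m hmn τ hm hf h hu
      have hp : τ.v .p = σ.v .p := hf.v _ (by decide)
      have hc' : τ.current = σ.current := hf.current rfl
      have ha : τ.a .points = σ.a .points := hf.a _ (by decide)
      rw [hdim] at hmn
      have h1 : σ.a .points (σ.v .p + m) = signBit (y ⟨m, hmn⟩) := hy ⟨m, hmn⟩
      have h2 : coordBit σ.current m = signBit ((y * flipVec u) ⟨m, hmn⟩) := by
        rw [hc]
        exact coordBit_some _ ⟨m, hmn⟩
      simp only [exec_seq, exec_coord, exec_branch, Store.set_a, Expr.eval_add, Expr.eval_sub,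
        Expr.eval_entry, Expr.eval_var, Store.set_v, hp, hm, hc', ha, h1, h2, reduceCtorEq,
        if_false, if_true, signBit_sub_ne_zero, exec_assign, exec_skip]
      by_cases hmu : m = u
      · rw [if_pos]
        · simp [hmu]
        · have e : (⟨m, hmn⟩ : Fin n) = u := Fin.ext hmu
          rw [e, Pi.mul_apply, flipVec, if_pos rfl]
          rcases Int.units_eq_one_or (y u) with h | h <;> simp [h]
      · rw [if_neg]
        · simp [h (by omega)]
        · have e : (⟨m, hmn⟩ : Fin n) ≠ u := fun h => hmu (congrArg Fin.val h)
          rw [Pi.mul_apply, flipVec, if_neg e, mul_one]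
          simp)
  rw [hdim] at this
  exact this u.2

theorem exec_countFlip (E : Env n) (σ : Store n) {s₀ s₁ s₂ s₃ : ℤˣ} (h₀ : σ.v .y0 = signBit s₀)
    (h₁ : σ.v .y1 = signBit s₁) (h₂ : σ.v .y2 = signBit s₂) (h₃ : σ.v .y3 = signBit s₃) (i : ℕ) :
    ((countFlip.exec E σ).a .pos i : ℝ) - (countFlip.exec E σ).a .neg i
      = σ.a .pos i - σ.a .neg i + if σ.v .flip = i then
        (((s₁ : ℤ) : ℝ) - ((s₀ : ℤ) : ℝ)) * (((s₂ : ℤ) : ℝ) + ((s₃ : ℤ) : ℝ)) / 4 else 0 := by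
  simp only [countFlip, exec_branch, Expr.eval_add, Expr.eval_sub, Expr.eval_var, h₀, h₁, h₂, h₃,
    signBit_sub_ne_zero, exec_skip, exec_put, Expr.eval_entry, Expr.eval_one]
  by_cases hi : σ.v .flip = i
  · rw [if_pos hi]
    rcases Int.units_eq_one_or s₀ with rfl | rfl <;>
    rcases Int.units_eq_one_or s₁ with rfl | rfl <;>
    rcases Int.units_eq_one_or s₂ with rfl | rfl <;>
    rcases Int.units_eq_one_or s₃ with rfl | rfl <;>
    simp [hi, show (1 : ℤˣ) ≠ -1 by decide, show (-1 : ℤˣ) ≠ 1 by decide] <;> ring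
  · have hi' : i ≠ σ.v .flip := fun h => hi h.symm
    rw [if_neg hi]
    split_ifs <;> simp [hi']

/-- The contribution to the counters of the `i`-th variable of a window that opens at time `s`. -/
noncomputable def observed (f : Cube n → ℤˣ) (w : WalkSpace n) (s : ℕ) (i : Fin n) : ℝ :=
  if w.2 s = i then (toReal f (walk w (s + 1)) - toReal f (walk w s)) *
    (toReal f (walk w (s + 1 + 2 * n)) + toReal f (walk w (s + 1 + 2 * n + 1))) / 4 else 0

/-- The length of a block. It is odd, so that the parity of the walk alternates from block to
block. -/
def blockLen (n T : ℕ) : ℕ := T + 2 * n + 3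

theorem exec_sampleBlock [NeZero n] (E : Env n) {f : Cube n → ℤˣ} {w : WalkSpace n}
    (hE : ∀ t, E.examples t = (walk w t, f (walk w t))) (σ : Store n) {T : ℕ}
    (hdim : σ.v .dim = n) (hwait : σ.v .wait = T + 1) (hdim2 : σ.v .dim2 = 2 * n) :
    let τ := sampleBlock.exec E σ
    (∀ i : Fin n, τ.a .points (σ.v .p + i) = signBit (walk w (σ.asked + T) i)) ∧
    (∀ m < σ.v .p, τ.a .points m = σ.a .points m) ∧
    (∀ m, τ.a .labels m
      = if m = σ.v .j then signBit (f (walk w (σ.asked + T))) else σ.a .labels m) ∧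
    (∀ i : Fin n, (τ.a .pos i : ℝ) - τ.a .neg i
      = σ.a .pos i - σ.a .neg i + observed f w (σ.asked + T) i) ∧
    τ.asked = σ.asked + blockLen n T ∧ τ.v .p = σ.v .p + n := by
  intro τ
  set s := σ.asked + T with hs
  set σ₁ := (loop .z .wait request).exec E σ with hσ₁
  set σ₂ := (label .y0).exec E σ₁ with hσ₂
  set σ₃ := storePoint.exec E σ₂ with hσ₃
  set σ₄ := (put .labels (.var .j) (.var .y0)).exec E σ₃ with hσ₄
  set σ₅ := (label .y1).exec E (request.exec E σ₄) with hσ₅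
  set σ₆ := findFlip.exec E σ₅ with hσ₆
  set σ₇ := (loop .z .dim2 request).exec E σ₆ with hσ₇
  set σ₈ := (label .y3).exec E (request.exec E ((label .y2).exec E σ₇)) with hσ₈
  set σ₉ := countFlip.exec E σ₈ with hσ₉
  have hτ : τ = (Var.p ≔ .var .p + .var .dim).exec E σ₉ := rfl
  have f₁ : Frame (loop .z .wait request) σ σ₁ := exec_frame E _ _
  have f₃ : Frame storePoint σ₂ σ₃ := exec_frame E _ _
  have f₆ : Frame findFlip σ₅ σ₆ := exec_frame E _ _
  have f₇ : Frame (loop .z .dim2 request) σ₆ σ₇ := exec_frame E _ _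
  have f₉ : Frame countFlip σ₈ σ₉ := exec_frame E _ _
  obtain ⟨ask₁, cur₁⟩ := exec_requests E σ (v := .wait) (by omega)
  rw [hwait, ← hσ₁, hE] at cur₁
  rw [hwait, ← hσ₁] at ask₁
  rw [show σ.asked + (T + 1) - 1 = s by omega] at cur₁
  have ask₁' : σ₁.asked = s + 1 := by omega
  -- the point and the label at time `s`
  have v₂ : ∀ x, x ≠ .y0 → x ≠ .z → σ₂.v x = σ.v x := by
    intro x h1 h2
    rw [hσ₂, exec_label, Store.set_v, if_neg h1, f₁.v x (by simp [mods, h2])]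
  have y0₂ : σ₂.v .y0 = signBit (f (walk w s)) := by
    rw [hσ₂, exec_label, Store.set_v, if_pos rfl, cur₁]
    rfl
  have a₂ : σ₂.a = σ.a := by
    rw [hσ₂, exec_label, Store.set_a]
    funext A
    exact f₁.a A (by simp [amods])
  have cur₂ : σ₂.current = some (walk w s, f (walk w s)) := cur₁
  obtain ⟨pt₃, old₃⟩ := exec_storePoint E σ₂ (by rw [v₂ _ (by decide) (by decide), hdim])
  rw [← hσ₃, v₂ .p (by decide) (by decide)] at pt₃ old₃
  have v₃ : ∀ x, x ∉ [Var.y0, .z, .i, .bit] → σ₃.v x = σ.v x := by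
    intro x hx
    simp only [List.mem_cons, List.not_mem_nil, or_false, not_or] at hx
    rw [f₃.v x (by simp [storePoint, mods, hx]), v₂ x hx.1 hx.2.1]
  have y0₃ : σ₃.v .y0 = signBit (f (walk w s)) := (f₃.v _ (by decide)).trans y0₂
  have ask₃ : σ₃.asked = s + 1 := (f₃.asked rfl).trans ask₁'
  have pts₃ : ∀ i : Fin n, σ₃.a .points (σ.v .p + i) = signBit (walk w s i) := by
    intro i
    rw [pt₃ i i.2, cur₂, coordBit_some]
  -- the flipped coordinate and the label at time `s + 1`
  have cur₅ : σ₅.current = some (walk w s * flipVec (w.2 s), f (walk w (s + 1))) := by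
    have : σ₅.current = some (E.examples σ₃.asked) := rfl
    rw [this, ask₃, hE]
    rfl
  have a₅ : ∀ A, A ≠ .labels → σ₅.a A = σ₃.a A := by
    intro A hA
    funext i
    simp [hσ₅, hσ₄, hA]
  have lab₅ : ∀ m, σ₅.a .labels m
      = if m = σ.v .j then signBit (f (walk w s)) else σ.a .labels m := by
    intro m
    have h1 : σ₃.a .labels = σ.a .labels := (f₃.a _ (by decide)).trans (by rw [a₂])
    simp [hσ₅, hσ₄, y0₃, h1, v₃ .j (by decide)]
  have y1₅ : σ₅.v .y1 = signBit (f (walk w (s + 1))) := by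
    have : σ₅.v .y1 = labelBit (some (E.examples σ₃.asked)) := by simp [hσ₅, hσ₄]
    rw [this, ask₃, hE]
    rfl
  have v₅ : ∀ x, x ≠ .y1 → σ₅.v x = σ₃.v x := by
    intro x hx
    simp [hσ₅, hσ₄, hx]
  have ask₅ : σ₅.asked = s + 2 := by
    have : σ₅.asked = σ₃.asked + 1 := rfl
    omega
  have p₅ : σ₅.v .p = σ.v .p := (v₅ _ (by decide)).trans (v₃ _ (by decide))
  have flip₆ : σ₆.v .flip = w.2 s := by
    refine exec_findFlip E σ₅ (y := walk w s) (by
      rw [v₅ _ (by decide), v₃ _ (by decide), hdim]) (fun i => ?_) cur₅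
    rw [a₅ _ (by decide), p₅, pts₃]
  have ask₆ : σ₆.asked = s + 2 := (f₆.asked rfl).trans ask₅
  -- the labels after `2n` and `2n + 1` further steps
  have dim2₆ : σ₆.v .dim2 = 2 * n := by
    rw [f₆.v _ (by decide), v₅ _ (by decide), v₃ _ (by decide), hdim2]
  have hn : 0 < n := NeZero.pos n
  obtain ⟨ask₇, cur₇⟩ := exec_requests E σ₆ (v := .dim2) (by omega)
  rw [dim2₆, ← hσ₇, hE, ask₆] at cur₇
  rw [dim2₆, ← hσ₇, ask₆] at ask₇
  rw [show s + 2 + 2 * n - 1 = s + 1 + 2 * n by omega] at cur₇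
  have y2₈ : σ₈.v .y2 = signBit (f (walk w (s + 1 + 2 * n))) := by
    have : σ₈.v .y2 = labelBit σ₇.current := by simp [hσ₈]
    rw [this, cur₇]
    rfl
  have y3₈ : σ₈.v .y3 = signBit (f (walk w (s + 1 + 2 * n + 1))) := by
    have : σ₈.v .y3 = labelBit (some (E.examples σ₇.asked)) := by simp [hσ₈]
    rw [this, ask₇, hE, show s + 2 + 2 * n = s + 1 + 2 * n + 1 by omega]
    rfl
  have v₈ : ∀ x, x ≠ .y2 → x ≠ .y3 → x ≠ .z → σ₈.v x = σ₆.v x := by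
    intro x h2 h3 hz
    have : σ₈.v x = σ₇.v x := by simp [hσ₈, h2, h3]
    rw [this, f₇.v x (by simp [mods, hz])]
  have a₈ : σ₈.a = σ₅.a := by
    have : σ₈.a = σ₇.a := rfl
    rw [this]
    funext A
    rw [f₇.a A (by simp [amods]), f₆.a A (by simp [findFlip, amods])]
  have ask₈ : σ₈.asked = s + 2 + 2 * n + 1 := by
    have : σ₈.asked = σ₇.asked + 1 := rfl
    omega
  have y0₈ : σ₈.v .y0 = signBit (f (walk w s)) := by
    rw [v₈ _ (by decide) (by decide) (by decide), f₆.v _ (by decide), v₅ _ (by decide), y0₃]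
  have y1₈ : σ₈.v .y1 = signBit (f (walk w (s + 1))) := by
    rw [v₈ _ (by decide) (by decide) (by decide), f₆.v _ (by decide), y1₅]
  have flip₈ : σ₈.v .flip = w.2 s := by
    rw [v₈ _ (by decide) (by decide) (by decide), flip₆]
  have aτ : τ.a = σ₉.a := rfl
  have pts₉ : τ.a .points = σ₃.a .points := by
    rw [aτ, f₉.a _ (by decide), a₈, a₅ _ (by decide)]
  refine ⟨fun i => by rw [pts₉, pts₃], fun m hm => by rw [pts₉, old₃ m hm, a₂], fun m => ?_,
    fun i => ?_, ?_, ?_⟩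
  · rw [aτ, f₉.a _ (by decide), a₈, lab₅]
  · have hpn : ∀ A, A ≠ .labels → A ≠ .points → σ₈.a A = σ.a A := by
      intro A h1 h2
      rw [a₈, a₅ A h1, f₃.a A (by simp [storePoint, amods, h2]), a₂]
    rw [aτ, exec_countFlip E σ₈ y0₈ y1₈ y2₈ y3₈, flip₈, hpn _ (by decide) (by decide),
      hpn _ (by decide) (by decide)]
    simp only [observed, toReal, Fin.val_inj]
  · have : τ.asked = σ₉.asked := rfl
    rw [this, f₉.asked rfl, ask₈, blockLen]
    omega
  · have h1 : σ₉.v .p = σ.v .p := by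
      rw [f₉.v _ (by decide), v₈ _ (by decide) (by decide) (by decide), f₆.v _ (by decide), p₅]
    have h2 : σ₉.v .dim = n := by
      rw [f₉.v _ (by decide), v₈ _ (by decide) (by decide) (by decide), f₆.v _ (by decide),
        v₅ _ (by decide), v₃ _ (by decide), hdim]
    rw [hτ]
    simp [h1, h2]

/-- The effect of the sampling phase: the sample points and labels are stored, and the counters
hold the sums of the observed window statistics. -/
theorem exec_sample [NeZero n] (E : Env n) {f : Cube n → ℤˣ} {w : WalkSpace n}
    (hE : ∀ t, E.examples t = (walk w t, f (walk w t))) (σ : Store n) {T N : ℕ}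
    (hdim : σ.v .dim = n) (hwait : σ.v .wait = T + 1) (hdim2 : σ.v .dim2 = 2 * n)
    (hN : σ.v .blocks = N) (ha : ∀ A i, σ.a A i = 0) (hask : σ.asked = 0) :
    (∀ j < N, ∀ i : Fin n, (sample.exec E σ).a .points (j * n + i)
      = signBit (walk w (j * blockLen n T + T) i)) ∧
    (∀ j < N, (sample.exec E σ).a .labels j = signBit (f (walk w (j * blockLen n T + T)))) ∧
    (∀ i : Fin n, ((sample.exec E σ).a .pos i : ℝ) - (sample.exec E σ).a .neg i
      = ∑ j ∈ Finset.range N, observed f w (j * blockLen n T + T) i) := by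
  have := exec_loop E (x := .j) (v := .blocks) (c := sampleBlock) (by decide)
    (σ := (Var.p ≔ 0).exec E σ)
    (fun m τ => τ.v .p = m * n ∧ τ.asked = m * blockLen n T ∧
      (∀ j < m, ∀ i : Fin n, τ.a .points (j * n + i)
        = signBit (walk w (j * blockLen n T + T) i)) ∧
      (∀ j < m, τ.a .labels j = signBit (f (walk w (j * blockLen n T + T)))) ∧
      (∀ i : Fin n, (τ.a .pos i : ℝ) - τ.a .neg i
        = ∑ j ∈ Finset.range m, observed f w (j * blockLen n T + T) i))
    (by simp [ha, hask]) (by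
      rintro m - τ hm hf ⟨hp, hq, h₁, h₂, h₃⟩
      have hv : ∀ x, x ∉ (loop .j .blocks sampleBlock).mods → x ≠ .p → τ.v x = σ.v x := by
        intro x hx hxp
        rw [hf.v x hx]
        simp [hxp]
      obtain ⟨g₁, g₂, g₃, g₄, g₅, g₆⟩ := exec_sampleBlock E hE τ (T := T)
        ((hv _ (by decide) (by decide)).trans hdim)
        ((hv _ (by decide) (by decide)).trans hwait)
        ((hv _ (by decide) (by decide)).trans hdim2)
      simp only [Store.set_v, Store.set_a, Store.set_asked, reduceCtorEq, if_false]
      rw [hp] at g₁ g₂ g₆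
      rw [hq] at g₁ g₃ g₄ g₅
      rw [hm] at g₃
      refine ⟨by rw [g₆]; ring, by rw [g₅]; ring, fun j hj i => ?_, fun j hj => ?_,
        fun i => ?_⟩
      · rcases Nat.lt_succ_iff_lt_or_eq.1 hj with h | rfl
        · rw [g₂ _ (by nlinarith [i.2]), h₁ j h i]
        · exact g₁ i
      · rw [g₃]
        rcases Nat.lt_succ_iff_lt_or_eq.1 hj with h | rfl
        · rw [if_neg h.ne, h₂ j h]
        · rw [if_pos rfl]
      · rw [g₄, h₃, Finset.sum_range_succ])
  have hb : ((Var.p ≔ 0).exec E σ).v .blocks = N := by simp [hN]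
  rw [hb] at this
  exact this.2.2

/-! ### Selecting candidate variables -/

/-- The selection rule for candidate variables, in terms of the two counters of a variable. -/
def Selected (n k t : ℕ) (pos neg : ℕ → ℕ) (i : ℕ) : Prop :=
  i = 0 ∨ n ≤ 4 * k ∨ neg i + 2 * t ≤ pos i

open scoped Classical in
/-- The list is never empty, because variable `0` comes first, and never too long; and it contains
all selected variables unless there are too many of them. -/
theorem exec_select [NeZero n] (E : Env n) (σ : Store n) {k t q : ℕ} (hdim : σ.v .dim = n)
    (har : σ.v .arity4 = 4 * k) (hcap : σ.v .cap = q) (hthr : σ.v .thr = t) (hq : 1 ≤ q) :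
    let τ := select.exec E σ
    let S := Selected n k t (σ.a .pos) (σ.a .neg)
    τ.v .r ≤ q ∧ 1 ≤ τ.v .r ∧ (∀ l < τ.v .r, τ.a .cand l < n) ∧
      (((Finset.range n).filter S).card ≤ q → ∀ i < n, S i → ∃ l < τ.v .r, τ.a .cand l = i) := by
  intro τ S
  have := exec_loop E (x := .i) (v := .dim)
    (c := branch ((1 - .var .i) + (.var .arity4 + 1 - .var .dim)
        + (.entry .pos (.var .i) + 1 - (.entry .neg (.var .i) + .var .thr + .var .thr)))
      (branch (.var .cap - .var .r) (put .cand (.var .r) (.var .i) ;; .r ≔ .var .r + 1) skip) skip)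
    (by decide) (σ := (Var.r ≔ 0).exec E σ)
    (fun m τ => τ.v .r ≤ q ∧ (0 < m → 1 ≤ τ.v .r) ∧ (∀ l < τ.v .r, τ.a .cand l < m) ∧
      τ.v .r ≤ ((Finset.range m).filter S).card ∧
      (((Finset.range m).filter S).card ≤ q → ∀ i < m, S i → ∃ l < τ.v .r, τ.a .cand l = i))
    (by simp) (by
      rintro m hmn τ hm hf ⟨h₁, h₂, h₃, h₄, h₅⟩
      have hv : ∀ x, x ∉ [Var.i, .r] → τ.v x = σ.v x := by
        intro x hx
        simp only [List.mem_cons, List.not_mem_nil, or_false, not_or] at hx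
        rw [hf.v x (by simp [mods, hx])]
        simp [hx]
      have hpos : τ.a .pos = σ.a .pos := hf.a _ (by decide)
      have hneg : τ.a .neg = σ.a .neg := hf.a _ (by decide)
      have hS : (1 - m) + (4 * k + 1 - n) + (σ.a .pos m + 1 - (σ.a .neg m + t + t)) ≠ 0 ↔ S m := by
        simp only [S, Selected]
        omega
      simp only [exec_branch, Expr.eval_add, Expr.eval_sub, Expr.eval_one, Expr.eval_var,
        Expr.eval_entry, hm, hpos, hneg, hv .arity4 (by decide), hv .dim (by decide),
        hv .thr (by decide), hv .cap (by decide), har, hdim, hthr, hcap, hS]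
      have hcard : ((Finset.range (m + 1)).filter S).card
          = ((Finset.range m).filter S).card + if S m then 1 else 0 := by
        rw [Finset.range_add_one, Finset.filter_insert]
        split_ifs with h
        · rw [Finset.card_insert_of_notMem (by simp)]
        · rfl
      rw [hcard]
      by_cases hSm : S m
      · simp only [if_pos hSm]
        by_cases hr : q - τ.v .r ≠ 0
        · rw [if_pos hr]
          simp only [exec_seq, exec_put, exec_assign, Expr.eval_var, Expr.eval_add, Expr.eval_one,
            Store.put_v, Store.set_v, Store.set_a, Store.put_a, hm, reduceCtorEq, if_false,
            if_true, true_and]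
          refine ⟨by omega, fun _ => by omega, fun l hl => ?_, by omega, fun hc i hi hSi => ?_⟩
          · split_ifs with h
            · omega
            · have := h₃ l (by omega)
              omega
          · rcases Nat.lt_succ_iff_lt_or_eq.1 hi with h | rfl
            · obtain ⟨l, hl, e⟩ := h₅ (by omega) i h hSi
              exact ⟨l, by omega, by rw [if_neg (by omega), e]⟩
            · exact ⟨τ.v .r, by omega, by simp⟩
        · rw [if_neg hr]
          simp only [exec_skip, Store.set_v, Store.set_a, reduceCtorEq, if_false]
          refine ⟨h₁, fun _ => by omega, fun l hl => ?_, by omega, fun hc => by omega⟩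
          have := h₃ l hl
          omega
      · simp only [if_neg hSm, exec_skip, Store.set_v, Store.set_a, reduceCtorEq, if_false]
        have hm0 : 0 < m := Nat.pos_of_ne_zero fun h => hSm (.inl h)
        refine ⟨h₁, fun _ => h₂ hm0, fun l hl => ?_, by omega, fun hc i hi hSi => ?_⟩
        · have := h₃ l hl
          omega
        · rcases Nat.lt_succ_iff_lt_or_eq.1 hi with h | rfl
          · exact h₅ hc i h hSi
          · exact absurd hSi hSm)
  have hb : ((Var.r ≔ 0).exec E σ).v .dim = n := by simp [hdim]
  rw [hb] at this
  exact ⟨this.1, this.2.1 (NeZero.pos n), this.2.2.1, this.2.2.2.2⟩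

theorem exec_countTuples (E : Env n) (σ : Store n) :
    (countTuples.exec E σ).v .total = σ.v .r ^ σ.v .arity := by
  have := exec_loop E (x := .i) (v := .arity)
    (c := .acc ≔ 0 ;; loop .j .r (.acc ≔ .var .acc + .var .total) ;; .total ≔ .var .acc)
    (by decide) (σ := (Var.total ≔ 1).exec E σ)
    (fun m τ => τ.v .total = σ.v .r ^ m) (by simp) (by
      intro m _ τ _ hf h
      have hr : τ.v .r = σ.v .r := by
        rw [hf.v _ (by decide)]
        simp
      simp only [exec_seq, exec_assign, Store.set_v, Expr.eval_var, reduceCtorEq, if_false,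
        if_true]
      rw [exec_accumulate E _ (by decide) (by decide) (by decide)]
      simp only [Store.set_v, Expr.eval_zero, reduceCtorEq, if_false, if_true, hr, h, zero_add]
      ring)
  have hb : ((Var.total ≔ 1).exec E σ).v .arity = σ.v .arity := by simp
  rw [hb] at this
  exact this

/-! ### Empirical risk minimization -/

theorem exec_divide (E : Env n) (σ : Store n) (hr : 1 ≤ σ.v .r) (ht : σ.v .tmp ≤ σ.v .total) :
    (divide.exec E σ).v .tmp = σ.v .tmp % σ.v .r ∧
      (divide.exec E σ).v .quo = σ.v .tmp / σ.v .r := by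
  have := exec_loop E (x := .z) (v := .total)
    (c := branch (.var .tmp + 1 - .var .r)
      (.tmp ≔ .var .tmp - .var .r ;; .quo ≔ .var .quo + 1) skip) (by decide)
    (σ := (Var.quo ≔ 0).exec E σ)
    (fun m τ => τ.v .tmp + τ.v .quo * σ.v .r = σ.v .tmp ∧ (τ.v .tmp < σ.v .r ∨ τ.v .quo = m))
    (by simp) (by
      rintro m - τ hm hf ⟨h₁, h₂⟩
      have hr' : τ.v .r = σ.v .r := by
        rw [hf.v _ (by decide)]
        simp
      simp only [exec_branch, Expr.eval_sub, Expr.eval_add, Expr.eval_var, Expr.eval_one, hr']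
      split_ifs with h
      · simp only [exec_seq, exec_assign, Store.set_v, Expr.eval_sub, Expr.eval_add,
          Expr.eval_var, Expr.eval_one, hr', reduceCtorEq, if_false, if_true]
        refine ⟨?_, .inr (by omega)⟩
        rw [add_mul, ← h₁]
        omega
      · simp only [exec_skip, Store.set_v, reduceCtorEq, if_false]
        exact ⟨h₁, .inl (by omega)⟩)
  have hb : ((Var.quo ≔ 0).exec E σ).v .total = σ.v .total := by simp
  rw [hb] at this
  change (divide.exec E σ).v .tmp + (divide.exec E σ).v .quo * σ.v .r = σ.v .tmp ∧
    ((divide.exec E σ).v .tmp < σ.v .r ∨ (divide.exec E σ).v .quo = σ.v .total) at this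
  set a := (divide.exec E σ).v .tmp
  set b := (divide.exec E σ).v .quo
  obtain ⟨h₁, h₂⟩ := this
  have hlt : a < σ.v .r := by
    rcases h₂ with h | h
    · exact h
    · by_contra hc
      have : b * 1 ≤ b * σ.v .r := Nat.mul_le_mul_left _ hr
      omega
  rw [← h₁]
  constructor
  · rw [Nat.add_mul_mod_self_right, Nat.mod_eq_of_lt hlt]
  · rw [Nat.add_mul_div_right _ _ (by omega), Nat.div_eq_of_lt hlt, Nat.zero_add]

/-- What the last phases of the program work on: `N` samples and `r` candidate variables. -/
structure Loaded (k N r : ℕ) (X : ℕ → Cube n) (Y : ℕ → ℤˣ) (R : ℕ → Fin n) (σ : Store n) :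
    Prop where
  dim : σ.v .dim = n
  arity : σ.v .arity = k
  blocks : σ.v .blocks = N
  tableSize : σ.v .tableSize = 2 ^ k
  candCount : σ.v .r = r
  total : σ.v .total = r ^ k
  points : ∀ j < N, ∀ i : Fin n, σ.a .points (j * n + i) = signBit (X j i)
  labels : ∀ j < N, σ.a .labels j = signBit (Y j)
  cand : ∀ l < r, σ.a .cand l = R l

theorem Loaded.of_frame {k N r : ℕ} {X : ℕ → Cube n} {Y : ℕ → ℤˣ} {R : ℕ → Fin n}
    {σ τ : Store n} (h : Loaded k N r X Y R σ) {c : Cmd} (hf : Frame c σ τ)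
    (hv : ∀ x ∈ [Var.dim, .arity, .blocks, .tableSize, .r, .total], x ∉ c.mods)
    (ha : ∀ A ∈ [Arr.points, .labels, .cand], A ∉ c.amods) : Loaded k N r X Y R τ where
  dim := (hf.v _ (hv _ (by simp))).trans h.dim
  arity := (hf.v _ (hv _ (by simp))).trans h.arity
  blocks := (hf.v _ (hv _ (by simp))).trans h.blocks
  tableSize := (hf.v _ (hv _ (by simp))).trans h.tableSize
  candCount := (hf.v _ (hv _ (by simp))).trans h.candCount
  total := (hf.v _ (hv _ (by simp))).trans h.total
  points := fun j hj i => by rw [hf.a _ (ha _ (by simp)), h.points j hj i]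
  labels := fun j hj => by rw [hf.a _ (ha _ (by simp)), h.labels j hj]
  cand := fun l hl => by rw [hf.a _ (ha _ (by simp)), h.cand l hl]

/-- The tuple of candidate variables with number `c`, read off from the digits of `c` in base
`r`. -/
def tuple (k r : ℕ) (R : ℕ → Fin n) (c : ℕ) : List (Fin n) :=
  (List.range k).map fun l => R (c / r ^ l % r)

theorem length_tuple (k r : ℕ) (R : ℕ → Fin n) (c : ℕ) : (tuple k r R c).length = k := by
  simp [tuple]

theorem tableIndex_lt (x : Cube n) (J : List (Fin n)) : tableIndex x J < 2 ^ J.length := by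
  induction J with
  | nil => simp [tableIndex]
  | cons i J ih =>
    have := signBit_le_one (x i)
    rw [tableIndex, List.length_cons, pow_succ]
    omega

section erm

variable {k N r : ℕ} {X : ℕ → Cube n} {Y : ℕ → ℤˣ} {R : ℕ → Fin n}

/-- One step of the decoding of a tuple number. -/
theorem exec_divide_tuple (E : Env n) {τ : Store n} (h : Loaded k N r X Y R τ) (hr : 1 ≤ r)
    {c l : ℕ} (hc : c < r ^ k) (ht : τ.v .tmp = c / r ^ l) :
    (divide.exec E τ).v .tmp = c / r ^ l % r ∧ (divide.exec E τ).v .quo = c / r ^ (l + 1) ∧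
      (divide.exec E τ).a .cand ((divide.exec E τ).v .tmp) = R (c / r ^ l % r) := by
  obtain ⟨h₁, h₂⟩ := exec_divide E τ (by rw [h.candCount]; exact hr) (by
    rw [ht, h.total]
    exact (Nat.div_le_self _ _).trans hc.le)
  rw [ht, h.candCount] at h₁ h₂
  refine ⟨h₁, by rw [h₂, Nat.div_div_eq_div_mul, pow_succ], ?_⟩
  rw [h₁, (exec_frame E divide τ).a _ (by decide), h.cand _ (Nat.mod_lt _ hr)]

/-- The table index is assembled bit by bit while the tuple number is divided by `r`. -/
theorem exec_locate (E : Env n) {σ : Store n} (h : Loaded k N r X Y R σ) (hr : 1 ≤ r)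
    {c j : ℕ} (hc : c < r ^ k) (hcc : σ.v .cc = c) (hj : j < N) (hp : σ.v .p = j * n) :
    (locate.exec E σ).v .idx = tableIndex (X j) (tuple k r R c) := by
  set J := tuple k r R c with hJ
  set σ' := (Var.idx ≔ 0).exec E ((Var.pw ≔ 1).exec E ((Var.tmp ≔ .var .cc).exec E σ)) with hσ'
  have := exec_loop E (x := .l) (v := .arity)
    (c := divide ;; branch (.entry .points (.var .p + .entry .cand (.var .tmp)))
      (.idx ≔ .var .idx + .var .pw) skip ;; .tmp ≔ .var .quo ;; .pw ≔ .var .pw + .var .pw)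
    (by decide) (σ := σ')
    (fun m τ => τ.v .tmp = c / r ^ m ∧
      τ.v .idx + τ.v .pw * tableIndex (X j) (J.drop m) = tableIndex (X j) J)
    (by simp [hσ', hcc]) (by
      rintro m hm τ - hf ⟨h₁, h₂⟩
      have hmk : m < k := by
        have : σ'.v .arity = k := by simp [hσ', h.arity]
        omega
      have hL : Loaded k N r X Y R σ' := by
        refine h.of_frame (c := .tmp ≔ .var .cc ;; .pw ≔ 1 ;; .idx ≔ 0) (exec_frame E _ _)
          (by decide) (by decide)
      have hLτ : Loaded k N r X Y R τ := hL.of_frame hf (by decide) (by decide)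
      obtain ⟨g₁, g₂, g₃⟩ := exec_divide_tuple E hLτ hr hc h₁
      have hF := exec_frame E divide τ
      obtain ⟨υ, hυ⟩ : ∃ υ, υ = divide.exec E τ := ⟨_, rfl⟩
      rw [← hυ] at g₁ g₂ g₃ hF
      have pυ : υ.v .p = j * n := by
        rw [hF.v _ (by decide), hf.v _ (by decide)]
        simp [hσ', hp]
      have pt : Expr.eval υ (.entry .points (.var .p + .entry .cand (.var .tmp)))
          = signBit (X j (R (c / r ^ m % r))) := by
        change υ.a .points (υ.v .p + υ.a .cand (υ.v .tmp)) = _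
        rw [pυ, g₃, hF.a _ (by decide)]
        exact hLτ.points j hj _
      have hdrop : J.drop m = R (c / r ^ m % r) :: J.drop (m + 1) := by
        rw [List.drop_eq_getElem_cons (by rw [hJ, length_tuple]; exact hmk)]
        congr 1
        simp [hJ, tuple]
      rw [hdrop, tableIndex] at h₂
      have hidx : υ.v .idx = τ.v .idx := hF.v _ (by decide)
      have hpw : υ.v .pw = τ.v .pw := hF.v _ (by decide)
      simp only [exec_seq, exec_branch, ← hυ]
      rw [← h₂]
      rcases Int.units_eq_one_or (X j (R (c / r ^ m % r))) with hs | hs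
      · rw [if_neg (by rw [pt, hs]; decide), hs]
        simp [g₂, hidx, hpw, signBit, show (1 : ℤˣ) ≠ -1 by decide]
        ring
      · rw [if_pos (by rw [pt, hs]; decide), hs]
        simp [g₂, hidx, hpw, signBit]
        ring)
  have hb : σ'.v .arity = k := by simp [hσ', h.arity]
  rw [hb] at this
  have h2 := this.2
  rw [List.drop_of_length_le (by rw [hJ, length_tuple])] at h2
  simp only [tableIndex, Nat.mul_zero, Nat.add_zero] at h2
  exact h2

/-- The number of samples with label `s` at position `m` of the truth table over `J`. -/
def hits (N : ℕ) (X : ℕ → Cube n) (Y : ℕ → ℤˣ) (J : List (Fin n)) (s : ℤˣ) (m : ℕ) : ℕ :=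
  ((Finset.range N).filter fun j => tableIndex (X j) J = m ∧ Y j = s).card

theorem hits_succ (N : ℕ) (X : ℕ → Cube n) (Y : ℕ → ℤˣ) (J : List (Fin n)) (s : ℤˣ) (m : ℕ) :
    hits (N + 1) X Y J s m
      = hits N X Y J s m + if tableIndex (X N) J = m ∧ Y N = s then 1 else 0 := by
  rw [hits, Finset.range_add_one, Finset.filter_insert]
  split_ifs
  · rw [Finset.card_insert_of_notMem (by simp)]
    rfl
  · rfl

theorem exec_tally (E : Env n) {σ : Store n} (h : Loaded k N r X Y R σ) (hr : 1 ≤ r)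
    {c : ℕ} (hc : c < r ^ k) (hcc : σ.v .cc = c) (m : ℕ) (hm : m < 2 ^ k) :
    (tally.exec E σ).a .zeros m = hits N X Y (tuple k r R c) 1 m ∧
      (tally.exec E σ).a .ones m = hits N X Y (tuple k r R c) (-1) m := by
  set J := tuple k r R c with hJ
  set σ₁ := (loop .i .tableSize (put .zeros (.var .i) 0 ;; put .ones (.var .i) 0)).exec E σ
    with hσ₁
  have f₁ : Frame (loop .i .tableSize (put .zeros (.var .i) 0 ;; put .ones (.var .i) 0)) σ σ₁ :=
    exec_frame E _ _
  have clear : ∀ m < 2 ^ k, σ₁.a .zeros m = 0 ∧ σ₁.a .ones m = 0 := by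
    have := exec_loop E (x := .i) (v := .tableSize)
      (c := put .zeros (.var .i) 0 ;; put .ones (.var .i) 0) (by decide) (σ := σ)
      (fun i τ => ∀ m < i, τ.a .zeros m = 0 ∧ τ.a .ones m = 0) (by simp) (by
        intro i _ τ hi _ h m hm
        simp only [exec_seq, exec_put, Store.set_a, Store.put_a, Expr.eval_zero, Expr.eval_var,
          Store.put_v, hi, reduceCtorEq, false_and, if_false, true_and]
        by_cases hmi : m = i
        · simp [hmi]
        · simp [hmi, h m (by omega)])
    rwa [h.tableSize] at this
  set σ₂ := (Var.p ≔ 0).exec E σ₁ with hσ₂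
  have hL₁ : Loaded k N r X Y R σ₁ := h.of_frame f₁ (by decide) (by decide)
  have hL₂ : Loaded k N r X Y R σ₂ :=
    hL₁.of_frame (exec_frame E (Var.p ≔ 0) _) (by decide) (by decide)
  have hcc₂ : σ₂.v .cc = c := by
    rw [hσ₂, (exec_frame E (Var.p ≔ 0) _).v _ (by decide), f₁.v _ (by decide), hcc]
  have := exec_loop E (x := .j) (v := .blocks)
    (c := locate ;; branch (.entry .labels (.var .j))
      (put .ones (.var .idx) (.entry .ones (.var .idx) + 1))
      (put .zeros (.var .idx) (.entry .zeros (.var .idx) + 1)) ;; .p ≔ .var .p + .var .dim)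
    (by decide) (σ := σ₂)
    (fun i τ => τ.v .p = i * n ∧ ∀ m < 2 ^ k, τ.a .zeros m = hits i X Y J 1 m ∧
      τ.a .ones m = hits i X Y J (-1) m)
    (by simpa [hσ₂, hits] using clear) (by
      rintro i hi τ hij hf ⟨hp, hh⟩
      have hiN : i < N := hL₂.blocks ▸ hi
      have hLτ : Loaded k N r X Y R τ := hL₂.of_frame hf (by decide) (by decide)
      have hloc := exec_locate E hLτ hr hc ((hf.v _ (by decide)).trans hcc₂) hiN hp
      have hF := exec_frame E locate τ
      obtain ⟨υ, hυ⟩ : ∃ υ, υ = locate.exec E τ := ⟨_, rfl⟩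
      rw [← hυ] at hloc hF
      have jυ : υ.v .j = i := (hF.v _ (by decide)).trans hij
      have lab : Expr.eval υ (.entry .labels (.var .j)) = signBit (Y i) := by
        change υ.a .labels (υ.v .j) = _
        rw [jυ, hF.a _ (by decide)]
        exact hLτ.labels i hiN
      have pυ : υ.v .p = i * n := (hF.v _ (by decide)).trans hp
      have dυ : υ.v .dim = n := (hF.v _ (by decide)).trans hLτ.dim
      have zυ : υ.a .zeros = τ.a .zeros := hF.a _ (by decide)
      have oυ : υ.a .ones = τ.a .ones := hF.a _ (by decide)
      simp only [exec_seq, exec_branch, hits_succ, ← hυ]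
      rw [← hJ] at hloc
      rcases Int.units_eq_one_or (Y i) with hs | hs
      · rw [if_neg (by rw [lab, hs]; decide), hs]
        refine ⟨by simp [pυ, dυ]; ring, fun m hm => ?_⟩
        obtain ⟨hz, ho⟩ := hh m hm
        by_cases he : m = tableIndex (X i) J
        · subst he
          simp [hloc, zυ, oυ, hz, ho, show (1 : ℤˣ) ≠ -1 by decide]
        · simp [hloc, zυ, oυ, hz, ho, he, Ne.symm he]
      · rw [if_pos (by rw [lab, hs]; decide), hs]
        refine ⟨by simp [pυ, dυ]; ring, fun m hm => ?_⟩
        obtain ⟨hz, ho⟩ := hh m hm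
        by_cases he : m = tableIndex (X i) J
        · subst he
          simp [hloc, zυ, oυ, hz, ho, show (-1 : ℤˣ) ≠ 1 by decide]
        · simp [hloc, zυ, oυ, hz, ho, he, Ne.symm he])
  rw [hL₂.blocks] at this
  exact this.2 m hm

/-- The number of samples on which `h` errs. -/
def empErr (N : ℕ) (X : ℕ → Cube n) (Y : ℕ → ℤˣ) (h : Cube n → ℤˣ) : ℕ :=
  ((Finset.range N).filter fun j => h (X j) ≠ Y j).card

/-- The number of samples on which the best function with a truth table over `J` errs. -/
def bestErr (k N : ℕ) (X : ℕ → Cube n) (Y : ℕ → ℤˣ) (J : List (Fin n)) : ℕ :=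
  ∑ m ∈ Finset.range (2 ^ k), min (hits N X Y J 1 m) (hits N X Y J (-1) m)

theorem empErr_le (N : ℕ) (X : ℕ → Cube n) (Y : ℕ → ℤˣ) (h : Cube n → ℤˣ) :
    empErr N X Y h ≤ N :=
  (Finset.card_filter_le _ _).trans_eq (Finset.card_range N)

theorem empErr_eq_sum_hits (N : ℕ) (X : ℕ → Cube n) (Y : ℕ → ℤˣ) {J : List (Fin n)}
    (hJ : J.length = k) (T : ℕ → ℤˣ) :
    empErr N X Y (fun x => T (tableIndex x J))
      = ∑ m ∈ Finset.range (2 ^ k), hits N X Y J (-T m) m := by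
  rw [empErr, Finset.card_eq_sum_card_fiberwise (f := fun j => tableIndex (X j) J)
    (t := Finset.range (2 ^ k))]
  · refine Finset.sum_congr rfl fun m _ => ?_
    rw [hits, Finset.filter_filter]
    congr 1
    ext j
    simp only [Finset.mem_filter]
    have hu : ∀ a b : ℤˣ, a ≠ b ↔ b = -a := by decide
    constructor
    · rintro ⟨h1, h2, rfl⟩
      exact ⟨h1, rfl, (hu _ _).1 h2⟩
    · rintro ⟨h1, rfl, h2⟩
      exact ⟨h1, (hu _ _).2 h2, rfl⟩
  · intro j _
    have := tableIndex_lt (X j) J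
    rw [hJ] at this
    simpa using this

theorem bestErr_le_empErr (N : ℕ) (X : ℕ → Cube n) (Y : ℕ → ℤˣ) {J : List (Fin n)}
    (hJ : J.length = k) (T : ℕ → ℤˣ) :
    bestErr k N X Y J ≤ empErr N X Y fun x => T (tableIndex x J) := by
  rw [empErr_eq_sum_hits N X Y hJ]
  refine Finset.sum_le_sum fun m _ => ?_
  rcases Int.units_eq_one_or (T m) with h | h <;> simp [h]

/-- The truth table that is best for the samples. -/
def majority (N : ℕ) (X : ℕ → Cube n) (Y : ℕ → ℤˣ) (J : List (Fin n)) (m : ℕ) : ℤˣ :=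
  if hits N X Y J 1 m < hits N X Y J (-1) m then -1 else 1

theorem bestErr_eq_empErr (N : ℕ) (X : ℕ → Cube n) (Y : ℕ → ℤˣ) {J : List (Fin n)}
    (hJ : J.length = k) :
    bestErr k N X Y J = empErr N X Y fun x => majority N X Y J (tableIndex x J) := by
  rw [empErr_eq_sum_hits N X Y hJ]
  refine Finset.sum_congr rfl fun m _ => ?_
  unfold majority
  split_ifs with h
  · simp [h.le]
  · simpa using h

theorem exec_addUp (E : Env n) (σ : Store n) (hts : σ.v .tableSize = 2 ^ k) :
    (addUp.exec E σ).v .score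
      = ∑ m ∈ Finset.range (2 ^ k), min (σ.a .zeros m) (σ.a .ones m) := by
  have := exec_loop E (x := .i) (v := .tableSize)
    (c := .score ≔ .var .score + (.entry .zeros (.var .i)
      - (.entry .zeros (.var .i) - .entry .ones (.var .i)))) (by decide)
    (σ := (Var.score ≔ 0).exec E σ)
    (fun m τ => τ.v .score = ∑ m ∈ Finset.range m, min (σ.a .zeros m) (σ.a .ones m))
    (by simp) (by
      intro m _ τ hm hf h
      have hz : τ.a .zeros = σ.a .zeros := hf.a _ (by decide)
      have ho : τ.a .ones = σ.a .ones := hf.a _ (by decide)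
      simp only [exec_assign, Store.set_v, Expr.eval_add, Expr.eval_sub, Expr.eval_entry,
        Expr.eval_var, hm, h, hz, ho, Finset.sum_range_succ, reduceCtorEq, if_false, if_true]
      omega)
  have hb : ((Var.score ≔ 0).exec E σ).v .tableSize = 2 ^ k := by simp [hts]
  rw [hb] at this
  exact this

/-- The search finds a tuple of minimal empirical error. The initial value `blocks + 1` of `best`
exceeds all errors, so it is replaced in the first round. -/
theorem exec_search (E : Env n) {σ : Store n} (h : Loaded k N r X Y R σ) (hr : 1 ≤ r) :
    (search.exec E σ).v .bestc < r ^ k ∧ ∀ c < r ^ k,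
      bestErr k N X Y (tuple k r R ((search.exec E σ).v .bestc))
        ≤ bestErr k N X Y (tuple k r R c) := by
  have hpos : 0 < r ^ k := Nat.pow_pos hr
  set σ' := (Var.best ≔ .var .blocks + 1 ;; .bestc ≔ 0).exec E σ with hσ'
  have hL' : Loaded k N r X Y R σ' := h.of_frame (exec_frame E _ _) (by decide) (by decide)
  have := exec_loop E (x := .c) (v := .total)
    (c := .cc ≔ .var .c ;; tally ;; addUp ;; branch (.var .best - .var .score)
      (.best ≔ .var .score ;; .bestc ≔ .var .cc) skip) (by decide) (σ := σ')
    (fun m τ => τ.v .bestc < r ^ k ∧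
      (∀ c < m, τ.v .best ≤ bestErr k N X Y (tuple k r R c)) ∧
      (τ.v .best = N + 1 ∨ τ.v .best = bestErr k N X Y (tuple k r R (τ.v .bestc))))
    (by simp [hσ', h.blocks, hpos]) (by
      rintro m hm τ hc hf ⟨h₁, h₂, h₃⟩
      have hmr : m < r ^ k := hL'.total ▸ hm
      have hLτ : Loaded k N r X Y R τ := hL'.of_frame hf (by decide) (by decide)
      obtain ⟨τ₁, hτ₁⟩ : ∃ τ₁, τ₁ = (Var.cc ≔ .var .c).exec E τ := ⟨_, rfl⟩
      have hL₁ : Loaded k N r X Y R τ₁ := by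
        rw [hτ₁]
        exact hLτ.of_frame (exec_frame E _ _) (by decide) (by decide)
      have cc₁ : τ₁.v .cc = m := by simp [hτ₁, hc]
      have htally := exec_tally E hL₁ hr hmr cc₁
      have f₂ := exec_frame E tally τ₁
      have hL₂ : Loaded k N r X Y R (tally.exec E τ₁) :=
        hL₁.of_frame f₂ (by decide) (by decide)
      have hadd := exec_addUp E _ hL₂.tableSize
      have f₃ := exec_frame E addUp (tally.exec E τ₁)
      obtain ⟨τ₃, hτ₃⟩ : ∃ τ₃, τ₃ = addUp.exec E (tally.exec E τ₁) := ⟨_, rfl⟩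
      rw [← hτ₃] at hadd f₃
      have score₃ : τ₃.v .score = bestErr k N X Y (tuple k r R m) := by
        rw [hadd, bestErr]
        refine Finset.sum_congr rfl fun i hi => ?_
        obtain ⟨e₁, e₂⟩ := htally i (Finset.mem_range.1 hi)
        rw [e₁, e₂]
      have best₃ : τ₃.v .best = τ.v .best := by
        rw [f₃.v _ (by decide), f₂.v _ (by decide)]
        simp [hτ₁]
      have bestc₃ : τ₃.v .bestc = τ.v .bestc := by
        rw [f₃.v _ (by decide), f₂.v _ (by decide)]
        simp [hτ₁]
      have cc₃ : τ₃.v .cc = m := by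
        rw [f₃.v _ (by decide), f₂.v _ (by decide), cc₁]
      simp only [exec_seq, ← hτ₁, ← hτ₃, exec_branch]
      by_cases hlt : τ₃.v .best - τ₃.v .score ≠ 0
      · rw [if_pos (show Expr.eval τ₃ (.var .best - .var .score) ≠ 0 from hlt)]
        simp only [exec_assign, Store.set_v, Expr.eval_var, reduceCtorEq, if_false, if_true, cc₃,
          score₃]
        refine ⟨hmr, fun c hcm => ?_, .inr trivial⟩
        rcases Nat.lt_succ_iff_lt_or_eq.1 hcm with h' | rfl
        · have := h₂ c h'
          omega
        · exact le_rfl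
      · rw [if_neg (show ¬ Expr.eval τ₃ (.var .best - .var .score) ≠ 0 from hlt)]
        simp only [exec_skip, Store.set_v, reduceCtorEq, if_false, best₃, bestc₃]
        refine ⟨h₁, fun c hcm => ?_, h₃⟩
        rcases Nat.lt_succ_iff_lt_or_eq.1 hcm with h' | rfl
        · exact h₂ c h'
        · omega)
  rw [hL'.total] at this
  obtain ⟨h₁, h₂, h₃⟩ := this
  refine ⟨h₁, fun c hc => ?_⟩
  rcases h₃ with h₃ | h₃
  · exfalso
    have e := bestErr_le_empErr N X Y (length_tuple k r R 0) fun _ => 1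
    have e' := h₂ 0 hpos
    have e'' := empErr_le N X Y fun _ => (1 : ℤˣ)
    rw [h₃] at e'
    exact absurd (e'.trans (e.trans e'')) (by omega)
  · have := h₂ c hc
    rw [h₃] at this
    exact this

theorem exec_answer (E : Env n) {σ : Store n} (h : Loaded k N r X Y R σ) (hr : 1 ≤ r)
    {c : ℕ} (hc : c < r ^ k) (hbc : σ.v .bestc = c) :
    (answer.exec E σ).out = σ.out ++ (k :: ((tuple k r R c).map (fun i : Fin n => (i : ℕ)) ++
      (List.range (2 ^ k)).map fun m => signBit (majority N X Y (tuple k r R c) m))) := by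
  set J := tuple k r R c with hJ
  obtain ⟨σ₁, hσ₁⟩ : ∃ τ, τ = (Var.cc ≔ .var .bestc).exec E σ := ⟨_, rfl⟩
  have hL₁ : Loaded k N r X Y R σ₁ := by
    rw [hσ₁]
    exact h.of_frame (exec_frame E _ _) (by decide) (by decide)
  have cc₁ : σ₁.v .cc = c := by simp [hσ₁, hbc]
  have htally := exec_tally E hL₁ hr hc cc₁
  have f₂ := exec_frame E tally σ₁
  have hL₂ : Loaded k N r X Y R (tally.exec E σ₁) := hL₁.of_frame f₂ (by decide) (by decide)
  obtain ⟨σ₂, hσ₂⟩ : ∃ τ, τ = tally.exec E σ₁ := ⟨_, rfl⟩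
  rw [← hσ₂] at htally f₂ hL₂
  have out₂ : σ₂.out = σ.out := by
    rw [f₂.out rfl, hσ₁]
    rfl
  obtain ⟨σ₃, hσ₃⟩ : ∃ τ, τ = (emit (.var .arity) ;; Var.tmp ≔ .var .cc).exec E σ₂ := ⟨_, rfl⟩
  have f₃ : Frame (emit (.var .arity) ;; Var.tmp ≔ .var .cc) σ₂ σ₃ := by
    rw [hσ₃]
    exact exec_frame E _ _
  have hL₃ : Loaded k N r X Y R σ₃ := hL₂.of_frame f₃ (by decide) (by decide)
  have out₃ : σ₃.out = σ.out ++ [k] := by simp [hσ₃, out₂, hL₂.arity]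
  have tmp₃ : σ₃.v .tmp = c := by
    have : σ₂.v .cc = c := (f₂.v _ (by decide)).trans cc₁
    simp [hσ₃, this]
  obtain ⟨σ₄, hσ₄⟩ : ∃ τ, τ = (loop .l .arity (divide ;; emit (.entry .cand (.var .tmp)) ;;
    Var.tmp ≔ .var .quo)).exec E σ₃ := ⟨_, rfl⟩
  have f₄ : Frame (loop .l .arity (divide ;; emit (.entry .cand (.var .tmp)) ;;
      Var.tmp ≔ .var .quo)) σ₃ σ₄ := by
    rw [hσ₄]
    exact exec_frame E _ _
  have out₄ : σ₄.out = σ.out ++ [k] ++ J.map (fun i : Fin n => (i : ℕ)) := by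
    have := exec_loop E (x := .l) (v := .arity)
      (c := divide ;; emit (.entry .cand (.var .tmp)) ;; .tmp ≔ .var .quo) (by decide) (σ := σ₃)
      (fun m τ => τ.v .tmp = c / r ^ m ∧ τ.out = σ.out ++ [k] ++
        (List.range m).map fun l => ((R (c / r ^ l % r) : Fin n) : ℕ))
      (by simp [tmp₃, out₃]) (by
        rintro m - τ - hf ⟨h₁, h₂⟩
        have hLτ : Loaded k N r X Y R τ := hL₃.of_frame hf (by decide) (by decide)
        obtain ⟨g₁, g₂, g₃⟩ := exec_divide_tuple E hLτ hr hc h₁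
        have hF := exec_frame E divide τ
        obtain ⟨υ, hυ⟩ : ∃ υ, υ = divide.exec E τ := ⟨_, rfl⟩
        rw [← hυ] at g₁ g₂ g₃ hF
        simp only [exec_seq, ← hυ]
        refine ⟨by simp [g₂], ?_⟩
        simp [g₃, hF.out rfl, h₂, List.range_succ])
    rw [hL₃.arity, ← hσ₄] at this
    rw [this.2, hJ, tuple, List.map_map]
    rfl
  have hz : σ₄.a .zeros = σ₂.a .zeros := (f₄.a _ (by decide)).trans (f₃.a _ (by decide))
  have ho : σ₄.a .ones = σ₂.a .ones := (f₄.a _ (by decide)).trans (f₃.a _ (by decide))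
  have hts : σ₄.v .tableSize = 2 ^ k := (f₄.v _ (by decide)).trans hL₃.tableSize
  have hans : answer.exec E σ = (loop .i .tableSize (emit (1 - (1 -
      (.entry .ones (.var .i) - .entry .zeros (.var .i)))))).exec E σ₄ := by
    rw [hσ₄, hσ₃, hσ₂, hσ₁]
    rfl
  have := exec_loop E (x := .i) (v := .tableSize)
    (c := emit (1 - (1 - (.entry .ones (.var .i) - .entry .zeros (.var .i))))) (by decide)
    (σ := σ₄)
    (fun m τ => m ≤ 2 ^ k → τ.out = σ.out ++ [k] ++ J.map (fun i : Fin n => (i : ℕ)) ++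
      (List.range m).map fun m => signBit (majority N X Y J m))
    (by simp [out₄]) (by
      intro m _ τ hm hf h' hmk
      obtain ⟨e₁, e₂⟩ := htally m (by omega)
      have hz' : τ.a .zeros = σ₄.a .zeros := hf.a _ (by decide)
      have ho' : τ.a .ones = σ₄.a .ones := hf.a _ (by decide)
      have e : 1 - (1 - (σ₂.a .ones m - σ₂.a .zeros m)) = signBit (majority N X Y J m) := by
        rw [e₁, e₂, ← hJ, majority]
        split_ifs with hlt
        · simp only [signBit, if_true]
          omega
        · simp only [signBit, show (1 : ℤˣ) ≠ -1 by decide, if_false]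
          omega
      simp only [exec_emit, Store.set_out, Expr.eval_sub, Expr.eval_one, Expr.eval_entry,
        Expr.eval_var, hm, hz', ho', hz, ho, e, h' (by omega), List.range_succ, List.map_append,
        List.map_cons, List.map_nil, List.append_assoc])
  rw [hts] at this
  rw [hans, this le_rfl]
  simp

end erm

/-! ### Running all phases -/

/-- Before each of the given commands, its loop bounds are at most `H`. -/
def Bounded (E : Env n) (H : ℕ) : List Cmd → Store n → Prop
  | [], _ => True
  | c :: cs, σ => (∀ v ∈ c.bounds, σ.v v ≤ H) ∧ Bounded E H cs (c.exec E σ)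

/-- The compiled sequence of the given commands. -/
def compileAll (cs : List Cmd) : Prog := cs.foldr (fun c p => .seq c.compile p) .skip

theorem runs_compileAll (E : Env n) (H : ℕ) (cs : List Cmd) (hc : ∀ c ∈ cs, c.Safe)
    {σ : Store n} {s : State n} (h : Rep σ s) (hb : Bounded E H cs σ) :
    ∃ t s', Runs E (compileAll cs) s t s' ∧ t ≤ (cs.map (cost H)).sum + 1 ∧
      Rep (cs.foldl (fun σ c => c.exec E σ) σ) s' := by
  induction cs generalizing σ s with
  | nil => exact ⟨1, s, .skip s, le_rfl, h⟩
  | cons c cs ih =>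
    obtain ⟨t₁, s₁, r₁, l₁, h₁⟩ := c.runs_compile E H (hc c (by simp)) h hb.1
    obtain ⟨t₂, s₂, r₂, l₂, h₂⟩ := ih (fun c' h' => hc c' (by simp [h'])) h₁ hb.2
    refine ⟨_, s₂, .seq r₁ r₂, ?_, h₂⟩
    rw [List.map_cons, List.sum_cons]
    omega

/-- A bound for all loops of the program. -/
def loopBound (n k e d : ℕ) : ℕ := 2 * blocksOf n k e d * capOf k e ^ k

theorem one_le_capOf (k e : ℕ) : 1 ≤ capOf k e := Nat.one_le_two_pow

theorem le_precOf [NeZero n] (k e : ℕ) : n ≤ precOf n k e :=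
  Nat.le_mul_of_pos_right _ (one_le_capOf k e)

theorem capOf_le_precOf [NeZero n] (k e : ℕ) : capOf k e ≤ precOf n k e :=
  Nat.le_mul_of_pos_left _ (NeZero.pos n)

theorem one_le_precOf [NeZero n] (k e : ℕ) : 1 ≤ precOf n k e :=
  (one_le_capOf k e).trans (capOf_le_precOf k e)

theorem blocksOf_eq (n k e d : ℕ) : blocksOf n k e d = precOf n k e ^ 3 * (d + 1) := by
  rw [blocksOf, thrOf]
  ring

/-- The time at which the sample of block number `j` is taken. -/
def sampleTime (n k e j : ℕ) : ℕ := j * blockLen n (delayOf n k e) + delayOf n k e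

/-- Variable `i` is a candidate: it has number `0`, or there are at most `4 * k` variables, or its
estimate is large. -/
def Candidate (k e d : ℕ) (f : Cube n → ℤˣ) (w : WalkSpace n) (i : Fin n) : Prop :=
  (i : ℕ) = 0 ∨ n ≤ 4 * k ∨
    2 * (thrOf n k e d : ℝ) ≤
      ∑ j ∈ Finset.range (blocksOf n k e d), observed f w (sampleTime n k e j) i

open scoped Classical in
/-- What the program finds: the candidate variables `R l` for `l < r`, and the number `c` of a tuple
of minimal empirical error. -/
structure Outcome (k e d : ℕ) (f : Cube n → ℤˣ) (w : WalkSpace n) (r : ℕ) (R : ℕ → Fin n)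
    (c : ℕ) : Prop where
  r_pos : 1 ≤ r
  covers : (Finset.univ.filter (Candidate k e d f w)).card ≤ capOf k e →
    ∀ i, Candidate k e d f w i → ∃ l < r, R l = i
  minimal : ∀ c' < r ^ k, bestErr k (blocksOf n k e d) (fun j => walk w (sampleTime n k e j))
      (fun j => f (walk w (sampleTime n k e j))) (tuple k r R c)
    ≤ bestErr k (blocksOf n k e d) (fun j => walk w (sampleTime n k e j))
      (fun j => f (walk w (sampleTime n k e j))) (tuple k r R c')

/-- The run of all phases: the loops stay within `loopBound`, and the output is the code of the best
hypothesis. -/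
theorem exec_phases [NeZero n] (E : Env n) {f : Cube n → ℤˣ} {w : WalkSpace n}
    (hE : ∀ t, E.examples t = (walk w t, f (walk w t))) {k e d : ℕ} (hk : 1 ≤ k) {σ : Store n}
    (h : Initial k e d σ) :
    Bounded E (loopBound n k e d) phases σ ∧ ∃ r R c, Outcome k e d f w r R c ∧
      (phases.foldl (fun σ c => c.exec E σ) σ).out
        = k :: ((tuple k r R c).map (fun i : Fin n => (i : ℕ)) ++
          (List.range (2 ^ k)).map fun m => signBit (majority (blocksOf n k e d)
            (fun j => walk w (sampleTime n k e j)) (fun j => f (walk w (sampleTime n k e j)))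
            (tuple k r R c) m)) := by
  classical
  set N := blocksOf n k e d with hN
  set X : ℕ → Cube n := fun j => walk w (sampleTime n k e j) with hX
  set Y : ℕ → ℤˣ := fun j => f (walk w (sampleTime n k e j)) with hY
  have hprep := exec_prepare E h
  obtain ⟨reps₁, arity₁, cap₂, prec₃, sq₄, prec₅, P₆, a₆, ask₆, out₆⟩ := hprep
  set σ₁ := setSimple.exec E σ
  set σ₂ := setPowers.exec E σ₁
  set σ₃ := setPrec.exec E σ₂
  set σ₄ := setWait.exec E σ₃
  set σ₅ := setThr.exec E σ₄
  obtain ⟨σ₆, hσ₆⟩ : ∃ τ, τ = setBlocks.exec E σ₅ := ⟨_, rfl⟩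
  rw [← hσ₆] at P₆ a₆ ask₆ out₆
  obtain ⟨σ₇, hσ₇⟩ : ∃ τ, τ = sample.exec E σ₆ := ⟨_, rfl⟩
  obtain ⟨σ₈, hσ₈⟩ : ∃ τ, τ = select.exec E σ₇ := ⟨_, rfl⟩
  obtain ⟨σ₉, hσ₉⟩ : ∃ τ, τ = countTuples.exec E σ₈ := ⟨_, rfl⟩
  obtain ⟨τ, hτ⟩ : ∃ τ, τ = search.exec E σ₉ := ⟨_, rfl⟩
  have f₇ : Frame sample σ₆ σ₇ := hσ₇ ▸ exec_frame E _ _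
  have f₈ : Frame select σ₇ σ₈ := hσ₈ ▸ exec_frame E _ _
  have f₉ : Frame countTuples σ₈ σ₉ := hσ₉ ▸ exec_frame E _ _
  have fτ : Frame search σ₉ τ := hτ ▸ exec_frame E _ _
  obtain ⟨pts, lab, cnt⟩ := exec_sample E hE σ₆ P₆.dim P₆.wait P₆.dim2 P₆.blocks a₆ ask₆
  rw [← hσ₇] at pts lab cnt
  obtain ⟨r_le, r_pos, cand_lt, cov⟩ := exec_select E σ₇ ((f₇.v _ (by decide)).trans P₆.dim)
    ((f₇.v _ (by decide)).trans P₆.arity4) ((f₇.v _ (by decide)).trans P₆.cap)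
    ((f₇.v _ (by decide)).trans P₆.thr) (one_le_capOf k e)
  rw [← hσ₈] at r_le r_pos cand_lt cov
  have tot := exec_countTuples E σ₈
  rw [← hσ₉] at tot
  set r := σ₈.v .r
  set R : ℕ → Fin n := fun l =>
    if hl : σ₈.a .cand l < n then ⟨σ₈.a .cand l, hl⟩ else ⟨0, NeZero.pos n⟩ with hR
  have hRl : ∀ l < r, (R l : ℕ) = σ₈.a .cand l := fun l hl => by simp [hR, cand_lt l hl]
  have ar₈ : σ₈.v .arity = k :=
    (f₈.v _ (by decide)).trans ((f₇.v _ (by decide)).trans P₆.arity)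
  have hL : Loaded k N r X Y R σ₉ :=
    { dim := (f₉.v _ (by decide)).trans ((f₈.v _ (by decide)).trans
        ((f₇.v _ (by decide)).trans P₆.dim))
      arity := (f₉.v _ (by decide)).trans ar₈
      blocks := (f₉.v _ (by decide)).trans ((f₈.v _ (by decide)).trans
        ((f₇.v _ (by decide)).trans P₆.blocks))
      tableSize := (f₉.v _ (by decide)).trans ((f₈.v _ (by decide)).trans
        ((f₇.v _ (by decide)).trans P₆.tableSize))
      candCount := f₉.v _ (by decide)
      total := by rw [tot, ar₈]
      points := fun j hj i => by
        rw [f₉.a _ (by decide), f₈.a _ (by decide)]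
        exact pts j hj i
      labels := fun j hj => by
        rw [f₉.a _ (by decide), f₈.a _ (by decide)]
        exact lab j hj
      cand := fun l hl => by rw [f₉.a _ (by decide), hRl l hl] }
  obtain ⟨c_lt, minimal⟩ := exec_search E hL r_pos
  rw [← hτ] at c_lt minimal
  have hLτ : Loaded k N r X Y R τ := hL.of_frame fτ (by decide) (by decide)
  have hans := exec_answer E hLτ r_pos c_lt rfl
  have out_τ : τ.out = [] := by
    rw [fτ.out rfl, f₉.out rfl, f₈.out rfl, f₇.out rfl, out₆]
  rw [out_τ, List.nil_append] at hans
  refine ⟨?_, r, R, τ.v .bestc, ⟨r_pos, ?_, minimal⟩, ?_⟩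
  · have hB := one_le_precOf (n := n) k e
    have hn := le_precOf (n := n) k e
    have hQB := capOf_le_precOf (n := n) k e
    have hQ := one_le_capOf k e
    have hQk : capOf k e ≤ capOf k e ^ k := Nat.le_self_pow (by omega) _
    have hexp : 20 * k + 2 * e ≤ capOf k e := Nat.lt_two_pow_self.le
    have hpk : 2 ^ k ≤ capOf k e := Nat.pow_le_pow_right (by omega) (by omega)
    have hrk : r ^ k ≤ capOf k e ^ k := Nat.pow_le_pow_left r_le k
    have hBlk : precOf n k e ^ 3 ≤ N := by
      rw [hN, blocksOf_eq]
      exact Nat.le_mul_of_pos_right _ (by omega)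
    have hB2 : precOf n k e ^ 2 ≤ N := (Nat.pow_le_pow_right hB (by omega)).trans hBlk
    have hB1 : precOf n k e ≤ N := (Nat.le_self_pow (by omega) _).trans hBlk
    have hwait : delayOf n k e + 1 ≤ 2 * N := by
      have : n * precOf n k e ≤ precOf n k e ^ 2 := by
        rw [sq]
        exact Nat.mul_le_mul_right _ hn
      unfold delayOf
      omega
    have hH : 2 * N ≤ loopBound n k e d :=
      Nat.le_mul_of_pos_right _ (by omega)
    have hH' : capOf k e ^ k ≤ loopBound n k e d :=
      Nat.le_mul_of_pos_left _ (by omega)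
    have late : ∀ {υ : Store n}, υ.v .dim = n → υ.v .arity = k → υ.v .blocks = N →
        υ.v .wait = delayOf n k e + 1 → υ.v .dim2 = 2 * n → υ.v .tableSize = 2 ^ k →
        ∀ v ∈ [Var.dim, .arity, .blocks, .wait, .dim2, .tableSize],
          υ.v v ≤ loopBound n k e d := by
      intro υ h₁ h₂ h₃ h₄ h₅ h₆ v hv
      simp only [List.mem_cons, List.not_mem_nil, or_false] at hv
      rcases hv with rfl | rfl | rfl | rfl | rfl | rfl <;> omega
    have late₆ := late P₆.dim P₆.arity P₆.blocks P₆.wait P₆.dim2 P₆.tableSize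
    have late₉ : ∀ v ∈ [Var.dim, .arity, .blocks, .wait, .dim2, .tableSize],
          σ₉.v v ≤ loopBound n k e d :=
      late hL.dim hL.arity hL.blocks ((f₉.v _ (by decide)).trans ((f₈.v _ (by decide)).trans
        ((f₇.v _ (by decide)).trans P₆.wait))) ((f₉.v _ (by decide)).trans
        ((f₈.v _ (by decide)).trans ((f₇.v _ (by decide)).trans P₆.dim2))) hL.tableSize
    have tot₉ : σ₉.v .total ≤ loopBound n k e d := by rw [hL.total]; omega
    simp only [phases, Bounded, and_true]
    refine ⟨fun v hv => ?_, fun v hv => ?_, fun v hv => ?_, fun v hv => ?_, fun v hv => ?_,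
      fun v hv => ?_, fun v hv => ?_, fun v hv => ?_, fun v hv => ?_, fun v hv => ?_,
      fun v hv => ?_⟩
    · simp [setSimple, bounds] at hv
    · simp only [setPowers, bounds, List.mem_append, List.mem_cons, List.not_mem_nil,
        or_false] at hv
      rcases hv with rfl | rfl
      · exact reps₁.trans_le (by omega)
      · exact arity₁.trans_le (by omega)
    · simp only [setPrec, bounds, List.mem_append, List.mem_cons, List.not_mem_nil,
        or_false, false_or] at hv
      subst hv
      exact cap₂.trans_le (by omega)
    · simp only [setWait, bounds, List.mem_append, List.mem_cons, List.not_mem_nil,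
        or_false, false_or, or_self] at hv
      subst hv
      exact prec₃.trans_le (by omega)
    · simp only [setThr, bounds, List.mem_append, List.mem_cons, List.not_mem_nil,
        or_false, false_or] at hv
      subst hv
      exact sq₄.trans_le (by omega)
    · simp only [setBlocks, bounds, List.mem_append, List.mem_cons, List.not_mem_nil,
        or_false, false_or] at hv
      subst hv
      exact prec₅.trans_le (by omega)
    · rw [← hσ₆]
      exact late₆ v (by revert v; decide)
    · rw [← hσ₆, ← hσ₇]
      have : v = .dim := by revert v; decide
      rw [this, f₇.v _ (by decide)]
      exact late₆ _ (by simp)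
    · rw [← hσ₆, ← hσ₇, ← hσ₈]
      have : v = .arity ∨ v = .r := by revert v; decide
      rcases this with rfl | rfl
      · rw [ar₈]; omega
      · exact r_le.trans (by omega)
    · rw [← hσ₆, ← hσ₇, ← hσ₈, ← hσ₉]
      have : v = .total ∨ v ∈ [Var.dim, .arity, .blocks, .wait, .dim2, .tableSize] := by
        revert v; decide
      rcases this with rfl | h'
      · exact tot₉
      · exact late₉ v h'
    · rw [← hσ₆, ← hσ₇, ← hσ₈, ← hσ₉, ← hτ]
      have : v = .total ∨ v ∈ [Var.dim, .arity, .blocks, .wait, .dim2, .tableSize] := by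
        revert v; decide
      rcases this with rfl | h'
      · rw [fτ.v _ (by decide)]
        exact tot₉
      · rw [fτ.v v (by revert v; decide)]
        exact late₉ v h'
  · have hS : ∀ i : Fin n, Selected n k (thrOf n k e d) (σ₇.a .pos) (σ₇.a .neg) i
        ↔ Candidate k e d f w i := by
      intro i
      have : σ₇.a .neg i + 2 * thrOf n k e d ≤ σ₇.a .pos i ↔ 2 * (thrOf n k e d : ℝ)
          ≤ ∑ j ∈ Finset.range N, observed f w (sampleTime n k e j) i := by
        rw [show ∑ j ∈ Finset.range N, observed f w (sampleTime n k e j) i = _ from (cnt i).symm,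
          ← Nat.cast_le (α := ℝ)]
        push_cast
        constructor <;> intro <;> linarith
      simp only [Selected, Candidate, this]
      rfl
    intro hcard i hi
    obtain ⟨l, hl, e'⟩ := cov (by
      refine le_trans (le_of_eq ?_) hcard
      rw [← Finset.card_map Fin.valEmbedding]
      congr 1
      ext m
      simp only [Finset.mem_filter, Finset.mem_range, Finset.mem_map, Finset.mem_univ, true_and,
        Fin.valEmbedding_apply]
      constructor
      · rintro ⟨hm, hs⟩
        exact ⟨⟨m, hm⟩, (hS ⟨m, hm⟩).1 hs, rfl⟩
      · rintro ⟨i, hi, rfl⟩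
        exact ⟨i.2, (hS i).2 hi⟩) i i.2 ((hS i).2 hi)
    exact ⟨l, hl, Fin.ext ((hRl l hl).trans e')⟩
  · simp only [phases, List.foldl_cons, List.foldl_nil]
    change (answer.exec E (search.exec E (countTuples.exec E (select.exec E (sample.exec E
      (setBlocks.exec E σ₅)))))).out = _
    rw [← hσ₆, ← hσ₇, ← hσ₈, ← hσ₉, ← hτ]
    exact hans

/-! ### Reading the parameters -/

/-- The number of the first nonzero binary digit of `min r 1`, for `r > 0`. Thus
`2 ^ (-firstDigit r)` is `min r 1` rounded down to a power of two. -/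
noncomputable def firstDigit (r : ℝ) : ℕ := sInf {m : ℕ | 1 ≤ min r 1 * 2 ^ m}

theorem one_le_mul_two_pow_firstDigit {r : ℝ} (hr : 0 < r) : 1 ≤ min r 1 * 2 ^ firstDigit r := by
  have h0 : 0 < min r 1 := lt_min hr one_pos
  have : {m : ℕ | 1 ≤ min r 1 * 2 ^ m}.Nonempty := by
    obtain ⟨m, hm⟩ := pow_unbounded_of_one_lt (1 / min r 1) (one_lt_two (α := ℝ))
    refine ⟨m, ?_⟩
    rw [div_lt_iff₀ h0] at hm
    exact (mul_comm (min r 1) _ ▸ hm).le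
  exact Nat.sInf_mem this

theorem mul_two_pow_lt_one {r : ℝ} {i : ℕ} (hi : i < firstDigit r) : min r 1 * 2 ^ i < 1 :=
  not_le.1 (Nat.notMem_of_lt_sInf hi)

theorem mul_two_pow_firstDigit_lt_two (r : ℝ) : min r 1 * 2 ^ firstDigit r < 2 := by
  rcases h : firstDigit r with _ | m
  · have := min_le_right r 1
    norm_num
  · have := mul_two_pow_lt_one (r := r) (i := m) (by omega)
    rw [pow_succ]
    linarith

theorem binDigit_firstDigit {r : ℝ} (hr : 0 < r) : binDigit r (firstDigit r) = 1 := by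
  have : ⌊min r 1 * 2 ^ firstDigit r⌋₊ = 1 := by
    rw [Nat.floor_eq_iff (by linarith [one_le_mul_two_pow_firstDigit hr])]
    have := mul_two_pow_firstDigit_lt_two r
    exact ⟨by simpa using one_le_mul_two_pow_firstDigit hr, by norm_num; linarith⟩
  rw [binDigit, this]

theorem binDigit_eq_zero {r : ℝ} {i : ℕ} (hi : i < firstDigit r) : binDigit r i = 0 := by
  rw [binDigit, Nat.floor_eq_zero.2 (mul_two_pow_lt_one hi)]

/-- Read digits up to the first nonzero one, and count the zeros in the variable `x`. -/
def readLength (digit : ℕ → Prog) (x : Var) : Prog :=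
  .seq (digit (scratch 0)) <| .seq (.sub (scratch 0) (scratch 1) (scratch 0)) <|
    .loop (scratch 0) <| .seq (.add x.cell x.cell (scratch 1)) <|
      .seq (digit (scratch 0)) (.sub (scratch 0) (scratch 1) (scratch 0))

/-- The instruction `digit` reads the next of the digits `b`, the counter being `rd`. The quantity
`g`, the counter of the other parameter, is not affected. -/
theorem runs_readLength (E : Env n) {digit : ℕ → Prog} {b : ℕ → ℕ} {rd g : State n → ℕ}
    {adv : State n → State n}
    (hrun : ∀ s c, Runs E (digit c) s 1 (adv (s.write c (b (rd s)))))
    (hrd : ∀ s, rd (adv s) = rd s + 1) (hrw : ∀ s c v, rd (s.write c v) = rd s)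
    (hg : ∀ s, g (adv s) = g s) (hgw : ∀ s c v, g (s.write c v) = g s)
    (hmem : ∀ s, (adv s).mem = s.mem)
    (hrep : ∀ σ s, Rep σ s → Rep σ (adv s)) {m : ℕ} (hm : b m = 1) (h0 : ∀ i < m, b i = 0)
    (x : Var) {σ : Store n} {s : State n} (h : Rep σ s) (hx : σ.v x = 0)
    (h1 : s.mem (scratch 1) = 1) (hr : rd s = 0) :
    ∃ s', Runs E (readLength digit x) s (4 * m + 3) s' ∧ Rep (σ.set x m) s' ∧
      s'.mem (scratch 1) = 1 ∧ g s' = g s := by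
  have hxs : ∀ d, x.cell ≠ scratch d := fun d => by unfold Var.cell scratch; omega
  have hs01 : scratch 1 ≠ scratch 0 := by decide
  have set_set : ∀ (τ : Store n) (u v : ℕ), (τ.set x u).set x v = τ.set x v := fun τ u v => by
    simp [Store.set]
  have key : ∀ u j : ℕ, ∀ s : State n, j + u = m → Rep (σ.set x j) s → rd s = j + 1 →
      s.mem (scratch 1) = 1 → s.mem (scratch 0) = 1 - b j →
      ∃ s', Runs E (.loop (scratch 0) <| .seq (.add x.cell x.cell (scratch 1)) <|
        .seq (digit (scratch 0)) (.sub (scratch 0) (scratch 1) (scratch 0))) s (4 * u + 1) s' ∧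
        Rep (σ.set x m) s' ∧ s'.mem (scratch 1) = 1 ∧ g s' = g s := by
    intro u
    induction u with
    | zero =>
      rintro j s rfl h - h1 h2
      simp only [Nat.add_zero] at hm
      exact ⟨s, Runs.loop_stop (by rw [h2, hm]), h, h1, rfl⟩
    | succ u ih =>
      intro j s hj h hrj h1 h2
      rw [h0 j (by omega)] at h2
      have hR := hrep _ _ ((h.write_var x (j + 1)).write_scratch 0 (b (j + 1)))
      rw [set_set] at hR
      obtain ⟨s', r', h₁, h₂, h₃⟩ := ih (j + 1) _ (by omega) (hR.write_scratch 0 (1 - b (j + 1)))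
        (by rw [hrw, hrd, hrw, hrw, hrj])
        (by rw [State.write_mem, if_neg hs01, hmem, State.write_mem, if_neg hs01,
          State.write_mem, if_neg (hxs 1).symm, h1])
        (by rw [State.write_mem, if_pos rfl])
      refine ⟨s', ?_, h₁, h₂, by rw [h₃, hgw, hg, hgw, hgw]⟩
      have e : 4 * (u + 1) + 1 = (1 + (1 + 1)) + (4 * u + 1) + 1 := by ring
      rw [e]
      refine Runs.loop_step (by omega) (.seq (.add _ _ _ _) (.seq (hrun _ _) (.sub _ _ _ _))) ?_
      simp only [hrw, hrj, hmem, State.write_mem, hs01, (hxs 1).symm, if_false, if_true, h1,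
        h.v, Store.set_v]
      exact r'
  have hR := hrep _ _ (h.write_scratch 0 (b 0))
  have hσ : σ.set x 0 = σ := by
    simp [Store.set, ← hx]
  obtain ⟨s', r', h₁, h₂, h₃⟩ := key m 0 _ (by omega)
    (hσ.symm ▸ hR.write_scratch 0 (1 - b 0)) (by rw [hrw, hrd, hrw, hr])
    (by rw [State.write_mem, if_neg hs01, hmem, State.write_mem, if_neg hs01, h1])
    (by rw [State.write_mem, if_pos rfl])
  refine ⟨s', ?_, h₁, h₂, by rw [h₃, hgw, hg, hgw]⟩
  have e : 4 * m + 3 = 1 + (1 + (4 * m + 1)) := by ring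
  rw [e]
  refine Runs.seq (hrun _ _) (.seq (.sub _ _ _ _) ?_)
  simp only [hr, hmem, State.write_mem, hs01, if_false, if_true, h1]
  exact r'

/-- The learning program: move the arity to its cell, read the parameters, and run the phases. -/
def learner : Prog :=
  .seq (.add Var.arity.cell 1 (scratch 0)) <| .seq (.const (scratch 1) 1) <|
    .seq (readLength .epsDigit .epsLen) <| .seq (readLength .deltaDigit .deltaLen) <|
      compileAll phases

/-- The hypothesis that the program puts out if it finds the tuple number `c`. -/
def hypothesis (k e d : ℕ) (f : Cube n → ℤˣ) (w : WalkSpace n) (r : ℕ) (R : ℕ → Fin n) (c : ℕ)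
    (x : Cube n) : ℤˣ :=
  majority (blocksOf n k e d) (fun j => walk w (sampleTime n k e j))
    (fun j => f (walk w (sampleTime n k e j))) (tuple k r R c) (tableIndex x (tuple k r R c))

theorem isJunta_hypothesis (k e d : ℕ) (f : Cube n → ℤˣ) (w : WalkSpace n) (r : ℕ)
    (R : ℕ → Fin n) (c : ℕ) : IsJunta k (hypothesis k e d f w r R c) := by
  refine isJunta_of_congr (tuple k r R c).toFinset
    ((List.toFinset_card_le _).trans_eq (length_tuple k r R c)) fun x y hxy => ?_
  have : ∀ J : List (Fin n), (∀ i ∈ J, x i = y i) → tableIndex x J = tableIndex y J := by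
    intro J hJ
    induction J with
    | nil => rfl
    | cons i J ih =>
      rw [tableIndex, tableIndex, hJ i (by simp), ih fun i hi => hJ i (by simp [hi])]
  rw [hypothesis, hypothesis, this _ fun i hi => hxy i (by simpa using hi)]

theorem runs_learner [NeZero n] {k : ℕ} (hk : 1 ≤ k) {ε δ : ℝ} (hε : 0 < ε) (hδ : 0 < δ)
    (f : Cube n → ℤˣ) (w : WalkSpace n) :
    ∃ t l r R c, HaltsWith learner k ε δ f w t l ∧
      t ≤ (phases.map (cost (loopBound n k (firstDigit ε) (firstDigit δ)))).sum
        + 4 * (firstDigit ε + firstDigit δ) + 9 ∧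
      Outcome k (firstDigit ε) (firstDigit δ) f w r R c ∧
      IsJuntaCode k l (hypothesis k (firstDigit ε) (firstDigit δ) f w r R c) := by
  set e := firstDigit ε
  set d := firstDigit δ
  set E := learnEnv ε δ f w
  set σ₀ : Store n :=
    { v := fun x => if x = .dim then n else if x = .arity then k else 0
      a := fun _ _ => 0
      asked := 0
      current := none
      out := [] } with hσ₀
  have h₀ : Rep σ₀ ((initState n k).write Var.arity.cell
      ((initState n k).mem 1 + (initState n k).mem (scratch 0))) := by
    have hk' : (initState n k).mem 1 + (initState n k).mem (scratch 0) = k := rfl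
    rw [hk']
    refine ⟨fun x => ?_, fun A i => ?_, rfl, rfl, rfl⟩
    · have hd : x.cell = 0 ↔ x = .dim := by
        rw [← Var.code_inj]
        change 4 * x.code = 0 ↔ x.code = 0
        omega
      have ha : x.cell = Var.arity.cell ↔ x = .arity := by
        rw [← Var.code_inj]
        change 4 * x.code = 4 * 1 ↔ x.code = 1
        omega
      have h1 : x.cell ≠ 1 := by unfold Var.cell; omega
      simp only [State.write_mem, initState, hσ₀, ha, hd, h1, if_false]
      by_cases hx : x = .arity
      · simp [hx]
      · simp [hx]
    · have h4 : A.cell i ≠ Var.arity.cell := by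
        change _ ≠ 4
        unfold Arr.cell
        omega
      have h0 : A.cell i ≠ 0 := by unfold Arr.cell; omega
      have h1 : A.cell i ≠ 1 := by unfold Arr.cell; omega
      simp [State.write_mem, initState, hσ₀, h4, h0, h1]
  obtain ⟨s₁, r₁, h₁, one₁, g₁⟩ := runs_readLength E (digit := .epsDigit) (b := binDigit ε)
    (rd := State.epsRead) (g := State.deltaRead)
    (adv := fun s => { s with epsRead := s.epsRead + 1 }) (fun s c => .epsDigit s c)
    (fun _ => rfl) (fun _ _ _ => rfl) (fun _ => rfl) (fun _ _ _ => rfl) (fun _ => rfl)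
    (fun _ _ h => ⟨h.v, h.a, h.asked, h.current, h.out⟩) (binDigit_firstDigit hε)
    (fun i hi => binDigit_eq_zero hi) .epsLen (h₀.write_scratch 1 1) (by simp [hσ₀])
    (by simp [State.write_mem]) rfl
  obtain ⟨s₂, r₂, h₂, one₂, -⟩ := runs_readLength E (digit := .deltaDigit) (b := binDigit δ)
    (rd := State.deltaRead) (g := State.epsRead)
    (adv := fun s => { s with deltaRead := s.deltaRead + 1 }) (fun s c => .deltaDigit s c)
    (fun _ => rfl) (fun _ _ _ => rfl) (fun _ => rfl) (fun _ _ _ => rfl) (fun _ => rfl)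
    (fun _ _ h => ⟨h.v, h.a, h.asked, h.current, h.out⟩) (binDigit_firstDigit hδ)
    (fun i hi => binDigit_eq_zero hi) .deltaLen h₁ (by simp [hσ₀]) one₁ (g₁.trans rfl)
  have hI : Initial k e d ((σ₀.set .epsLen e).set .deltaLen d) := by
    constructor <;> simp [hσ₀]
  obtain ⟨hb, r, R, c, hout, hl⟩ := exec_phases E (f := f) (w := w) (fun _ => rfl) hk hI
  obtain ⟨t, s₃, r₃, ht, h₃⟩ := runs_compileAll E _ phases phases_safe h₂ hb
  refine ⟨_, _, r, R, c, ⟨s₃, .seq (.add _ _ _ _) (.seq (.const _ _ _) (.seq r₁ (.seq r₂ r₃))),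
    rfl⟩, by omega, hout, ?_⟩
  have hlen := length_tuple k r R c
  refine ⟨tuple k r R c, (List.range (2 ^ k)).map fun m => signBit (majority (blocksOf n k e d)
      (fun j => walk w (sampleTime n k e j)) (fun j => f (walk w (sampleTime n k e j)))
      (tuple k r R c) m), hlen.le, by simp [hlen], ?_, fun x => ?_⟩
  · rw [h₃.out, hl, hlen]
    simp [List.map_eq_flatMap]
  · rw [List.getElem?_map,
      List.getElem?_range ((tableIndex_lt x (tuple k r R c)).trans_eq (by rw [hlen]))]
    rfl

/-! ### The running time -/

theorem exists_sum_cost_le (cs : List Cmd) :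
    ∃ C D : ℕ, ∀ H, (cs.map (cost H)).sum ≤ C * (H + 1) ^ D := by
  induction cs with
  | nil => exact ⟨0, 0, fun H => by simp⟩
  | cons c cs ih =>
    obtain ⟨C₁, D₁, h₁⟩ := exists_cost_le c
    obtain ⟨C₂, D₂, h₂⟩ := ih
    refine ⟨C₁ + C₂, D₁ + D₂, fun H => ?_⟩
    rw [List.map_cons, List.sum_cons, add_mul]
    refine add_le_add ((h₁ H).trans ?_) ((h₂ H).trans ?_) <;> gcongr <;> omega

/-- For `δ > 1` the logarithm is negative, so that a linear bound in `log (1 / δ)` would fail. -/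
theorem firstDigit_le {δ : ℝ} (hδ : 0 < δ) :
    (firstDigit δ : ℝ) ≤ 2 + Real.log (1 / δ) ^ 2 := by
  set d := firstDigit δ
  set L := Real.log (1 / δ) with hL
  have h0 : 0 < min δ 1 := lt_min hδ one_pos
  have h : min δ 1 * 2 ^ d < 2 := mul_two_pow_firstDigit_lt_two δ
  have h' := Real.log_lt_log (by positivity) h
  rw [Real.log_mul h0.ne' (by positivity), Real.log_pow] at h'
  have hmin : -Real.log (min δ 1) ≤ |L| := by
    rw [hL, one_div, Real.log_inv, abs_neg]
    rcases le_total δ 1 with h1 | h1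
    · rw [min_eq_left h1]
      exact neg_le_abs _
    · rw [min_eq_right h1]
      simp
  have hd : (0 : ℝ) ≤ d := Nat.cast_nonneg d
  have hlog := Real.log_two_gt_d9
  have hsq : |L| ^ 2 = L ^ 2 := sq_abs L
  nlinarith [sq_nonneg (|L| - 1), abs_nonneg L]

/-- The number of `k`-tuples of candidate variables is polynomial in `2 ^ (k ^ 2)` and
`(1 / ε) ^ k`. -/
theorem capOf_pow_le {k : ℕ} {ε : ℝ} (hε : 0 < ε) :
    ((capOf k (firstDigit ε) : ℝ)) ^ k ≤ ((2 : ℝ) ^ (k ^ 2)) ^ 22 * (1 + (1 / ε) ^ k) ^ 2 := by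
  set e := firstDigit ε
  have h0 : 0 < min ε 1 := lt_min hε one_pos
  have h : min ε 1 * 2 ^ e < 2 := mul_two_pow_firstDigit_lt_two ε
  have h1 : (2 : ℝ) ^ e ≤ 2 * (1 / min ε 1) := by
    rw [mul_one_div, le_div_iff₀ h0]
    linarith
  have h2 : (1 / min ε 1) ^ k ≤ 1 + (1 / ε) ^ k := by
    rcases le_total ε 1 with h1 | h1
    · rw [min_eq_left h1]
      linarith
    · rw [min_eq_right h1]
      have : (0 : ℝ) ≤ (1 / ε) ^ k := by positivity
      simpa using this
  have h3 : ((2 : ℝ) ^ e) ^ k ≤ 2 ^ (k ^ 2) * (1 + (1 / ε) ^ k) := by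
    calc ((2 : ℝ) ^ e) ^ k ≤ (2 * (1 / min ε 1)) ^ k := by gcongr
      _ = 2 ^ k * (1 / min ε 1) ^ k := mul_pow _ _ _
      _ ≤ _ := by
        gcongr
        · norm_num
        · exact Nat.le_self_pow two_ne_zero k
  calc ((capOf k e : ℝ)) ^ k = ((2 : ℝ) ^ (k ^ 2)) ^ 20 * (((2 : ℝ) ^ e) ^ k) ^ 2 := by
        rw [capOf]
        push_cast
        ring
    _ ≤ ((2 : ℝ) ^ (k ^ 2)) ^ 20 * (2 ^ (k ^ 2) * (1 + (1 / ε) ^ k)) ^ 2 := by gcongr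
    _ = _ := by ring

theorem loopBound_le [NeZero n] {k : ℕ} (hk : 1 ≤ k) {ε δ : ℝ} (hε : 0 < ε) (hδ : 0 < δ) :
    (loopBound n k (firstDigit ε) (firstDigit δ) : ℝ)
      ≤ 2 * (n : ℝ) ^ 3 * (((2 : ℝ) ^ (k ^ 2)) ^ 22 * (1 + (1 / ε) ^ k) ^ 2) ^ 4
        * (3 + Real.log (1 / δ) ^ 2) := by
  set e := firstDigit ε
  set d := firstDigit δ
  have hQ : (1 : ℝ) ≤ capOf k e := by exact_mod_cast one_le_capOf k e
  calc (loopBound n k e d : ℝ) = 2 * (n : ℝ) ^ 3 * (capOf k e : ℝ) ^ (k + 3) * (d + 1) := by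
        rw [loopBound, blocksOf_eq, precOf]
        push_cast
        ring
    _ ≤ 2 * (n : ℝ) ^ 3 * (capOf k e : ℝ) ^ (k * 4) * (d + 1) := by
        gcongr
        omega
    _ = 2 * (n : ℝ) ^ 3 * ((capOf k e : ℝ) ^ k) ^ 4 * (d + 1) := by rw [pow_mul]
    _ ≤ _ := by
        have hd : (d : ℝ) + 1 ≤ 3 + Real.log (1 / δ) ^ 2 := by linarith [firstDigit_le hδ]
        have hc := capOf_pow_le (k := k) hε
        gcongr

theorem exists_polynomial_le : ∃ q : MvPolynomial (Fin 4) ℕ, ∀ (n : ℕ) [NeZero n] (k : ℕ), 1 ≤ k →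
    ∀ ε δ : ℝ, 0 < ε → 0 < δ → ∀ t : ℕ,
      t ≤ (phases.map (cost (loopBound n k (firstDigit ε) (firstDigit δ)))).sum
        + 4 * (firstDigit ε + firstDigit δ) + 9 →
      (t : ℝ) ≤ MvPolynomial.aeval
        ![(n : ℝ), (2 : ℝ) ^ (k ^ 2), (1 / ε) ^ k, Real.log (1 / δ)] q := by
  obtain ⟨C, D, hCD⟩ := exists_sum_cost_le phases
  open MvPolynomial in
  refine ⟨C.cast * (2 * X 0 ^ 3 * (X 1 ^ 22 * (1 + X 2) ^ 2) ^ 4 * (3 + X 3 ^ 2) + 1) ^ D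
    + 9 * (2 * X 0 ^ 3 * (X 1 ^ 22 * (1 + X 2) ^ 2) ^ 4 * (3 + X 3 ^ 2) + 1), ?_⟩
  intro n _ k hk ε δ hε hδ t ht
  have hH := loopBound_le (n := n) hk hε hδ
  set P : ℝ := 2 * (n : ℝ) ^ 3 * (((2 : ℝ) ^ (k ^ 2)) ^ 22 * (1 + (1 / ε) ^ k) ^ 2) ^ 4
        * (3 + Real.log (1 / δ) ^ 2) with hP
  have haeval : MvPolynomial.aeval ![(n : ℝ), (2 : ℝ) ^ (k ^ 2), (1 / ε) ^ k, Real.log (1 / δ)]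
      (C.cast * (2 * MvPolynomial.X 0 ^ 3 * (MvPolynomial.X 1 ^ 22 * (1 + MvPolynomial.X 2) ^ 2) ^ 4
        * (3 + MvPolynomial.X 3 ^ 2) + 1) ^ D + 9 * (2 * MvPolynomial.X 0 ^ 3
        * (MvPolynomial.X 1 ^ 22 * (1 + MvPolynomial.X 2) ^ 2) ^ 4
        * (3 + MvPolynomial.X 3 ^ 2) + 1) : MvPolynomial (Fin 4) ℕ)
      = C * (P + 1) ^ D + 9 * (P + 1) := by
    simp [hP]
  rw [haeval]
  set H := loopBound n k (firstDigit ε) (firstDigit δ) with hHdef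
  have hed : 4 * (firstDigit ε + firstDigit δ) + 9 ≤ 9 * (H + 1) := by
    have hQ := one_le_capOf k (firstDigit ε)
    have hQk : capOf k (firstDigit ε) ≤ capOf k (firstDigit ε) ^ k := Nat.le_self_pow (by omega) _
    have h1 : 20 * k + 2 * firstDigit ε ≤ capOf k (firstDigit ε) := Nat.lt_two_pow_self.le
    have h2 : firstDigit δ + 1 ≤ blocksOf n k (firstDigit ε) (firstDigit δ) := by
      rw [blocksOf_eq]
      exact Nat.le_mul_of_pos_left _ (pow_pos (one_le_precOf k _) 3)
    have h3 : 2 * blocksOf n k (firstDigit ε) (firstDigit δ) ≤ H :=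
      Nat.le_mul_of_pos_right _ (by omega)
    have h4 : capOf k (firstDigit ε) ^ k ≤ H := Nat.le_mul_of_pos_left _ (by omega)
    omega
  have ht' : t ≤ C * (H + 1) ^ D + 9 * (H + 1) := by
    have := hCD H
    omega
  calc (t : ℝ) ≤ ((C * (H + 1) ^ D + 9 * (H + 1) : ℕ) : ℝ) := by exact_mod_cast ht'
    _ = C * ((H : ℝ) + 1) ^ D + 9 * ((H : ℝ) + 1) := by push_cast; ring
    _ ≤ _ := by gcongr

/-! ### The statistics of the program are close to their means -/

theorem walk_walk (x : Cube n) (ω : ℕ → Fin n) (s t : ℕ) :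
    walk (walk (x, ω) s, shift s ω) t = walk (x, ω) (s + t) := (walk_add x ω s t).symm

theorem shift_shift (ω : ℕ → Fin n) (s t : ℕ) : shift t (shift s ω) = shift (s + t) ω := by
  funext r
  simp only [shift, Nat.add_assoc]

theorem blockValue_delayed (L T : ℕ) (G : Cube n → (ℕ → Fin n) → ℝ) (x : Cube n)
    (ω : ℕ → Fin n) (l : ℕ) : blockValue L (delayed T G) x ω l
      = G (walk (x, ω) (l * L + T)) (shift (l * L + T) ω) := by
  rw [blockValue, delayed, walk_walk, shift_shift]

theorem dependsOn_blockValue {L N : ℕ} {Z : Cube n → (ℕ → Fin n) → ℝ}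
    (hZ : ∀ x, DependsOn L (Z x)) (x : Cube n) {l : ℕ} (hl : l < N) :
    DependsOn (N * L) fun ω => blockValue L Z x ω l := by
  have hN : l * L + L ≤ N * L := by
    rw [← Nat.succ_mul]
    exact Nat.mul_le_mul_right _ hl
  intro ω ω' h
  have hw : walk (x, ω) (l * L) = walk (x, ω') (l * L) :=
    dependsOn_walk x _ ω ω' fun t ht => h t (by omega)
  simp only [blockValue, hw]
  exact hZ _ _ _ fun t ht => h _ (by omega)

/-- The statistic that estimates the influence of variable `i`: if variable `i` is flipped in the
first step, compare the change of the label with the labels about `2 * n` steps later. -/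
noncomputable def influenceWindow (f : Cube n → ℤˣ) (i : Fin n) (y : Cube n) (ω : ℕ → Fin n) : ℝ :=
  if ω 0 = i then (toReal f (walk (y, ω) 1) - toReal f y) *
    (toReal f (walk (y, ω) (1 + 2 * n)) + toReal f (walk (y, ω) (1 + 2 * n + 1))) / 4 else 0

theorem blockValue_influenceWindow (f : Cube n → ℤˣ) (i : Fin n) (L T : ℕ) (w : WalkSpace n)
    (l : ℕ) : blockValue L (delayed T (influenceWindow f i)) w.1 w.2 l
      = observed f w (l * L + T) i := by
  obtain ⟨x, ω⟩ := w
  rw [blockValue_delayed, influenceWindow, observed]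
  simp only [walk_walk, shift, Nat.add_assoc, Nat.add_zero]

theorem abs_influenceWindow_le (f : Cube n → ℤˣ) (i : Fin n) (y : Cube n) (ω : ℕ → Fin n) :
    |influenceWindow f i y ω| ≤ 1 := by
  unfold influenceWindow
  split_ifs
  · have h := fun x => abs_toReal f x
    rw [abs_div, abs_mul, abs_of_pos (by norm_num : (0 : ℝ) < 4), div_le_one (by norm_num)]
    have h1 := (abs_sub (toReal f (walk (y, ω) 1)) (toReal f y))
    have h2 := (abs_add_le (toReal f (walk (y, ω) (1 + 2 * n)))
      (toReal f (walk (y, ω) (1 + 2 * n + 1))))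
    rw [h, h] at h1 h2
    calc _ ≤ (1 + 1 : ℝ) * (1 + 1) := by gcongr
      _ = 4 := by norm_num
  · simp

theorem dependsOn_influenceWindow (f : Cube n → ℤˣ) (i : Fin n) (y : Cube n) :
    DependsOn (2 * n + 2) (influenceWindow f i y) := by
  intro ω ω' h
  have hw : ∀ t ≤ 2 * n + 2, walk (y, ω) t = walk (y, ω') t := fun t ht =>
    dependsOn_walk y t ω ω' fun r hr => h r (by omega)
  rw [influenceWindow, influenceWindow, h 0 (by omega), hw 1 (by omega), hw _ (by omega),
    hw (1 + 2 * n + 1) (by omega)]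

/-- The factor `1 / n` is the probability that variable `i` is flipped. -/
theorem mean_pathAvg_influenceWindow [NeZero n] (f : Cube n → ℤˣ) (i : Fin n) :
    mean (fun y => pathAvg (2 * n + 2) (influenceWindow f i y))
      = walkInfluence (toReal f) i / n := by
  have step : ∀ (y : Cube n) (j : Fin n) (ω : ℕ → Fin n),
      influenceWindow f i y (consStep j ω) = (if j = i then
        (toReal f (y * flipVec i) - toReal f y) / 4 else 0) *
        (toReal f (walk (y * flipVec i, ω) (2 * n))
          + toReal f (walk (y * flipVec i, ω) (2 * n + 1))) := by
    intro y j ω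
    have h0 : consStep j ω 0 = j := rfl
    rw [influenceWindow, h0]
    split_ifs with hj
    · subst hj
      rw [show walk (y, consStep j ω) 1 = y * flipVec j from rfl,
        show 1 + 2 * n + 1 = (2 * n + 1) + 1 by ring, show 1 + 2 * n = 2 * n + 1 by ring,
        walk_consStep y j ω (2 * n), walk_consStep y j ω (2 * n + 1)]
      ring
    · simp
  have hA : ∀ z : Cube n, pathAvg (2 * n + 1) (fun ω => toReal f (walk (z, ω) (2 * n)))
      = trans^[2 * n] (toReal f) z := by
    intro z
    have hd : DependsOn (2 * n) fun ω => toReal f (walk (z, ω) (2 * n)) := fun ω ω' h => by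
      simp only [dependsOn_walk z (2 * n) ω ω' h]
    rw [hd.pathAvg_eq (Nat.le_succ _), pathAvg_walk]
  have hy : ∀ y, pathAvg (2 * n + 2) (influenceWindow f i y)
      = (1 / n : ℝ) * ((toReal f (y * flipVec i) - toReal f (y * flipVec i * flipVec i)) / 2 *
        ((trans^[2 * n] (toReal f) (y * flipVec i)
          + trans^[2 * n + 1] (toReal f) (y * flipVec i)) / 2)) := by
    intro y
    rw [pathAvg]
    simp only [step, pathAvg_mul_left, pathAvg_add, hA, pathAvg_walk]
    simp only [ite_mul, zero_mul]
    rw [Finset.sum_ite_eq' Finset.univ i, if_pos (Finset.mem_univ i), mul_flipVec_mul_flipVec]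
    ring
  simp only [hy, mean_mul_left]
  rw [mean_flip (fun y => (toReal f y - toReal f (y * flipVec i)) / 2 *
    ((trans^[2 * n] (toReal f) y + trans^[2 * n + 1] (toReal f) y) / 2)), mean_sub_flip_mul]
  ring

/-- The statistic that estimates the error of the hypothesis `h`. -/
noncomputable def errorWindow (f h : Cube n → ℤˣ) (y : Cube n) (_ω : ℕ → Fin n) : ℝ :=
  if h y ≠ f y then 1 else 0

theorem sum_blockValue_errorWindow (f h : Cube n → ℤˣ) (L T N : ℕ) (w : WalkSpace n) :
    ∑ l ∈ Finset.range N, blockValue L (delayed T (errorWindow f h)) w.1 w.2 l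
      = empErr N (fun j => walk w (j * L + T)) (fun j => f (walk w (j * L + T))) h := by
  obtain ⟨x, ω⟩ := w
  simp only [blockValue_delayed, errorWindow]
  rw [empErr, Finset.sum_boole]

theorem mean_pathAvg_errorWindow [NeZero n] (f h : Cube n → ℤˣ) (ℓ : ℕ) :
    mean (fun y => pathAvg ℓ (errorWindow f h y)) = cubeDist h f := by
  rw [cubeDist_eq_mean]
  congr 1
  funext y
  exact pathAvg_const _ _

/-- The function with truth table `T` over the variables `J`. -/
def tableFun {k : ℕ} (J : Fin k → Fin n) (T : Fin (2 ^ k) → ℤˣ) (x : Cube n) : ℤˣ :=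
  T ⟨tableIndex x (List.ofFn J), (tableIndex_lt _ _).trans_eq (by rw [List.length_ofFn])⟩

/-- All statistics of the program are close to their means. -/
structure Typical (k e d : ℕ) (f : Cube n → ℤˣ) (w : WalkSpace n) : Prop where
  influence : ∀ i : Fin n,
    |∑ j ∈ Finset.range (blocksOf n k e d), observed f w (sampleTime n k e j) i
      - blocksOf n k e d * (walkInfluence (toReal f) i / n)| ≤ blocksOf n k e d * (1 / precOf n k e)
  error : ∀ (J : Fin k → Fin n) (T : Fin (2 ^ k) → ℤˣ),
    |(empErr (blocksOf n k e d) (fun j => walk w (sampleTime n k e j))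
      (fun j => f (walk w (sampleTime n k e j))) (tableFun J T) : ℝ)
      - blocksOf n k e d * cubeDist (tableFun J T) f| ≤ blocksOf n k e d * (1 / precOf n k e)

theorem two_pow_le_exp (m : ℕ) : (2 : ℝ) ^ m ≤ Real.exp m := by
  rw [← Real.exp_one_pow]
  have := Real.add_one_le_exp (1 : ℝ)
  gcongr
  linarith

/-- The delay suffices for the walk to mix, up to parity, to half the accuracy of the estimates. -/
theorem two_pow_mul_exp_le [NeZero n] (k e : ℕ) :
    2 ^ n * Real.exp (-(2 * (delayOf n k e : ℕ) / n)) ≤ 1 / (precOf n k e : ℝ) / 2 := by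
  have hn : (n : ℝ) ≠ 0 := Nat.cast_ne_zero.2 (NeZero.ne n)
  have hB : (1 : ℝ) ≤ precOf n k e := by exact_mod_cast one_le_precOf k e
  have hnB : (n : ℝ) ≤ precOf n k e := by exact_mod_cast le_precOf k e
  have e1 : 2 * ((delayOf n k e : ℕ) : ℝ) / n = 2 * precOf n k e := by
    rw [delayOf]
    push_cast
    field_simp
  rw [e1]
  set B : ℝ := (precOf n k e : ℝ)
  have h1 : (2 : ℝ) ^ n ≤ Real.exp B := (two_pow_le_exp n).trans (Real.exp_le_exp.2 hnB)
  have h2 : 2 * B ≤ Real.exp B := by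
    have := Real.quadratic_le_exp_of_nonneg (x := B) (by linarith)
    nlinarith [sq_nonneg (B - 1)]
  calc 2 ^ n * Real.exp (-(2 * B)) ≤ Real.exp B * Real.exp (-(2 * B)) := by gcongr
    _ = 1 / Real.exp B := by
      rw [← Real.exp_add, one_div, ← Real.exp_neg]
      congr 1
      ring
    _ ≤ 1 / (2 * B) := one_div_le_one_div_of_le (by linarith) h2
    _ = _ := by
      field_simp

/-- The number of statistics is small compared to the exponent in the concentration inequality. -/
theorem card_mul_exp_le [NeZero n] {k : ℕ} (hk : 1 ≤ k) (e d : ℕ) :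
    ((n + n ^ k * 2 ^ 2 ^ k : ℕ) : ℝ) *
      (2 * Real.exp (-(blocksOf n k e d * (1 / (precOf n k e : ℝ)) ^ 2 / 64))) ≤ 1 / 2 ^ d := by
  have hB : (1 : ℝ) ≤ precOf n k e := by exact_mod_cast one_le_precOf k e
  have e1 : (blocksOf n k e d : ℝ) * (1 / (precOf n k e : ℝ)) ^ 2 / 64
      = precOf n k e * (d + 1) / 64 := by
    rw [blocksOf_eq]
    push_cast
    field_simp
  have hpow : ((n + n ^ k * 2 ^ 2 ^ k : ℕ) : ℝ) * 2 * 2 ^ d ≤ 2 ^ (n * k + 2 ^ k + 2 + d) := by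
    have h1 : n ≤ 2 ^ (n * k) * 2 ^ 2 ^ k := by
      calc n ≤ 2 ^ n := Nat.lt_two_pow_self.le
        _ ≤ 2 ^ (n * k) := Nat.pow_le_pow_right (by omega) (Nat.le_mul_of_pos_right n hk)
        _ ≤ _ := Nat.le_mul_of_pos_right _ (by positivity)
    have h2 : n ^ k ≤ 2 ^ (n * k) := by
      rw [pow_mul]
      exact Nat.pow_le_pow_left Nat.lt_two_pow_self.le k
    have h3 : n + n ^ k * 2 ^ 2 ^ k ≤ 2 * (2 ^ (n * k) * 2 ^ 2 ^ k) := by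
      have := Nat.mul_le_mul_right (2 ^ 2 ^ k) h2
      omega
    have h4 : (n + n ^ k * 2 ^ 2 ^ k) * 2 * 2 ^ d ≤ 2 ^ (n * k + 2 ^ k + 2 + d) := by
      calc (n + n ^ k * 2 ^ 2 ^ k) * 2 * 2 ^ d
          ≤ 2 * (2 ^ (n * k) * 2 ^ 2 ^ k) * 2 * 2 ^ d := by gcongr
        _ = _ := by ring
    exact_mod_cast h4
  have hexp : 64 * (n * k + 2 ^ k + 2 + d) ≤ precOf n k e * (d + 1) := by
    have hn : 1 ≤ n := NeZero.pos n
    have hk2 : k ≤ 2 ^ k := Nat.lt_two_pow_self.le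
    have h22 : 2 ≤ 2 ^ k := Nat.le_self_pow (by omega) 2
    have h1 : 256 * 2 ^ k ≤ capOf k e := by
      calc 256 * 2 ^ k = 2 ^ (8 + k) := by rw [pow_add]; norm_num
        _ ≤ _ := Nat.pow_le_pow_right (by omega) (by omega)
    have h2 : n * (256 * 2 ^ k) ≤ precOf n k e := Nat.mul_le_mul_left n h1
    have h3 : n * k + 2 ^ k + 2 ≤ n * (3 * 2 ^ k) := by nlinarith
    have h4 : 256 * d ≤ precOf n k e * d := Nat.mul_le_mul_right d (by nlinarith)
    nlinarith
  rw [e1, le_div_iff₀ (by positivity), mul_assoc, mul_assoc, mul_comm (Real.exp _), ← mul_assoc,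
    ← mul_assoc, Real.exp_neg, ← div_eq_mul_inv, div_le_one (Real.exp_pos _)]
  refine hpow.trans ((two_pow_le_exp _).trans (Real.exp_le_exp.2 ?_))
  rw [le_div_iff₀ (by norm_num), mul_comm]
  exact_mod_cast hexp

theorem two_dvd_precOf {k : ℕ} (hk : 1 ≤ k) (e : ℕ) : 2 ∣ precOf n k e :=
  Dvd.dvd.mul_left (dvd_pow_self 2 (by omega)) n

/-- With probability at least `1 - δ`, all statistics are close to their means. -/
theorem le_walkMeasure_typical [NeZero n] {k : ℕ} (hk : 1 ≤ k) (e : ℕ) {δ : ℝ} (hδ : 0 < δ)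
    (f : Cube n → ℤˣ) :
    1 - δ ≤ (walkMeasure n).real {w | Typical k e (firstDigit δ) f w} := by
  classical
  set d := firstDigit δ with hd
  set N := blocksOf n k e d with hN
  set T := delayOf n k e with hT
  set L := blockLen n T with hL
  set a : ℝ := 1 / precOf n k e with ha
  have hB : (1 : ℝ) ≤ precOf n k e := by exact_mod_cast one_le_precOf k e
  have ha0 : 0 ≤ a := by positivity
  have ha4 : a ≤ 4 := ((div_le_one (by linarith)).2 hB).trans (by norm_num)
  have hodd : Odd L := by
    have : 2 ∣ T := Dvd.dvd.mul_left (two_dvd_precOf hk e) n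
    rw [Nat.odd_iff, hL, blockLen]
    omega
  have heven : Even N := by
    rw [even_iff_two_dvd, hN, blocksOf_eq]
    exact ((two_dvd_precOf hk e).trans (dvd_pow_self _ (by norm_num))).mul_right _
  -- one statistic for each variable, and one for each hypothesis
  let ι := Fin n ⊕ ((Fin k → Fin n) × (Fin (2 ^ k) → ℤˣ))
  let G : ι → Cube n → (ℕ → Fin n) → ℝ :=
    Sum.elim (influenceWindow f) fun p => errorWindow f (tableFun p.1 p.2)
  have hG : ∀ s y, DependsOn (2 * n + 2) (G s y) := by
    rintro (i | p) y
    · exact dependsOn_influenceWindow f i y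
    · exact fun _ _ _ => rfl
  have hGb : ∀ s y ω, |G s y ω| ≤ 1 := by
    rintro (i | p) y ω
    · exact abs_influenceWindow_le f i y ω
    · simp only [G, Sum.elim_inr, errorWindow]
      split_ifs <;> simp
  have hTL : T + (2 * n + 2) ≤ L := by
    rw [hL, blockLen]
    omega
  let dev : ι → Cube n → (ℕ → Fin n) → Prop := fun s x ω =>
    N * a < |∑ l ∈ Finset.range N, blockValue L (delayed T (G s)) x ω l
      - N * mean fun y => pathAvg (2 * n + 2) (G s y)|
  have key := one_sub_le_walkMeasure (n := n) (m := N * L) (P := fun x ω => ∃ s, dev s x ω)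
    (fun x ω ω' h => by
      have : ∀ s, dev s x ω = dev s x ω' := fun s => by
        simp only [dev]
        rw [Finset.sum_congr rfl fun l hl => dependsOn_blockValue
          (dependsOn_delayed (hG s) hTL) x (Finset.mem_range.1 hl) ω ω' h]
      simp only [this]) (δ := δ) hδ.le (fun x => by
      refine le_trans (pathAvg_mono _ (G := fun ω => ∑ s, if dev s x ω then (1 : ℝ) else 0)
        fun ω => ?_) ?_
      · have h0 : ∀ s ∈ Finset.univ, (0 : ℝ) ≤ if dev s x ω then (1 : ℝ) else 0 :=
          fun s _ => by split_ifs <;> norm_num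
        split_ifs with h
        · obtain ⟨s, hs⟩ := h
          refine le_trans ?_ (Finset.single_le_sum h0 (Finset.mem_univ s))
          rw [if_pos hs]
        · exact Finset.sum_nonneg h0
      calc pathAvg (N * L) (fun ω => ∑ s, if dev s x ω then (1 : ℝ) else 0)
          = ∑ s, pathAvg (N * L) (fun ω => if dev s x ω then (1 : ℝ) else 0) := by
            rw [pathAvg_sum]
        _ ≤ ∑ _s : ι, 2 * Real.exp (-(N * a ^ 2 / 64)) :=
            Finset.sum_le_sum fun s _ => pathAvg_deviation_le (hG s) hTL hodd heven (hGb s) ha0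
              ha4 (two_pow_mul_exp_le k e) x
        _ ≤ 1 / 2 ^ d := by
            have hu : Fintype.card ℤˣ = 2 := by decide
            have hcard : Fintype.card ι = n + n ^ k * 2 ^ 2 ^ k := by
              simp only [ι, Fintype.card_sum, Fintype.card_prod, Fintype.card_fun,
                Fintype.card_fin, hu]
            rw [Finset.sum_const, nsmul_eq_mul, Finset.card_univ, hcard]
            exact card_mul_exp_le hk e d
        _ ≤ δ := by
            have := one_le_mul_two_pow_firstDigit hδ
            rw [div_le_iff₀ (by positivity)]
            exact this.trans (by gcongr; exact min_le_left _ _))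
  have hset : {w : WalkSpace n | ¬ ∃ s, dev s w.1 w.2} ⊆ {w | Typical k e d f w} := by
    intro w hw
    have hw' : ∀ s, ¬ dev s w.1 w.2 := not_exists.1 hw
    constructor
    · intro i
      have := not_lt.1 (hw' (.inl i))
      simp only [G, Sum.elim_inl, blockValue_influenceWindow,
        mean_pathAvg_influenceWindow] at this
      exact this
    · intro J U
      have := not_lt.1 (hw' (.inr (J, U)))
      simp only [G, Sum.elim_inr, sum_blockValue_errorWindow, mean_pathAvg_errorWindow] at this
      exact this
  have : IsProbabilityMeasure (walkMeasure n) := by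
    unfold walkMeasure
    infer_instance
  exact key.trans (measureReal_mono hset)

/-! ### Accuracy of the hypothesis -/

theorem exists_digits {k r : ℕ} (a : Fin k → Fin r) :
    ∃ c < r ^ k, ∀ l : Fin k, c / r ^ (l : ℕ) % r = a l := by
  refine ⟨finFunctionFinEquiv a, (finFunctionFinEquiv a).2, fun l => ?_⟩
  have := congrFun (finFunctionFinEquiv.symm_apply_apply a) l
  exact congrArg Fin.val this

/-- Every set of at most `k` candidate variables is covered by one of the tuples. -/
theorem exists_tuple {k r : ℕ} (hr : 1 ≤ r) {R : ℕ → Fin n} {J : Finset (Fin n)}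
    (hJ : J.card ≤ k) (hR : ∀ i ∈ J, ∃ l < r, R l = i) :
    ∃ c < r ^ k, ∀ i ∈ J, i ∈ tuple k r R c := by
  choose! l hl hRl using hR
  obtain ⟨c, hc, hdig⟩ := exists_digits (k := k) (r := r) fun m =>
    if hm : (m : ℕ) < J.toList.length then
      ⟨l (J.toList[m]), hl _ (Finset.mem_toList.1 (List.getElem_mem hm))⟩ else ⟨0, hr⟩
  refine ⟨c, hc, fun i hi => ?_⟩
  obtain ⟨m, hm, rfl⟩ := List.mem_iff_getElem.1 (Finset.mem_toList.2 hi)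
  have hmk : m < k := hm.trans_le ((Finset.length_toList J).trans_le hJ)
  have := hdig ⟨m, hmk⟩
  simp only [hm, dite_true] at this
  refine List.mem_map.2 ⟨m, List.mem_range.2 hmk, ?_⟩
  rw [this]
  exact hRl _ hi

theorem tableIndex_inj {x y : Cube n} {J : List (Fin n)} (h : tableIndex x J = tableIndex y J) :
    ∀ i ∈ J, x i = y i := by
  induction J with
  | nil => simp
  | cons j J ih =>
    rw [tableIndex, tableIndex] at h
    have hx := signBit_le_one (x j)
    have hy := signBit_le_one (y j)
    intro i hi
    rcases List.mem_cons.1 hi with rfl | hi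
    · exact signBit_inj.1 (by omega)
    · exact ih (by omega) i hi

/-- A function of the variables in `J` has a truth table over `J`. -/
theorem exists_table {g : Cube n → ℤˣ} {J : List (Fin n)}
    (hg : ∀ x y : Cube n, (∀ i ∈ J, x i = y i) → g x = g y) :
    ∃ T : ℕ → ℤˣ, g = fun x => T (tableIndex x J) := by
  have h : Function.FactorsThrough g fun x => tableIndex x J :=
    fun x y hxy => hg x y (tableIndex_inj hxy)
  exact ⟨Function.extend (fun x => tableIndex x J) g fun _ => 1,
    funext fun x => (h.extend_apply _ x).symm⟩

theorem Typical.abs_empErr_sub_le {k e d : ℕ} {f : Cube n → ℤˣ} {w : WalkSpace n}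
    (h : Typical k e d f w) (r : ℕ) (R : ℕ → Fin n) (c : ℕ) (T : ℕ → ℤˣ) :
    |(empErr (blocksOf n k e d) (fun j => walk w (sampleTime n k e j))
      (fun j => f (walk w (sampleTime n k e j)))
      (fun x => T (tableIndex x (tuple k r R c))) : ℝ)
      - blocksOf n k e d * cubeDist (fun x => T (tableIndex x (tuple k r R c))) f|
      ≤ blocksOf n k e d * (1 / precOf n k e) := by
  have hJ : List.ofFn (fun l : Fin k => R (c / r ^ (l : ℕ) % r)) = tuple k r R c := by
    refine List.ext_getElem (by simp [tuple]) fun i h₁ h₂ => ?_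
    simp [tuple]
  have := h.error (fun l => R (c / r ^ (l : ℕ) % r)) fun m => T m
  have e : tableFun (fun l : Fin k => R (c / r ^ (l : ℕ) % r)) (fun m => T m)
      = fun x => T (tableIndex x (tuple k r R c)) := by
    funext x
    exact congrArg (fun t => T (tableIndex x t)) hJ
  rwa [e] at this

section accuracy

variable [NeZero n] {k e d : ℕ} {f : Cube n → ℤˣ} {w : WalkSpace n}

theorem blocksOf_mul_div (k e d : ℕ) :
    (blocksOf n k e d : ℝ) * (1 / precOf n k e) = thrOf n k e d := by
  have hB : (precOf n k e : ℝ) ≠ 0 := by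
    have := one_le_precOf (n := n) k e
    exact_mod_cast (by omega : precOf n k e ≠ 0)
  rw [blocksOf]
  push_cast
  field_simp

theorem blocksOf_mul_influence (k e d : ℕ) (a : ℝ) :
    (blocksOf n k e d : ℝ) * (a / n) = thrOf n k e d * (capOf k e * a) := by
  have hn : (n : ℝ) ≠ 0 := Nat.cast_ne_zero.2 (NeZero.ne n)
  rw [blocksOf, precOf]
  push_cast
  field_simp

theorem thrOf_pos (k e d : ℕ) : (0 : ℝ) < thrOf n k e d := by
  have := one_le_precOf (n := n) k e
  have : 0 < thrOf n k e d := Nat.mul_pos (pow_pos this 2) (Nat.succ_pos d)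
  exact_mod_cast this

theorem Typical.one_le_of_candidate (h : Typical k e d f w) {i : Fin n} (hn : 4 * k < n)
    (hi : (i : ℕ) ≠ 0) (hc : Candidate k e d f w i) :
    1 ≤ capOf k e * walkInfluence (toReal f) i := by
  have h1 := abs_le.1 (h.influence i)
  rw [blocksOf_mul_div, blocksOf_mul_influence] at h1
  rcases hc with hc | hc | hc
  · exact absurd hc hi
  · omega
  · have h2 : (thrOf n k e d : ℝ) * 1 ≤
        thrOf n k e d * (capOf k e * walkInfluence (toReal f) i) := by
      linarith [h1.2]
    exact le_of_mul_le_mul_left h2 (thrOf_pos k e d)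

theorem Typical.lt_three_of_not_candidate (h : Typical k e d f w) {i : Fin n}
    (hc : ¬ Candidate k e d f w i) : capOf k e * walkInfluence (toReal f) i < 3 := by
  have h1 := abs_le.1 (h.influence i)
  rw [blocksOf_mul_div, blocksOf_mul_influence] at h1
  simp only [Candidate, not_or, not_le] at hc
  have h2 : (thrOf n k e d : ℝ) * (capOf k e * walkInfluence (toReal f) i) < thrOf n k e d * 3 := by
    linarith [h1.1, hc.2.2]
  exact lt_of_mul_lt_mul_left h2 (thrOf_pos k e d).le

open scoped Classical in
/-- The candidate variables fit into the list. -/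
theorem Typical.card_candidate_le (h : Typical k e d f w) (hk : 1 ≤ k) :
    (Finset.univ.filter (Candidate k e d f w)).card ≤ capOf k e := by
  have hcap : 20 * k + 2 * e < capOf k e := Nat.lt_two_pow_self
  rcases le_or_gt n (4 * k) with hn | hn
  · have := Finset.card_le_univ (Finset.univ.filter (Candidate k e d f w))
    rw [Fintype.card_fin] at this
    omega
  · set A := Finset.univ.filter fun i : Fin n => 1 ≤ capOf k e * walkInfluence (toReal f) i
    have hsub : Finset.univ.filter (Candidate k e d f w) ⊆ insert 0 A := by
      intro i hi
      rw [Finset.mem_filter] at hi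
      by_cases hi0 : (i : ℕ) = 0
      · exact Finset.mem_insert.2 (.inl (Fin.ext (by simpa using hi0)))
      · exact Finset.mem_insert_of_mem (Finset.mem_filter.2
          ⟨Finset.mem_univ i, h.one_le_of_candidate hn hi0 hi.2⟩)
    have hA : (A.card : ℝ) ≤ capOf k e * (1 / 4) := by
      calc (A.card : ℝ) = ∑ _i ∈ A, (1 : ℝ) := by simp
        _ ≤ ∑ i ∈ A, capOf k e * walkInfluence (toReal f) i :=
            Finset.sum_le_sum fun i hi => (Finset.mem_filter.1 hi).2
        _ ≤ ∑ i, capOf k e * walkInfluence (toReal f) i :=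
            Finset.sum_le_sum_of_subset_of_nonneg (Finset.subset_univ _) fun i _ _ =>
              mul_nonneg (Nat.cast_nonneg _) (walkInfluence_nonneg _ i)
        _ ≤ _ := by
            rw [← Finset.mul_sum]
            gcongr
            exact sum_walkInfluence_le f
    have hA' : 4 * A.card ≤ capOf k e := by
      have : (4 : ℝ) * A.card ≤ capOf k e := by linarith
      exact_mod_cast this
    have := (Finset.card_le_card hsub).trans (Finset.card_insert_le _ _)
    omega

/-- Variables that are not candidates have so little low-degree weight that they can be dropped. -/
theorem Typical.lowWeight_le (h : Typical k e d f w) {i : Fin n}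
    (hc : ¬ Candidate k e d f w i) :
    lowWeight (toReal f) k i ≤ 4 * 4 ^ (8 * k) / capOf k e := by
  have hcap : (0 : ℝ) < capOf k e := by exact_mod_cast one_le_capOf k e
  have hn : 4 * k < n := by
    simp only [Candidate, not_or, not_le] at hc
    exact hc.2.1
  have h1 := JuntaWalk.lowWeight_le (toReal f) hn i
  have h2 := h.lt_three_of_not_candidate hc
  rw [le_div_iff₀ hcap]
  calc lowWeight (toReal f) k i * capOf k e
      ≤ 4 / 3 * 4 ^ (8 * k) * walkInfluence (toReal f) i * capOf k e := by gcongr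
    _ = 4 / 3 * 4 ^ (8 * k) * (capOf k e * walkInfluence (toReal f) i) := by ring
    _ ≤ 4 / 3 * 4 ^ (8 * k) * 3 := by gcongr
    _ = _ := by ring

/-- The loss in accuracy from dropping all variables that are not candidates. -/
theorem sqrt_dropped_le (hk : 1 ≤ k) (e : ℕ) :
    √(k * (4 * 4 ^ (8 * k) / capOf k e)) / 2 ≤ 1 / 4 * (1 / 2 ^ e) := by
  have h16 : 16 * k ≤ 16 ^ k := by
    obtain ⟨m, rfl⟩ := Nat.exists_eq_add_of_le' hk
    have : m < 16 ^ m := Nat.lt_pow_self (by norm_num)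
    rw [pow_succ]
    omega
  have h16' : (16 : ℝ) * k ≤ 16 ^ k := by exact_mod_cast h16
  have e1 : (capOf k e : ℝ) = 4 ^ (8 * k) * 16 ^ k * (2 ^ e) ^ 2 := by
    rw [capOf, show (4 : ℝ) = 2 ^ 2 by norm_num, show (16 : ℝ) = 2 ^ 4 by norm_num, ← pow_mul,
      ← pow_mul, ← pow_mul, ← pow_add, ← pow_add]
    push_cast
    congr 1
    ring
  have h1 : √(k * (4 * 4 ^ (8 * k) / capOf k e)) ≤ 1 / 2 * (1 / 2 ^ e) := by
    rw [Real.sqrt_le_left (by positivity), e1]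
    have e2 : (k : ℝ) * (4 * 4 ^ (8 * k) / (4 ^ (8 * k) * 16 ^ k * (2 ^ e) ^ 2))
        = 4 * k / 16 ^ k * (1 / 2 ^ e) ^ 2 := by
      field_simp
    have h2 : (4 : ℝ) * k / 16 ^ k ≤ (1 / 2) ^ 2 := by
      rw [div_le_iff₀ (by positivity)]
      linarith
    rw [e2, mul_pow]
    gcongr
  linarith

/-- If all statistics are close to their means, then the hypothesis is nearly optimal. -/
theorem cubeDist_hypothesis_le (hk : 1 ≤ k) {ε : ℝ} (hε : 0 < ε)
    (h : Typical k (firstDigit ε) d f w) {r c : ℕ} {R : ℕ → Fin n}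
    (hout : Outcome k (firstDigit ε) d f w r R c) :
    cubeDist (hypothesis k (firstDigit ε) d f w r R c) f ≤ optJunta k f + ε := by
  classical
  set e := firstDigit ε
  set N := blocksOf n k e d with hN
  set X : ℕ → Cube n := fun j => walk w (sampleTime n k e j) with hX
  set Y : ℕ → ℤˣ := fun j => f (walk w (sampleTime n k e j)) with hY
  suffices hs : ∀ g, IsJunta k g →
      cubeDist (hypothesis k e d f w r R c) f - ε ≤ cubeDist g f by
    linarith [le_optJunta hs]
  intro g hg
  have hcap : (0 : ℝ) < capOf k e := by exact_mod_cast one_le_capOf k e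
  obtain ⟨J, hJR, hJ, hdist⟩ := exists_bestOn_close f g hg
    (Finset.univ.filter (Candidate k e d f w)) (b := 4 * 4 ^ (8 * k) / capOf k e)
    (fun i hi => h.lowWeight_le fun hc => hi (Finset.mem_filter.2 ⟨Finset.mem_univ i, hc⟩))
    (by positivity)
  obtain ⟨c', hc', hcov⟩ := exists_tuple hout.r_pos hJ fun i hi =>
    hout.covers (h.card_candidate_le hk) i (Finset.mem_filter.1 (hJR hi)).2
  obtain ⟨T, hT⟩ := exists_table (g := bestOn f J) (J := tuple k r R c')
    fun x y hxy => bestOn_congr f fun i hi => hxy i (hcov i hi)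
  have h1 := (abs_le.1 (h.abs_empErr_sub_le r R c' T)).2
  have h2 := (abs_le.1 (h.abs_empErr_sub_le r R c (majority N X Y (tuple k r R c)))).1
  rw [← hT] at h1
  change _ ≤ (empErr N X Y (hypothesis k e d f w r R c) : ℝ)
    - N * cubeDist (hypothesis k e d f w r R c) f at h2
  have h3 : empErr N X Y (hypothesis k e d f w r R c) ≤ empErr N X Y (bestOn f J) := by
    calc empErr N X Y (hypothesis k e d f w r R c) = bestErr k N X Y (tuple k r R c) :=
          (bestErr_eq_empErr N X Y (length_tuple k r R c)).symm
      _ ≤ bestErr k N X Y (tuple k r R c') := hout.minimal c' hc'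
      _ ≤ empErr N X Y (bestOn f J) := by
          rw [hT]
          exact bestErr_le_empErr N X Y (length_tuple k r R c') T
  have h3' : (empErr N X Y (hypothesis k e d f w r R c) : ℝ) ≤ empErr N X Y (bestOn f J) := by
    exact_mod_cast h3
  have hN0 : (0 : ℝ) < N := by
    have : 0 < N := by
      rw [hN, blocksOf_eq]
      exact Nat.mul_pos (pow_pos (one_le_precOf k e) 3) (Nat.succ_pos d)
    exact_mod_cast this
  have h4 : cubeDist (hypothesis k e d f w r R c) f
      ≤ cubeDist (bestOn f J) f + 2 * (1 / precOf n k e) := by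
    refine le_of_mul_le_mul_left ?_ hN0
    linarith
  -- `1/4 * 2 ^ (-e)` for the dropped variables and `1/2 * 2 ^ (-e)` for the two estimates
  have h5 := sqrt_dropped_le hk e
  have h6 : 2 * (1 / (precOf n k e : ℝ)) ≤ 1 / 2 * (1 / 2 ^ e) := by
    have h7 : 2 ^ 2 * 2 ^ e ≤ precOf n k e := by
      refine le_trans ?_ (capOf_le_precOf k e)
      rw [← pow_add]
      exact Nat.pow_le_pow_right (by omega) (by omega)
    have h8 : (4 : ℝ) * 2 ^ e ≤ precOf n k e := by
      have : ((2 ^ 2 * 2 ^ e : ℕ) : ℝ) ≤ precOf n k e := by exact_mod_cast h7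
      push_cast at this
      linarith
    calc 2 * (1 / (precOf n k e : ℝ)) ≤ 2 * (1 / (4 * 2 ^ e)) := by gcongr
      _ = _ := by
        field_simp
        norm_num
  have h9 : 1 / 2 ^ e ≤ ε := by
    rw [div_le_iff₀ (by positivity)]
    exact (one_le_mul_two_pow_firstDigit hε).trans (by gcongr; exact min_le_left _ _)
  have h10 : (0 : ℝ) ≤ 1 / 2 ^ e := by positivity
  linarith

end accuracy

end JuntaWalk

open JuntaWalk in
theorem theorem1 :
    ∃ (p : Prog) (q : MvPolynomial (Fin 4) ℕ),
      ∀ (n : ℕ) [NeZero n] (k : ℕ), 1 ≤ k → ∀ ε δ : ℝ, 0 < ε → 0 < δ →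
        ∀ f : Cube n → ℤˣ,
          ∃ h : WalkSpace n → (Cube n → ℤˣ),
            (∀ w : WalkSpace n, ∃ (t : ℕ) (l : List ℕ),
              HaltsWith p k ε δ f w t l ∧ IsJuntaCode k l (h w) ∧
              (t : ℝ) ≤ MvPolynomial.aeval
                ![(n : ℝ), (2 : ℝ) ^ (k ^ 2), (1 / ε) ^ k, Real.log (1 / δ)] q) ∧
            (∀ w : WalkSpace n, IsJunta k (h w)) ∧
            1 - δ ≤ (walkMeasure n).real
              {w : WalkSpace n | cubeDist (h w) f ≤ optJunta k f + ε} := by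
  obtain ⟨q, hq⟩ := exists_polynomial_le
  refine ⟨learner, q, fun n _ k hk ε δ hε hδ f => ?_⟩
  choose t l r R c hrun ht hout hcode using fun w => runs_learner hk hε hδ f w
  refine ⟨fun w => hypothesis k (firstDigit ε) (firstDigit δ) f w (r w) (R w) (c w),
    fun w => ⟨t w, l w, hrun w, hcode w, hq n k hk ε δ hε hδ (t w) (ht w)⟩,
    fun w => isJunta_hypothesis _ _ _ _ _ _ _ _, ?_⟩
  have : IsProbabilityMeasure (walkMeasure n) := by
    unfold walkMeasure
    infer_instance
  exact (le_walkMeasure_typical hk (firstDigit ε) hδ f).trans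
    (measureReal_mono fun w hw => cubeDist_hypothesis_le hk hε hw (hout w))
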